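/- Let $\mathbb{K}$ be a field, and count operations $+,-,\times,/$ in $\mathbb{K}$ at unit cost. Let $\mathsf{M}(\cdot)$ be a multiplication time function for $\mathbb{K}[X]$: polynomials of degree at most $d$ can be multiplied using $\mathsf{M}(d)$ operations in $\mathbb{K}$, and $\mathsf{M}$ is super-linear, that is, $\mathsf{M}(a)/a\le \mathsf{M}(b)/b$ for $1\le a\le b$, and $\mathsf{M}(d)\ge d$ for $d\ge 1$. Let $\mathsf{MM}(m,d)$, for $m,d\ge 1$, be such that $m\times m$ matrices over $\mathbb{K}[X]$ of degree at most $d$ can be multiplied using $\mathsf{MM}(m,d)$ operations in $\mathbb{K}$, and such that $\mathsf{MM}(m,a)/a\le\mathsf{MM}(m,b)/b$ for $1\le a\le b$; for real $d\ge 1$ put $\mathsf{MM}(m,d)=\mathsf{MM}(m,\lfloor d\rfloor)$. Let $\mathbf{J}\in\mathbb{K}^{\sigma\times\sigma}$ be a Jordan matrix (with ones above the diagonal in each block) given in standard representation, that is, by pairs (eigenvalue, block size) $$((x_1,\sigma_{1,1}),\dots,(x_1,\sigma_{1,r_1}),\dots,(x_t,\sigma_{t,1}),\dots,(x_t,\sigma_{t,r_t}))$$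 with $x_1,\dots,x_t$ pairwise distinct, $r_1\ge\cdots\ge r_t\ge 1$, and $\sigma_{i,1}\ge\cdots\ge\sigma_{i,r_i}\ge 1$ for all $i$; thus $\sigma=\sum_{i,j}\sigma_{i,j}$. For $\mathbf{P}=[p_{i,j}]\in\mathbb{K}[X]^{m\times m}$ with $m\ge1$ and $\mathbf{E}\in\mathbb{K}^{m\times\sigma}$ with rows $\mathbf{e}_1,\dots,\mathbf{e}_m$, the residual $\mathbf{P}\cdot\mathbf{E}\in\mathbb{K}^{m\times\sigma}$ is the matrix whose $i$-th row is $\sum_j \mathbf{e}_j\,p_{i,j}(\mathbf{J})$. The degree of the $i$-th row of $\mathbf{P}$ is $\max_j\deg p_{i,j}$ (counted as $0$ for a zero row). There is a deterministic algorithm which, given $\mathbf{J}$ in standard representation, $\mathbf{P}$ and $\mathbf{E}$, computes $\mathbf{P}\cdot\mathbf{E}$. If $\sigma\ge m$ and the sum of the row degrees of $\mathbf{P}$ is in $O(\sigma)$, this algorithm uses $$O\bigl(\mathsf{MM}(m,\sigma/m)\,(1+\log_2(\sigma/m))+m\,\mathsf{M}(\sigma)\,(1+\log_2\sigma)\bigr)$$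 operations in $\mathbb{K}$; that is, for every $c$ there is a constant $C$ depending only on $c$ such that, whenever $\sigma\ge m$ and the sum of the row degrees of $\mathbf{P}$ is at most $c\,\sigma$, the number of operations is at most $C$ times the expression in parentheses. -/

import Mathlib

namespace AlgCost

/-! ### Straight-line programs over a field, counting field operations -/

/-- The four arithmetic operations of a field. -/
inductive Op where
  | add | sub | mul | div

/-- An instruction of a straight-line program.  Every instruction appends one field element to the
memory: `const k` appends a constant, and `op o i j` appends the result of the operation `o`
on the memory cells `i` and `j`. -/
inductive Instr where
  | const (k : ℕ)
  | op (o : Op) (i j : ℕ)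

/-- A straight-line program: a list of instructions, and the list of the memory cells that form
the output. -/
abbrev Program := List Instr × List ℕ

/-- Operations as elements of a four-element type (used only to encode programs by numbers). -/
def opEquiv : Op ≃ Fin 4 where
  toFun
    | .add => 0
    | .sub => 1
    | .mul => 2
    | .div => 3
  invFun
    | 0 => .add
    | 1 => .sub
    | 2 => .mul
    | 3 => .div
  left_inv o := by cases o <;> rfl
  right_inv i := by fin_cases i <;> rfl

/-- Instructions as a sum type (used only to encode programs by numbers). -/
def instrEquiv : Instr ≃ ℕ ⊕ (Fin 4 × ℕ × ℕ) where
  toFun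
    | .const k => .inl k
    | .op o i j => .inr (opEquiv o, i, j)
  invFun
    | .inl k => .const k
    | .inr (o, i, j) => .op (opEquiv.symm o) i j
  left_inv a := by cases a <;> simp
  right_inv a := by rcases a with k | ⟨o, i, j⟩ <;> simp

instance instPrimcodableInstr : Primcodable Instr := Primcodable.ofEquiv _ instrEquiv

/-- Number of field operations of one instruction: loading a constant is free. -/
def Instr.cost : Instr → ℕ
  | .const _ => 0
  | .op _ _ _ => 1

/-- The number of field operations (additions, subtractions, multiplications, divisions) that a
straight-line program performs. -/
def Program.cost (p : Program) : ℕ := (p.1.map Instr.cost).sum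

section Semantics

variable {K : Type*} [Field K]

open Classical in
/-- The result of an arithmetic operation; a division by zero fails. -/
noncomputable def Op.eval (o : Op) (a b : K) : Option K :=
  match o with
  | .add => some (a + b)
  | .sub => some (a - b)
  | .mul => some (a * b)
  | .div => if b = 0 then none else some (a / b)

/-- The constants that programs may load: `0`, `1`, and the members of a given sequence `κ`
of further constants of the field (roots of unity, for example). -/
def constant (κ : ℕ → K) : ℕ → K
  | 0 => 0
  | 1 => 1
  | k + 2 => κ k

/-- The value that an instruction computes from the memory; reading outside of the memory fails. -/
noncomputable def Instr.eval (κ : ℕ → K) (mem : List K) : Instr → Option K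
  | .const k => some (constant κ k)
  | .op o i j => do
      let a ← mem[i]?
      let b ← mem[j]?
      o.eval a b

/-- Execution of a list of instructions: each one appends its value to the end of the memory. -/
noncomputable def runCode (κ : ℕ → K) : List Instr → List K → Option (List K)
  | [], mem => some mem
  | c :: cs, mem => do
      let v ← c.eval κ mem
      runCode κ cs (mem ++ [v])

/-- Execution of a program on an input: the memory initially holds the input; at the end the output
cells are read.  The value is `none` if some step fails. -/
noncomputable def Program.eval (κ : ℕ → K) (p : Program) (input : List K) : Option (List K) := do
  let mem ← runCode κ p.1 input
  p.2.mapM fun i => mem[i]?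

/-! ### Dense representations -/

/-- The coefficients of degree `0, …, n - 1` of a polynomial. -/
def polyCoeffs (p : Polynomial K) (n : ℕ) : List K := (List.range n).map p.coeff

/-- The entries of a polynomial matrix, row by row, the entries of the row `i` being given by their
coefficients of degree `0, …, d i`. -/
def matCoeffs {m n : ℕ} (A : Matrix (Fin m) (Fin n) (Polynomial K)) (d : Fin m → ℕ) : List K :=
  (List.finRange m).flatMap fun i => (List.finRange n).flatMap fun j => polyCoeffs (A i j) (d i + 1)

/-! ### Multiplication time functions -/

/-- `M` is a multiplication time function for `K[X]`: some algorithm (a computable family of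
straight-line programs) multiplies polynomials of degree at most `d` using at most `M d`
operations in `K`, and `M` is super-linear. -/
structure IsPolyMulTime (κ : ℕ → K) (M : ℕ → ℝ) : Prop where
  exists_algorithm : ∃ mul : ℕ → Program, Computable mul ∧ ∀ d : ℕ, 1 ≤ d →
    ((mul d).cost : ℝ) ≤ M d ∧
    ∀ p q : Polynomial K, p.natDegree ≤ d → q.natDegree ≤ d →
      (mul d).eval κ (polyCoeffs p (d + 1) ++ polyCoeffs q (d + 1)) =
        some (polyCoeffs (p * q) (2 * d + 1))
  superlinear : ∀ a b : ℕ, 1 ≤ a → a ≤ b → M a / a ≤ M b / b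
  le_self : ∀ d : ℕ, 1 ≤ d → (d : ℝ) ≤ M d

/-- `MM` is a multiplication time function for square matrices over `K[X]`: some algorithm
multiplies `m × m` matrices of degree at most `d` using at most `MM m d` operations in `K`, and
`d ↦ MM m d` is super-linear. -/
structure IsMatMulTime (κ : ℕ → K) (MM : ℕ → ℕ → ℝ) : Prop where
  exists_algorithm : ∃ mul : ℕ → ℕ → Program, Computable₂ mul ∧ ∀ m d : ℕ, 1 ≤ m → 1 ≤ d →
    ((mul m d).cost : ℝ) ≤ MM m d ∧
    ∀ A B : Matrix (Fin m) (Fin m) (Polynomial K),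
      (∀ i j, (A i j).natDegree ≤ d) → (∀ i j, (B i j).natDegree ≤ d) →
      (mul m d).eval κ (matCoeffs A (fun _ => d) ++ matCoeffs B (fun _ => d)) =
        some (matCoeffs (A * B) (fun _ => 2 * d))
  superlinear : ∀ m a b : ℕ, 1 ≤ m → 1 ≤ a → a ≤ b → MM m a / a ≤ MM m b / b

/-! ### Jordan matrices in standard representation -/

/-- A description of a Jordan matrix: for each eigenvalue `x i`, the list of the sizes
`σ i 1, …, σ i (r i)` of its Jordan blocks. -/
abbrev JordanRep (K : Type*) := List (K × List ℕ)

/-- The representation is standard: the eigenvalues are pairwise distinct, `r 1 ≥ r 2 ≥ …`, and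
`σ i 1 ≥ σ i 2 ≥ …` for every `i`; every eigenvalue has a block and the blocks are not empty. -/
structure JordanRep.IsStandard (L : JordanRep K) : Prop where
  nodup : (L.map Prod.fst).Nodup
  counts : (L.map fun e => e.2.length).Pairwise (· ≥ ·)
  sizes : ∀ e ∈ L, e.2.Pairwise (· ≥ ·)
  ne_nil : ∀ e ∈ L, e.2 ≠ []
  pos : ∀ e ∈ L, ∀ s ∈ e.2, 1 ≤ s

/-- The eigenvalues `x 1, …, x t`. -/
def JordanRep.points (L : JordanRep K) : List K := L.map Prod.fst

/-- The block sizes, grouped by eigenvalue: the part of the description that consists of integers. -/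
def JordanRep.shape (L : JordanRep K) : List (List ℕ) := L.map Prod.snd

/-- The list of all Jordan blocks (eigenvalue, size). -/
def JordanRep.blocks (L : JordanRep K) : List (K × ℕ) :=
  L.flatMap fun e => e.2.map fun s => (e.1, s)

/-- The order `σ` of the Jordan matrix: the sum of the sizes of all its blocks. -/
def JordanRep.order (L : JordanRep K) : ℕ := (L.blocks.map Prod.snd).sum

/-- The rows and columns of the Jordan matrix: a block and a position inside of that block. -/
abbrev JordanRep.Index (L : JordanRep K) : Type :=
  (b : Fin L.blocks.length) × Fin (L.blocks.get b).2

/-- The Jordan block with eigenvalue `x` and size `s` (ones above the diagonal). -/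
def jordanBlock (x : K) (s : ℕ) : Matrix (Fin s) (Fin s) K :=
  Matrix.of fun i j => if i = j then x else if (i : ℕ) + 1 = j then 1 else 0

/-- The Jordan matrix described by a representation. -/
def JordanRep.toMatrix (L : JordanRep K) : Matrix L.Index L.Index K :=
  Matrix.blockDiagonal' fun b => jordanBlock (L.blocks.get b).1 (L.blocks.get b).2

/-! ### Residuals -/

/-- The residual `P · E`: its row `i` is `∑ j, p i j · e j`, where `e j` is the row `j` of `E`,
and `p · e = e p(J)` for a polynomial `p` and a row vector `e`. -/
noncomputable def residualMatrix {m : ℕ} {ι : Type*} [Fintype ι] [DecidableEq ι] (J : Matrix ι ι K)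
    (P : Matrix (Fin m) (Fin m) (Polynomial K)) (E : Matrix (Fin m) ι K) : Matrix (Fin m) ι K :=
  Matrix.of fun i => ∑ j, Matrix.vecMul (E j) (Polynomial.aeval J (P i j))

/-- The degree of the row `i` of a polynomial matrix (`0` if the row is zero). -/
noncomputable def rowDegree {m : ℕ} (P : Matrix (Fin m) (Fin m) (Polynomial K)) (i : Fin m) : ℕ :=
  Finset.univ.sup fun j => (P i j).natDegree

/-- The entries of a matrix with `m` rows whose columns are indexed as those of the Jordan matrix,
row by row. -/
def entries (L : JordanRep K) {m : ℕ} (E : Matrix (Fin m) L.Index K) : List K :=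
  (List.finRange m).flatMap fun i => (List.finRange L.blocks.length).flatMap fun b =>
    (List.finRange (L.blocks.get b).2).map fun l => E i ⟨b, l⟩

/-- The field elements that form the input of the residual computation: the eigenvalues, the dense
representation of `P`, and the entries of `E`. -/
noncomputable def residualInput (L : JordanRep K) {m : ℕ}
    (P : Matrix (Fin m) (Fin m) (Polynomial K)) (E : Matrix (Fin m) L.Index K) : List K :=
  L.points ++ matCoeffs P (rowDegree P) ++ entries L E

end Semantics

end AlgCost

open AlgCost

section

open Polynomial

namespace Residual

/-! ### A stack machine on vectors -/

/-- An instruction of the vector machine: an operation code and its parameters. -/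
abbrev VInstr := ℕ × List ℕ

/-- A program of the vector machine, which transforms a stack of vectors. -/
abbrev VCode := List VInstr

/-- Replace the `n` topmost vectors by those at the positions `idx`. -/
def wire (n : ℕ) (idx : List ℕ) : VInstr := (0, n :: idx)
/-- Concatenate the two topmost vectors. -/
def cat : VInstr := (1, [])
/-- Keep the first `k` entries of the topmost vector. -/
def vtake (k : ℕ) : VInstr := (2, [k])
/-- Remove the first `k` entries of the topmost vector. -/
def vdrop (k : ℕ) : VInstr := (3, [k])
/-- Rearrange the topmost vector, of length `len`; positions outside of it yield `0`. -/
def gather (len : ℕ) (idx : List ℕ) : VInstr := (4, len :: idx)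
/-- Push `n` copies of the constant number `k`. -/
def rep (k n : ℕ) : VInstr := (5, [k, n])
/-- Add two vectors of length `n`. -/
def vadd (n : ℕ) : VInstr := (6, [n])
/-- Subtract two vectors of length `n`. -/
def vsub (n : ℕ) : VInstr := (7, [n])
/-- Divide two vectors of length `n` entry by entry. -/
def vdiv (n : ℕ) : VInstr := (8, [n])
/-- Multiply two polynomials of degree at most `d`. -/
def pmul (d : ℕ) : VInstr := (9, [d])
/-- Multiply two square polynomial matrices of order `m` and degree at most `d`. -/
def mmul (m d : ℕ) : VInstr := (10, [m, d])

/-- The effect of the instructions that only rearrange the stack. -/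
def wiring {α : Type*} (i : VInstr) (st : List (List α)) : List (List α) :=
  if i.1 = 0 then i.2.tail.map (fun k => st.getD k []) ++ st.drop (i.2.getD 0 0)
  else if i.1 = 1 then (st.getD 0 [] ++ st.getD 1 []) :: st.drop 2
  else if i.1 = 2 then (st.getD 0 []).take (i.2.getD 0 0) :: st.drop 1
  else (st.getD 0 []).drop (i.2.getD 0 0) :: st.drop 1

/-- The number of vectors that a computing instruction consumes. -/
def arity (i : VInstr) : ℕ := if i.1 = 4 then 1 else if i.1 = 5 then 0 else 2

/-- The straight-line program for an entrywise operation on two vectors of length `n`. -/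
def zipProgram (o : Op) (n : ℕ) : Program :=
  ((List.range n).map fun i => Instr.op o i (n + i), (List.range n).map fun i => 2 * n + i)

/-- The straight-line program that a computing instruction stands for. -/
def subProgram (mul : ℕ → Program) (mmulP : ℕ → ℕ → Program) (i : VInstr) : Program :=
  if i.1 = 4 then ([Instr.const 0], i.2.tail.map fun k => min k (i.2.getD 0 0))
  else if i.1 = 5 then ([Instr.const (i.2.getD 0 0)], (List.range (i.2.getD 1 0)).map fun _ => 0)
  else if i.1 = 6 then zipProgram Op.add (i.2.getD 0 0)
  else if i.1 = 7 then zipProgram Op.sub (i.2.getD 0 0)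
  else if i.1 = 8 then zipProgram Op.div (i.2.getD 0 0)
  else if i.1 = 9 then mul (i.2.getD 0 0)
  else mmulP (i.2.getD 0 0) (i.2.getD 1 0)

/-- One step of the vector machine; `call` interprets the computing instructions. -/
def vstep {α : Type*} (call : VInstr → List α → Option (List α)) (i : VInstr)
    (st : List (List α)) : Option (List (List α)) :=
  if i.1 < 4 then some (wiring i st)
  else (call i (st.take (arity i)).flatten).map (· :: st.drop (arity i))

/-- Execution of a program of the vector machine. -/
def vrun {α : Type*} (call : VInstr → List α → Option (List α)) :
    VCode → List (List α) → Option (List (List α))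
  | [], st => some st
  | i :: c, st => (vstep call i st).bind (vrun call c)

/-! ### Translation into straight-line programs -/

/-- The memory cell that replaces the cell `i` of a subprogram which is called with the arguments
`args` when the memory has `n` cells. -/
def relocate (args : List ℕ) (n i : ℕ) : ℕ :=
  if i < args.length then args.getD i 0 else n + (i - args.length)

/-- The instruction that replaces an instruction of a called subprogram. -/
def relocateInstr (args : List ℕ) (n : ℕ) : Instr → Instr
  | .const k => .const k
  | .op o i j => .op o (relocate args n i) (relocate args n j)

/-- The state of the translation: for each entry of the stack its memory cell, the size of the
memory, and the code produced so far. -/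
abbrev XState := List (List ℕ) × ℕ × List Instr

/-- Translation of one instruction. -/
def expandStep (sub : VInstr → Program) (s : XState) (i : VInstr) : XState :=
  if i.1 < 4 then (wiring i s.1, s.2)
  else ((sub i).2.map (relocate (s.1.take (arity i)).flatten s.2.1) :: s.1.drop (arity i),
    s.2.1 + (sub i).1.length,
    s.2.2 ++ (sub i).1.map (relocateInstr (s.1.take (arity i)).flatten s.2.1))

/-- The straight-line program of a program of the vector machine whose initial stack is one vector
of length `n`, and which leaves its result on top of the stack. -/
def expand (sub : VInstr → Program) (n : ℕ) (c : VCode) : Program :=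
  ((c.foldl (expandStep sub) ([List.range n], n, [])).2.2,
    (c.foldl (expandStep sub) ([List.range n], n, [])).1.getD 0 [])

section Correctness

variable {K : Type*} [Field K] {κ : ℕ → K}

theorem runCode_append (c d : List Instr) (mem : List K) :
    runCode κ (c ++ d) mem = (runCode κ c mem).bind (runCode κ d) := by
  induction c generalizing mem with
  | nil => rfl
  | cons i c ih =>
    simp only [List.cons_append, runCode, Option.bind_eq_bind]
    cases i.eval κ mem <;> simp [ih]

/-- `mem` is the memory of a subprogram and `big` that of the calling program. -/
structure Embeds (args : List ℕ) (n : ℕ) (mem big : List K) : Prop where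
  le : args.length ≤ mem.length
  length_eq : big.length = n + (mem.length - args.length)
  get : ∀ i v, mem[i]? = some v → big[relocate args n i]? = some v

theorem Embeds.push {args : List ℕ} {n : ℕ} {mem big : List K} (h : Embeds args n mem big) (v : K) :
    Embeds args n (mem ++ [v]) (big ++ [v]) := by
  refine ⟨by have := h.le; simp; omega, by have := h.le; simp [h.length_eq]; omega, ?_⟩
  intro i w hw
  rcases lt_trichotomy i mem.length with hi | hi | hi
  · rw [List.getElem?_append_left hi] at hw
    have := h.get i w hw
    rw [List.getElem?_append_left (List.getElem?_eq_some_iff.1 this).1, this]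
  · subst hi
    have h2 : relocate args n mem.length = big.length := by
      rw [relocate, if_neg (by have := h.le; omega), h.length_eq]
    rw [h2]
    simpa using hw
  · rw [List.getElem?_eq_none (by simp; omega)] at hw
    cases hw

theorem Embeds.instr_eval {args : List ℕ} {n : ℕ} {mem big : List K} (h : Embeds args n mem big)
    (c : Instr) (v : K) (hv : c.eval κ mem = some v) :
    (relocateInstr args n c).eval κ big = some v := by
  cases c with
  | const k => simpa [relocateInstr, Instr.eval] using hv
  | op o i j =>
    simp only [Instr.eval, Option.bind_eq_bind, Option.bind_eq_some_iff] at hv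
    obtain ⟨a, ha, b, hb, hab⟩ := hv
    simp [relocateInstr, Instr.eval, h.get i a ha, h.get j b hb, hab]

theorem Embeds.run {args : List ℕ} {n : ℕ} (c : List Instr) {mem big mem' : List K}
    (h : Embeds args n mem big) (hr : runCode κ c mem = some mem') :
    ∃ big', runCode κ (c.map (relocateInstr args n)) big = some big' ∧
      Embeds args n mem' big' ∧ big <+: big' ∧ big'.length = big.length + c.length := by
  induction c generalizing mem big with
  | nil =>
    simp only [runCode, Option.some.injEq] at hr
    exact ⟨big, rfl, hr ▸ h, List.prefix_rfl, rfl⟩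
  | cons i c ih =>
    simp only [runCode, Option.bind_eq_bind, Option.bind_eq_some_iff] at hr
    obtain ⟨v, hv, hr⟩ := hr
    obtain ⟨big', h1, h2, h3, h4⟩ := ih (h.push v) hr
    refine ⟨big', ?_, h2, (List.prefix_append _ _).trans h3, ?_⟩
    · simp [runCode, h.instr_eval i v hv, h1]
    · simp [h4]; omega

/-- The cells `as` of the memory contain the values `vs`. -/
def Holds (mem : List K) (as : List ℕ) (vs : List K) : Prop :=
  List.Forall₂ (fun a v => mem[a]? = some v) as vs

theorem Holds.mono {mem mem' : List K} (h : mem <+: mem') {as : List ℕ} {vs : List K}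
    (ha : Holds mem as vs) : Holds mem' as vs := by
  obtain ⟨t, rfl⟩ := h
  refine List.Forall₂.imp (fun a v hv => ?_) ha
  rw [List.getElem?_append_left (List.getElem?_eq_some_iff.1 hv).1, hv]

theorem mapM_eq_some_iff_forall₂ {α β : Type*} (f : α → Option β) (l : List α) (r : List β) :
    l.mapM f = some r ↔ List.Forall₂ (fun a b => f a = some b) l r := by
  induction l generalizing r with
  | nil => simp [eq_comm]
  | cons a l ih =>
    simp only [List.mapM_cons, Option.bind_eq_bind, Option.bind_eq_some_iff, Option.pure_def,
      Option.some.injEq]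
    constructor
    · rintro ⟨b, hb, t, ht, rfl⟩
      exact .cons hb ((ih t).1 ht)
    · rintro (_ | ⟨hb, ht⟩)
      exact ⟨_, hb, _, (ih _).2 ht, rfl⟩

/-- Calling a subprogram. -/
theorem call_subprogram (p : Program) {mem : List K} {args : List ℕ} {u v : List K}
    (hu : Holds mem args u) (hp : p.eval κ u = some v) :
    ∃ mem', runCode κ (p.1.map (relocateInstr args mem.length)) mem = some mem' ∧
      mem <+: mem' ∧ mem'.length = mem.length + p.1.length ∧
      Holds mem' (p.2.map (relocate args mem.length)) v := by
  simp only [Program.eval, Option.bind_eq_bind, Option.bind_eq_some_iff] at hp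
  obtain ⟨m1, h1, h2⟩ := hp
  have hl : args.length = u.length := List.Forall₂.length_eq hu
  have he : Embeds args mem.length u mem := by
    refine ⟨hl.le, by omega, fun i w hw => ?_⟩
    have hi : i < u.length := (List.getElem?_eq_some_iff.1 hw).1
    have hi' : i < args.length := hl ▸ hi
    have := (List.forall₂_iff_get.1 hu).2 i hi' hi
    rw [relocate, if_pos hi']
    rw [List.getElem?_eq_getElem hi] at hw
    simp only [List.get_eq_getElem] at this
    simpa [List.getD_eq_getElem?_getD, hi', this] using hw
  obtain ⟨big, h3, h4, h5, h6⟩ := he.run p.1 h1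
  refine ⟨big, h3, h5, h6, ?_⟩
  rw [Holds, List.forall₂_map_left_iff]
  exact List.Forall₂.imp (fun a b hab => h4.get a b hab) ((mapM_eq_some_iff_forall₂ _ _ _).1 h2)

theorem forall₂_getD {α β : Type*} {R : α → β → Prop} {l : List (List α)} {r : List (List β)}
    (h : List.Forall₂ (List.Forall₂ R) l r) (k : ℕ) :
    List.Forall₂ R (l.getD k []) (r.getD k []) := by
  induction h generalizing k with
  | nil => simp
  | cons h _ ih =>
    cases k with
    | zero => simpa using h
    | succ k => simpa using ih k

theorem forall₂_wiring {α β : Type*} {R : α → β → Prop} (i : VInstr) {l : List (List α)}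
    {r : List (List β)} (h : List.Forall₂ (List.Forall₂ R) l r) :
    List.Forall₂ (List.Forall₂ R) (wiring i l) (wiring i r) := by
  unfold wiring
  have h0 := forall₂_getD h 0
  split_ifs
  · refine List.rel_append ?_ (List.forall₂_drop _ h)
    rw [List.forall₂_map_left_iff, List.forall₂_map_right_iff]
    exact List.forall₂_same.2 fun k _ => forall₂_getD h k
  · exact .cons (List.rel_append h0 (forall₂_getD h 1)) (List.forall₂_drop _ h)
  · exact .cons (List.forall₂_take _ h0) (List.forall₂_drop _ h)
  · exact .cons (List.forall₂_drop _ h0) (List.forall₂_drop _ h)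

/-- The state of the translation describes the stack `st` of the vector machine. -/
def Simulates (κ : ℕ → K) (input : List K) (s : XState) (st : List (List K)) : Prop :=
  ∃ mem, runCode κ s.2.2 input = some mem ∧ mem.length = s.2.1 ∧ List.Forall₂ (Holds mem) s.1 st

theorem Simulates.step {sub : VInstr → Program} {input : List K} {s : XState}
    {st st' : List (List K)} (h : Simulates κ input s st) (i : VInstr)
    (hs : vstep (fun i u => (sub i).eval κ u) i st = some st') :
    Simulates κ input (expandStep sub s i) st' := by
  obtain ⟨mem, h1, h2, h3⟩ := h
  unfold vstep at hs
  unfold expandStep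
  split_ifs at hs ⊢
  · simp only [Option.some.injEq] at hs
    exact ⟨mem, h1, h2, hs ▸ forall₂_wiring i h3⟩
  · simp only [Option.map_eq_some_iff] at hs
    obtain ⟨v, hv, rfl⟩ := hs
    have hf : Holds mem (s.1.take (arity i)).flatten (st.take (arity i)).flatten :=
      List.rel_flatten (List.forall₂_take _ h3)
    obtain ⟨mem', h4, h5, h6, h7⟩ := call_subprogram (sub i) hf hv
    rw [h2] at h4 h6 h7
    refine ⟨mem', ?_, h6, .cons h7 ?_⟩
    · simp [runCode_append, h1, h4]
    · exact (List.forall₂_drop _ h3).imp fun a b hab => hab.mono h5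

theorem Simulates.run {sub : VInstr → Program} {input : List K} (c : VCode) {s : XState}
    {st st' : List (List K)} (h : Simulates κ input s st)
    (hs : vrun (fun i u => (sub i).eval κ u) c st = some st') :
    Simulates κ input (c.foldl (expandStep sub) s) st' := by
  induction c generalizing s st with
  | nil => simpa [vrun] using (by simpa [vrun] using hs : st = st') ▸ h
  | cons i c ih =>
    simp only [vrun, Option.bind_eq_some_iff] at hs
    obtain ⟨st1, h1, h2⟩ := hs
    exact ih (h.step i h1) h2

/-- The translation is correct. -/
theorem expand_eval {sub : VInstr → Program} (c : VCode) {input v : List K}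
    {rest : List (List K)}
    (h : vrun (fun i u => (sub i).eval κ u) c [input] = some (v :: rest)) :
    (expand sub input.length c).eval κ input = some v := by
  have h0 : Simulates κ input ([List.range input.length], input.length, []) [input] := by
    refine ⟨input, rfl, rfl, .cons ?_ .nil⟩
    rw [Holds, List.forall₂_iff_get]
    simp
  obtain ⟨mem, h1, -, h3⟩ := h0.run c h
  simp only [expand, Program.eval, h1, Option.bind_eq_bind, Option.bind_some]
  rw [mapM_eq_some_iff_forall₂]
  generalize (c.foldl (expandStep sub) ([List.range input.length], input.length, [])).1 = w at h3
  cases h3 with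
  | cons h _ => exact h

end Correctness

/-! ### Cost of the translation -/

theorem relocateInstr_cost (args : List ℕ) (n : ℕ) (c : Instr) :
    (relocateInstr args n c).cost = c.cost := by cases c <;> rfl

/-- The number of field operations of an instruction of the vector machine. -/
def vcost (sub : VInstr → Program) (i : VInstr) : ℕ := if i.1 < 4 then 0 else (sub i).cost

theorem foldl_expandStep_cost (sub : VInstr → Program) (c : VCode) (s : XState) :
    ((c.foldl (expandStep sub) s).2.2.map Instr.cost).sum =
      (s.2.2.map Instr.cost).sum + (c.map (vcost sub)).sum := by
  induction c generalizing s with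
  | nil => simp
  | cons i c ih =>
    rw [List.foldl_cons, ih, List.map_cons, List.sum_cons, ← add_assoc]
    congr 1
    unfold expandStep vcost
    split_ifs
    · simp
    · simp [Program.cost, Function.comp_def, relocateInstr_cost]

theorem expand_cost (sub : VInstr → Program) (n : ℕ) (c : VCode) :
    (expand sub n c).cost = (c.map (vcost sub)).sum := by
  simp [expand, Program.cost, foldl_expandStep_cost]

/-! ### Primitive recursive and computable functions -/

attribute [fun_prop] Primrec
attribute [fun_prop] Primrec.id Primrec.const
attribute [fun_prop] Computable
attribute [fun_prop] Computable.id Computable.const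

section Split

variable {α σ : Type*}

/-- Recursion on the halves of a list. -/
def splitRec (base : List α → σ) (comb : List α → σ → σ → σ) (l : List α) : σ :=
  if h : l.length < 2 then base l
  else comb l (splitRec base comb (l.take ((l.length + 1) / 2)))
    (splitRec base comb (l.drop ((l.length + 1) / 2)))
termination_by l.length
decreasing_by all_goals simp; omega

theorem splitRec_of_lt {base : List α → σ} {comb : List α → σ → σ → σ} {l : List α}
    (h : l.length < 2) : splitRec base comb l = base l := by
  rw [splitRec, dif_pos h]

theorem splitRec_of_le {base : List α → σ} {comb : List α → σ → σ → σ} {l : List α}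
    (h : 2 ≤ l.length) : splitRec base comb l =
      comb l (splitRec base comb (l.take ((l.length + 1) / 2)))
        (splitRec base comb (l.drop ((l.length + 1) / 2))) := by
  rw [splitRec, dif_neg (by omega)]

theorem split_induction {P : List α → Prop} (base : ∀ l, l.length < 2 → P l)
    (step : ∀ l, 2 ≤ l.length → P (l.take ((l.length + 1) / 2)) →
      P (l.drop ((l.length + 1) / 2)) → P l) (l : List α) : P l := by
  induction h : l.length using Nat.strong_induction_on generalizing l with
  | _ n ih =>
    subst h
    rcases lt_or_ge l.length 2 with h | h
    · exact base l h
    · exact step l h (ih _ (by simp; omega) _ rfl) (ih _ (by simp; omega) _ rfl)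

end Split

section Primrec

variable {α β γ δ σ : Type*} [Primcodable α] [Primcodable β] [Primcodable γ] [Primcodable δ]
  [Primcodable σ]

@[fun_prop] theorem primrec_comp {f : β → γ} {g : α → β} (hf : Primrec f) (hg : Primrec g) :
    Primrec fun x => f (g x) := hf.comp hg

@[fun_prop] theorem primrec_fst {f : α → β × γ} (hf : Primrec f) : Primrec fun x => (f x).1 :=
  Primrec.fst.comp hf

@[fun_prop] theorem primrec_snd {f : α → β × γ} (hf : Primrec f) : Primrec fun x => (f x).2 :=
  Primrec.snd.comp hf

@[fun_prop] theorem primrec_pair {f : α → β} {g : α → γ} (hf : Primrec f) (hg : Primrec g) :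
    Primrec fun x => (f x, g x) := hf.pair hg

@[fun_prop] theorem primrec_add {f g : α → ℕ} (hf : Primrec f) (hg : Primrec g) :
    Primrec fun x => f x + g x := Primrec.nat_add.comp hf hg

@[fun_prop] theorem primrec_sub {f g : α → ℕ} (hf : Primrec f) (hg : Primrec g) :
    Primrec fun x => f x - g x := Primrec.nat_sub.comp hf hg

@[fun_prop] theorem primrec_mul {f g : α → ℕ} (hf : Primrec f) (hg : Primrec g) :
    Primrec fun x => f x * g x := Primrec.nat_mul.comp hf hg

@[fun_prop] theorem primrec_div {f g : α → ℕ} (hf : Primrec f) (hg : Primrec g) :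
    Primrec fun x => f x / g x := Primrec.nat_div.comp hf hg

@[fun_prop] theorem primrec_min {f g : α → ℕ} (hf : Primrec f) (hg : Primrec g) :
    Primrec fun x => min (f x) (g x) := Primrec.nat_min.comp hf hg

@[fun_prop] theorem primrec_max {f g : α → ℕ} (hf : Primrec f) (hg : Primrec g) :
    Primrec fun x => max (f x) (g x) := Primrec.nat_max.comp hf hg

@[fun_prop] theorem primrec_cons {f : α → β} {g : α → List β} (hf : Primrec f) (hg : Primrec g) :
    Primrec fun x => f x :: g x := Primrec.list_cons.comp hf hg

@[fun_prop] theorem primrec_append {f g : α → List β} (hf : Primrec f) (hg : Primrec g) :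
    Primrec fun x => f x ++ g x := Primrec.list_append.comp hf hg

@[fun_prop] theorem primrec_length {f : α → List β} (hf : Primrec f) :
    Primrec fun x => (f x).length := Primrec.list_length.comp hf

@[fun_prop] theorem primrec_tail {f : α → List β} (hf : Primrec f) :
    Primrec fun x => (f x).tail := Primrec.list_tail.comp hf

@[fun_prop] theorem primrec_flatten {f : α → List (List β)} (hf : Primrec f) :
    Primrec fun x => (f x).flatten := Primrec.list_flatten.comp hf

@[fun_prop] theorem primrec_range {f : α → ℕ} (hf : Primrec f) :
    Primrec fun x => List.range (f x) := Primrec.list_range.comp hf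

@[fun_prop] theorem primrec_getElem? {f : α → List β} {g : α → ℕ} (hf : Primrec f)
    (hg : Primrec g) : Primrec fun x => (f x)[g x]? := Primrec.list_getElem?.comp hf hg

@[fun_prop] theorem primrec_option_getD {f : α → Option β} {g : α → β} (hf : Primrec f)
    (hg : Primrec g) : Primrec fun x => (f x).getD (g x) := Primrec.option_getD.comp hf hg

@[fun_prop] theorem primrec_getD {f : α → List β} {g : α → ℕ} {h : α → β} (hf : Primrec f)
    (hg : Primrec g) (hh : Primrec h) : Primrec fun x => (f x).getD (g x) (h x) := by
  simp only [List.getD_eq_getElem?_getD]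
  fun_prop

@[fun_prop] theorem primrec_take {f : α → ℕ} {g : α → List β} (hf : Primrec f) (hg : Primrec g) :
    Primrec fun x => (g x).take (f x) := Primrec.list_take.comp hf hg

@[fun_prop] theorem primrec_drop {f : α → ℕ} {g : α → List β} (hf : Primrec f) (hg : Primrec g) :
    Primrec fun x => (g x).drop (f x) := Primrec.list_drop.comp hf hg

@[fun_prop] theorem primrec_map {f : α → β → γ} {g : α → List β} (hg : Primrec g)
    (hf : Primrec fun p : α × β => f p.1 p.2) : Primrec fun x => (g x).map (f x) :=
  Primrec.list_map hg hf

@[fun_prop] theorem primrec_flatMap {f : α → β → List γ} {g : α → List β} (hg : Primrec g)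
    (hf : Primrec fun p : α × β => f p.1 p.2) : Primrec fun x => (g x).flatMap (f x) :=
  Primrec.list_flatMap hg hf

@[fun_prop] theorem primrec_idxOf [DecidableEq β] {f : α → β} {g : α → List β} (hf : Primrec f)
    (hg : Primrec g) : Primrec fun x => (g x).idxOf (f x) := Primrec.list_idxOf.comp hf hg

@[fun_prop] theorem primrec_foldl {f : α → List β} {g : α → σ} {h : α → σ → β → σ}
    (hf : Primrec f) (hg : Primrec g) (hh : Primrec fun p : α × σ × β => h p.1 p.2.1 p.2.2) :
    Primrec fun x => (f x).foldl (h x) (g x) :=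
  Primrec.list_foldl (h := fun a p => h a p.1 p.2) hf hg hh

@[fun_prop] theorem primrec_ite_eq [DecidableEq β] {f g : α → β} {a b : α → σ} (hf : Primrec f)
    (hg : Primrec g) (ha : Primrec a) (hb : Primrec b) :
    Primrec fun x => if f x = g x then a x else b x :=
  Primrec.ite (Primrec.eq.comp hf hg) ha hb

@[fun_prop] theorem primrec_ite_lt {f g : α → ℕ} {a b : α → σ} (hf : Primrec f)
    (hg : Primrec g) (ha : Primrec a) (hb : Primrec b) :
    Primrec fun x => if f x < g x then a x else b x :=
  Primrec.ite (Primrec.nat_lt.comp hf hg) ha hb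

@[fun_prop] theorem primrec_ite_le {f g : α → ℕ} {a b : α → σ} (hf : Primrec f)
    (hg : Primrec g) (ha : Primrec a) (hb : Primrec b) :
    Primrec fun x => if f x ≤ g x then a x else b x :=
  Primrec.ite (Primrec.nat_le.comp hf hg) ha hb

@[fun_prop] theorem primrec_nat_rec {f : α → ℕ} {g : α → β} {h : α → ℕ → β → β}
    (hf : Primrec f) (hg : Primrec g) (hh : Primrec fun p : α × ℕ × β => h p.1 p.2.1 p.2.2) :
    Primrec fun x => Nat.rec (motive := fun _ => β) (g x) (h x) (f x) :=
  Primrec.nat_rec' (h := fun a p => h a p.1 p.2) hf hg hh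

@[fun_prop] theorem primrec_sum {f : α → List ℕ} (hf : Primrec f) :
    Primrec fun x => (f x).sum := by
  have : ∀ l : List ℕ, l.sum = l.foldl (fun a b => a + b) 0 := fun l => List.sum_eq_foldl
  simp only [this]
  fun_prop

theorem primrec_filter {p : α → β → Prop} [∀ a b, Decidable (p a b)] {f : α → List β}
    (hf : Primrec f) (h : Primrec fun q : α × β => if p q.1 q.2 then [q.2] else []) :
    Primrec fun x => (f x).filter fun b => p x b := by
  have : ∀ x, ((f x).filter fun b => p x b) = (f x).flatMap fun b => if p x b then [b] else [] := by
    intro x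
    induction f x with
    | nil => rfl
    | cons b l ih => by_cases h : p x b <;> simp [h, ih]
  simp only [this]
  exact primrec_flatMap hf h

@[fun_prop] theorem primrec_pow {f g : α → ℕ} (hf : Primrec f) (hg : Primrec g) :
    Primrec fun x => f x ^ g x := by
  have : Primrec fun x => Nat.rec (motive := fun _ => ℕ) 1 (fun _ y => y * f x) (g x) := by fun_prop
  refine this.of_eq fun x => ?_
  induction g x with
  | zero => rfl
  | succ n ih => rw [pow_succ, ← ih]

@[fun_prop] theorem primrec_log2 {f : α → ℕ} (hf : Primrec f) :
    Primrec fun x => Nat.log 2 (f x) := by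
  have h : Primrec fun x => ((List.range (f x)).flatMap fun k =>
      if 2 ^ (k + 1) ≤ f x then [k] else []).length := by fun_prop
  refine h.of_eq fun x => ?_
  generalize f x = n
  have key : ∀ N, ((List.range N).flatMap fun k => if 2 ^ (k + 1) ≤ n then [k] else []).length
      = min N (Nat.log 2 n) := by
    intro N
    induction N with
    | zero => simp
    | succ N ih =>
      rw [List.range_succ, List.flatMap_append, List.length_append, ih]
      by_cases hn : n = 0
      · simp [hn]
      · have := Nat.le_log_iff_pow_le (b := 2) (x := N + 1) (by norm_num) hn
        by_cases h2 : 2 ^ (N + 1) ≤ n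
        · have := this.2 h2
          simp [h2]; omega
        · have : ¬ (N + 1 ≤ Nat.log 2 n) := fun h => h2 (this.1 h)
          simp [h2]; omega
  rw [key]
  exact min_eq_right (Nat.log_le_self 2 n)

theorem splitRec_primrec {base : List α → σ} {comb : List α → σ → σ → σ} (hb : Primrec base)
    (hc : Primrec fun p : List α × σ × σ => comb p.1 p.2.1 p.2.2) :
    Primrec (splitRec base comb) := by
  let g : List α → List σ → Option σ := fun l r =>
    if l.length < 2 then some (base l) else
      (r[0]?).bind fun a => (r[1]?).map fun b => comb l a b
  refine Primrec.nat_omega_rec' (m := List.length) (l := fun l => if l.length < 2 then []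
    else [l.take ((l.length + 1) / 2), l.drop ((l.length + 1) / 2)]) (g := g) _
    Primrec.list_length (by fun_prop) ?_ ?_ ?_
  · refine Primrec.ite (Primrec.nat_lt.comp (by fun_prop) (by fun_prop))
      (Primrec.option_some.comp (by fun_prop)) ?_
    refine Primrec.option_bind (by fun_prop) ?_
    refine Primrec.option_map (by fun_prop) ?_
    show Primrec fun p : ((List α × List σ) × σ) × σ => comb p.1.1.1 p.1.2 p.2
    exact hc.comp (f := fun p : List α × σ × σ => comb p.1 p.2.1 p.2.2)
      (g := fun p : ((List α × List σ) × σ) × σ => (p.1.1.1, p.1.2, p.2)) (by fun_prop)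
  · intro b b' hb'
    split_ifs at hb' with h
    · simp at hb'
    · simp only [List.mem_cons, List.not_mem_nil, or_false] at hb'
      rcases hb' with rfl | rfl <;> simp <;> omega
  · intro b
    conv_rhs => rw [splitRec]
    by_cases h : b.length < 2
    · simp only [g, if_pos h, dif_pos h]
    · have h' : ¬ b.length ≤ 1 := by omega
      simp [g, h']

@[fun_prop] theorem primrec_instr_op {o : Op} {f g : α → ℕ} (hf : Primrec f) (hg : Primrec g) :
    Primrec fun x => Instr.op o (f x) (g x) := by
  have : Primrec fun x => instrEquiv.symm (.inr (opEquiv o, f x, g x)) :=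
    (Primrec.of_equiv_symm (e := instrEquiv)).comp (Primrec.sumInr.comp (by fun_prop))
  exact this.of_eq fun x => by simp [instrEquiv]

@[fun_prop] theorem primrec_instr_const {f : α → ℕ} (hf : Primrec f) :
    Primrec fun x => Instr.const (f x) := by
  have : Primrec fun x => instrEquiv.symm (.inl (f x)) :=
    (Primrec.of_equiv_symm (e := instrEquiv)).comp (Primrec.sumInl.comp (by fun_prop))
  exact this.of_eq fun x => by simp [instrEquiv]

@[fun_prop] theorem primrec_relocate {f : α → List ℕ} {g h : α → ℕ} (hf : Primrec f)
    (hg : Primrec g) (hh : Primrec h) : Primrec fun x => relocate (f x) (g x) (h x) := by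
  unfold relocate
  fun_prop

@[fun_prop] theorem primrec_relocateInstr {f : α → List ℕ} {g : α → ℕ} {h : α → Instr}
    (hf : Primrec f) (hg : Primrec g) (hh : Primrec h) :
    Primrec fun x => relocateInstr (f x) (g x) (h x) := by
  have : Primrec fun x => (Sum.casesOn (instrEquiv (h x)) (fun k => instrEquiv.symm (.inl k))
      (fun p => instrEquiv.symm (.inr (p.1, relocate (f x) (g x) p.2.1, relocate (f x) (g x) p.2.2)))
      : Instr) := by
    refine Primrec.sumCasesOn ((Primrec.of_equiv (e := instrEquiv)).comp hh) ?_ ?_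
    · exact (Primrec.of_equiv_symm (e := instrEquiv)).comp (Primrec.sumInl.comp (by fun_prop))
    · exact (Primrec.of_equiv_symm (e := instrEquiv)).comp (Primrec.sumInr.comp (by fun_prop))
  exact this.of_eq fun x => by cases h x <;> simp [instrEquiv, relocateInstr]

@[fun_prop] theorem primrec_arity {f : α → VInstr} (hf : Primrec f) :
    Primrec fun x => arity (f x) := by
  unfold arity
  fun_prop

@[fun_prop] theorem primrec_wiring {f : α → VInstr} {g : α → List (List σ)}
    (hf : Primrec f) (hg : Primrec g) : Primrec fun x => wiring (f x) (g x) := by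
  unfold wiring
  fun_prop

@[fun_prop] theorem primrec_zipProgram {o : Op} {f : α → ℕ} (hf : Primrec f) :
    Primrec fun x => zipProgram o (f x) := by
  unfold zipProgram
  fun_prop

theorem computable_foldl {f : α → List β} {g : α → σ} {h : α → σ → β → σ} (hf : Computable f)
    (hg : Computable g) (hh : Computable fun p : α × σ × β => h p.1 p.2.1 p.2.2) :
    Computable fun x => (f x).foldl (h x) (g x) := by
  let step : α → ℕ × σ → σ := fun x p =>
    Option.casesOn ((f x)[p.1]?) p.2 fun b => h x p.2 b
  have hstep : Computable₂ step := by
    refine Computable.option_casesOn (o := fun q : α × ℕ × σ => (f q.1)[q.2.1]?)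
      (f := fun q => q.2.2) (g := fun q b => h q.1 q.2.2 b) ?_ ?_ ?_
    · exact Computable.list_getElem?.comp (hf.comp .fst) (Computable.fst.comp .snd)
    · exact Computable.snd.comp .snd
    · exact hh.comp (Computable.pair (Computable.fst.comp .fst)
        (Computable.pair (Computable.snd.comp (Computable.snd.comp .fst)) .snd))
  have := Computable.nat_rec (Computable.list_length.comp hf) hg hstep
  refine this.of_eq fun x => ?_
  have key : ∀ n, n ≤ (f x).length → (Nat.rec (g x) (fun y IH => step x (y, IH)) n : σ) =
      ((f x).take n).foldl (h x) (g x) := by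
    intro n hn
    induction n with
    | zero => simp
    | succ n ih =>
      have h1 : (f x)[n]? = some (f x)[n] := List.getElem?_eq_getElem (by omega)
      rw [List.take_add_one, List.foldl_append, ← ih (by omega)]
      simp [step, h1]
  simpa using key _ le_rfl

theorem computable_ite {f g : α → ℕ} {a b : α → σ} (hf : Primrec f) (hg : Primrec g)
    (ha : Computable a) (hb : Computable b) :
    Computable fun x => if f x = g x then a x else b x := by
  have h : Primrec fun x => if f x = g x then true else false := by fun_prop
  refine (Computable.cond h.to_comp ha hb).of_eq fun x => ?_
  by_cases h : f x = g x <;> simp [h]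

end Primrec

theorem subProgram_computable {mul : ℕ → Program} {mmulP : ℕ → ℕ → Program}
    (hmul : Computable mul) (hmmul : Computable₂ mmulP) : Computable (subProgram mul mmulP) := by
  unfold subProgram
  refine computable_ite (by fun_prop) (by fun_prop) (Primrec.to_comp (by fun_prop)) ?_
  refine computable_ite (by fun_prop) (by fun_prop) (Primrec.to_comp (by fun_prop)) ?_
  refine computable_ite (by fun_prop) (by fun_prop) (Primrec.to_comp (by fun_prop)) ?_
  refine computable_ite (by fun_prop) (by fun_prop) (Primrec.to_comp (by fun_prop)) ?_
  refine computable_ite (by fun_prop) (by fun_prop) (Primrec.to_comp (by fun_prop)) ?_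
  refine computable_ite (by fun_prop) (by fun_prop) ?_ ?_
  · exact hmul.comp (Primrec.to_comp (by fun_prop))
  · exact hmmul.comp (Primrec.to_comp (by fun_prop)) (Primrec.to_comp (by fun_prop))

/-- The translation step as a function of the subprogram that is called. -/
def translateCall (q : XState × VInstr × Program) : XState :=
  if q.2.1.1 < 4 then (wiring q.2.1 q.1.1, q.1.2)
  else (q.2.2.2.map (relocate (q.1.1.take (arity q.2.1)).flatten q.1.2.1) ::
      q.1.1.drop (arity q.2.1),
    q.1.2.1 + q.2.2.1.length,
    q.1.2.2 ++ q.2.2.1.map (relocateInstr (q.1.1.take (arity q.2.1)).flatten q.1.2.1))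

theorem translateCall_primrec : Primrec translateCall := by
  unfold translateCall
  fun_prop

/-- The program that a state of the translation stands for. -/
def XState.program (s : XState) : Program := (s.2.2, s.1.getD 0 [])

theorem program_primrec : Primrec XState.program := by
  unfold XState.program
  fun_prop

theorem initial_primrec : Primrec fun n : ℕ => (([List.range n], n, []) : XState) := by
  fun_prop

theorem expandStep_computable {sub : VInstr → Program} (hs : Computable sub) :
    Computable₂ (expandStep sub) :=
  Computable.comp (f := translateCall) (g := fun p : XState × VInstr => (p.1, p.2, sub p.2))
    translateCall_primrec.to_comp
    (Computable.pair Computable.fst (Computable.pair Computable.snd (hs.comp Computable.snd)))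

/-- The translation of programs of the vector machine is computable. -/
theorem expand_computable {α : Type*} [Primcodable α] {sub : VInstr → Program} (hs : Computable sub)
    {n : α → ℕ} {c : α → VCode} (hn : Primrec n) (hc : Primrec c) :
    Computable fun x => expand sub (n x) (c x) := by
  have h4 : Computable fun x => (c x).foldl (expandStep sub) (([List.range (n x)], n x, []) : XState) :=
    computable_foldl (h := fun _ s i => expandStep sub s i) hc.to_comp
      (initial_primrec.to_comp.comp hn.to_comp) ((expandStep_computable hs).comp
        (Computable.fst.comp Computable.snd) (Computable.snd.comp Computable.snd))
  exact Computable.comp (f := XState.program) program_primrec.to_comp h4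

/-! ### Semantics of the vector machine -/

/-- The arithmetic that the vector machine uses: programs for multiplying polynomials and square
polynomial matrices. -/
structure Arith (K : Type*) [Field K] where
  κ : ℕ → K
  mulP : ℕ → Program
  mmulP : ℕ → ℕ → Program
  mulP_eval : ∀ d, 1 ≤ d → ∀ p q : K[X], p.natDegree ≤ d → q.natDegree ≤ d →
    (mulP d).eval κ (polyCoeffs p (d + 1) ++ polyCoeffs q (d + 1)) =
      some (polyCoeffs (p * q) (2 * d + 1))
  mmulP_eval : ∀ m d, 1 ≤ m → 1 ≤ d → ∀ S T : Matrix (Fin m) (Fin m) K[X],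
    (∀ i j, (S i j).natDegree ≤ d) → (∀ i j, (T i j).natDegree ≤ d) →
    (mmulP m d).eval κ (matCoeffs S (fun _ => d) ++ matCoeffs T (fun _ => d)) =
      some (matCoeffs (S * T) (fun _ => 2 * d))

variable {K : Type*} [Field K]

/-- Execution of a program of the vector machine on stacks of vectors over a field. -/
noncomputable def Arith.run (A : Arith K) (c : VCode) (st : List (List K)) :
    Option (List (List K)) :=
  vrun (fun i u => (subProgram A.mulP A.mmulP i).eval A.κ u) c st

theorem zipProgram_eval (κ : ℕ → K) (o : Op) {a b r : List K} {n : ℕ} (ha : a.length = n)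
    (hb : b.length = n) (hc : r.length = n)
    (h : ∀ i, ∀ hi : i < n, o.eval a[i] b[i] = some r[i]) :
    (zipProgram o n).eval κ (a ++ b) = some r := by
  have key : ∀ j, j ≤ n → runCode κ ((List.range j).map fun i => Instr.op o i (n + i)) (a ++ b) =
      some (a ++ b ++ r.take j) := by
    intro j hj
    induction j with
    | zero => simp [runCode]
    | succ j ih =>
      have h1 : (a ++ (b ++ List.take j r))[j]? = some a[j] := by
        rw [List.getElem?_append_left (by omega), List.getElem?_eq_getElem]
      have h2 : (a ++ (b ++ List.take j r))[n + j]? = some b[j] := by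
        rw [List.getElem?_append_right (by omega), List.getElem?_append_left (by omega), ha]
        simp only [Nat.add_sub_cancel_left]
        rw [List.getElem?_eq_getElem]
      have h3 : r[j]? = some r[j] := List.getElem?_eq_getElem (by omega)
      rw [List.range_succ, List.map_append, runCode_append, ih (by omega)]
      simp only [List.append_assoc, List.map_cons, List.map_nil, Option.bind_some, runCode,
        Instr.eval, h1, h2, h j hj, Option.bind_eq_bind, List.take_add_one, h3, Option.toList_some]
  simp only [zipProgram, Program.eval, key n le_rfl, Option.bind_eq_bind, Option.bind_some]
  rw [mapM_eq_some_iff_forall₂, List.forall₂_map_left_iff, List.forall₂_iff_get]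
  refine ⟨by simp [hc], fun i h1 h2 => ?_⟩
  simp only [List.get_eq_getElem, List.getElem_range, List.length_range] at h1 ⊢
  rw [List.getElem?_append_right (by simp; omega)]
  simp only [List.length_append, ha, hb]
  rw [show 2 * n + i - (n + n) = i by omega, List.getElem?_take_of_lt h1,
    List.getElem?_eq_getElem]

namespace Arith

variable (A : Arith K)

@[simp] theorem run_nil (st : List (List K)) : A.run [] st = some st := rfl

theorem run_cons (i : VInstr) (k : VCode) (st : List (List K)) :
    A.run (i :: k) st =
      (vstep (fun i u => (subProgram A.mulP A.mmulP i).eval A.κ u) i st).bind (A.run k) := rfl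

@[simp] theorem run_wire (n : ℕ) (idx : List ℕ) (k : VCode) (st : List (List K)) :
    A.run (wire n idx :: k) st = A.run k (idx.map (fun i => st.getD i []) ++ st.drop n) := by
  simp [run_cons, vstep, wire, wiring]

@[simp] theorem run_cat (k : VCode) (a b : List K) (st : List (List K)) :
    A.run (cat :: k) (a :: b :: st) = A.run k ((a ++ b) :: st) := by
  simp [run_cons, vstep, cat, wiring]

@[simp] theorem run_vtake (n : ℕ) (k : VCode) (a : List K) (st : List (List K)) :
    A.run (vtake n :: k) (a :: st) = A.run k (a.take n :: st) := by
  simp [run_cons, vstep, vtake, wiring]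

@[simp] theorem run_vdrop (n : ℕ) (k : VCode) (a : List K) (st : List (List K)) :
    A.run (vdrop n :: k) (a :: st) = A.run k (a.drop n :: st) := by
  simp [run_cons, vstep, vdrop, wiring]

theorem run_call {i : VInstr} (hi : 4 ≤ i.1) {us : List (List K)} (hu : us.length = arity i)
    {v : List K} (hv : (subProgram A.mulP A.mmulP i).eval A.κ us.flatten = some v) (k : VCode)
    (st : List (List K)) : A.run (i :: k) (us ++ st) = A.run k (v :: st) := by
  have h1 : ¬ i.1 < 4 := by omega
  rw [run_cons, vstep, if_neg h1, ← hu, List.take_left, List.drop_left, hv]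
  rfl

theorem run_gather {n : ℕ} {a : List K} (ha : a.length = n) (idx : List ℕ) (k : VCode)
    (st : List (List K)) :
    A.run (gather n idx :: k) (a :: st) = A.run k (idx.map (fun i => a.getD i 0) :: st) := by
  refine A.run_call (us := [a]) (by simp [gather]) (by simp [gather, arity]) ?_ k st
  simp only [subProgram, gather, if_true, Program.eval, runCode, Instr.eval, constant]
  simp only [List.flatten_cons, List.flatten_nil, List.append_nil, List.tail_cons,
    List.getD_cons_zero, Option.bind_eq_bind, Option.bind_some]
  rw [mapM_eq_some_iff_forall₂, List.forall₂_map_left_iff, List.forall₂_map_right_iff]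
  refine List.forall₂_same.2 fun i _ => ?_
  subst ha
  rcases lt_or_ge i a.length with hi | hi
  · rw [min_eq_left hi.le, List.getElem?_append_left hi, List.getElem?_eq_getElem hi]
    simp [List.getD_eq_getElem?_getD, hi]
  · rw [min_eq_right hi]
    simp [List.getD_eq_getElem?_getD, hi]

theorem run_rep (j n : ℕ) (k : VCode) (st : List (List K)) :
    A.run (rep j n :: k) st = A.run k (List.replicate n (constant A.κ j) :: st) := by
  refine A.run_call (us := []) (by simp [rep]) (by simp [rep, arity]) ?_ k st
  show Program.eval A.κ ([Instr.const j], (List.range n).map fun _ => 0) [] = _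
  simp only [Program.eval, runCode, Instr.eval, Option.bind_eq_bind, Option.bind_some]
  rw [mapM_eq_some_iff_forall₂, List.forall₂_map_left_iff, List.forall₂_iff_get]
  refine ⟨by simp, ?_⟩
  intro i h1 h2
  simp

theorem run_vadd {n : ℕ} {a b : List K} (ha : a.length = n) (hb : b.length = n) (k : VCode)
    (st : List (List K)) :
    A.run (vadd n :: k) (a :: b :: st) = A.run k (List.zipWith (· + ·) a b :: st) := by
  refine A.run_call (us := [a, b]) (by simp [vadd]) (by simp [vadd, arity]) ?_ k st
  simp only [List.flatten_cons, List.flatten_nil, List.append_nil]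
  exact zipProgram_eval _ _ (n := n) ha hb (by simp [ha, hb]) (by simp [Op.eval])

theorem run_vsub {n : ℕ} {a b : List K} (ha : a.length = n) (hb : b.length = n) (k : VCode)
    (st : List (List K)) :
    A.run (vsub n :: k) (a :: b :: st) = A.run k (List.zipWith (· - ·) a b :: st) := by
  refine A.run_call (us := [a, b]) (by simp [vsub]) (by simp [vsub, arity]) ?_ k st
  simp only [List.flatten_cons, List.flatten_nil, List.append_nil]
  exact zipProgram_eval _ _ (n := n) ha hb (by simp [ha, hb]) (by simp [Op.eval])

theorem run_vdiv_one {x y : K} (hy : y ≠ 0) (k : VCode) (st : List (List K)) :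
    A.run (vdiv 1 :: k) ([x] :: [y] :: st) = A.run k ([x / y] :: st) := by
  refine A.run_call (us := [[x], [y]]) (by simp [vdiv]) (by simp [vdiv, arity]) ?_ k st
  refine zipProgram_eval A.κ Op.div (n := 1) (a := [x]) (b := [y]) (r := [x / y]) rfl rfl rfl ?_
  intro i hi
  simp [Op.eval, hy]

theorem run_pmul {d : ℕ} (hd : 1 ≤ d) {p q : K[X]} (hp : p.natDegree ≤ d) (hq : q.natDegree ≤ d)
    (k : VCode) (st : List (List K)) :
    A.run (pmul d :: k) (polyCoeffs p (d + 1) :: polyCoeffs q (d + 1) :: st) =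
      A.run k (polyCoeffs (p * q) (2 * d + 1) :: st) := by
  refine A.run_call (us := [_, _]) (by simp [pmul]) (by simp [pmul, arity]) ?_ k st
  simp only [List.flatten_cons, List.flatten_nil, List.append_nil]
  exact A.mulP_eval d hd p q hp hq

theorem run_mmul {m d : ℕ} (hm : 1 ≤ m) (hd : 1 ≤ d) {S T : Matrix (Fin m) (Fin m) K[X]}
    (hS : ∀ i j, (S i j).natDegree ≤ d) (hT : ∀ i j, (T i j).natDegree ≤ d)
    (k : VCode) (st : List (List K)) :
    A.run (mmul m d :: k) (matCoeffs S (fun _ => d) :: matCoeffs T (fun _ => d) :: st) =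
      A.run k (matCoeffs (S * T) (fun _ => 2 * d) :: st) := by
  refine A.run_call (us := [_, _]) (by simp [mmul]) (by simp [mmul, arity]) ?_ k st
  simp only [List.flatten_cons, List.flatten_nil, List.append_nil]
  exact A.mmulP_eval m d hm hd S T hS hT

end Arith

/-- The position of a label in a list. -/
def position {α : Type*} [DecidableEq α] (s : List α) (x : α) : ℕ := s.idxOf x

theorem position_lt {α : Type*} [DecidableEq α] {s : List α} {x : α} (h : x ∈ s) :
    position s x < s.length := List.idxOf_lt_length_iff.2 h

theorem getD_position {α : Type*} [DecidableEq α] {s : List α} {x : α} (h : x ∈ s) (d : α) :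
    s.getD (position s x) d = x := by
  rw [List.getD_eq_getElem _ _ (position_lt h)]
  exact List.getElem_idxOf _

/-- Rearrange a vector whose entries are labelled by `s` into one whose entries are labelled
by `t`; labels that do not occur in `s` yield `0`. -/
def relabel {α : Type*} [DecidableEq α] (s t : List α) : VInstr :=
  gather s.length (t.map (position s))

open Classical in
/-- The value of a label in a labelled vector. -/
noncomputable def lookup {α : Type*} (s : List α) (F : α → K) (x : α) : K :=
  if x ∈ s then F x else 0

theorem lookup_of_mem {α : Type*} {s : List α} {F : α → K} {x : α} (h : x ∈ s) :
    lookup s F x = F x := if_pos h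

theorem lookup_of_not_mem {α : Type*} {s : List α} {F : α → K} {x : α} (h : x ∉ s) :
    lookup s F x = 0 := if_neg h

theorem Arith.run_relabel (A : Arith K) {α : Type*} [DecidableEq α] (s t : List α) (F : α → K)
    (k : VCode) (st : List (List K)) :
    A.run (relabel s t :: k) (s.map F :: st) = A.run k (t.map (lookup s F) :: st) := by
  rw [relabel, A.run_gather (by simp), List.map_map]
  congr 2
  refine List.map_congr_left fun x _ => ?_
  by_cases hx : x ∈ s
  · rw [lookup_of_mem hx, Function.comp, List.getD_eq_getElem?_getD, List.getElem?_map,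
      List.getElem?_eq_getElem (position_lt hx), Option.map_some, Option.getD_some]
    congr 1
    exact List.getElem_idxOf _
  · rw [lookup_of_not_mem hx]
    simp [position, List.getD_eq_getElem?_getD, hx]

/-- Apply to each item the program `body`; the stack consists of the concatenation of the arguments
(with lengths `len`), and of `q` further vectors that are available to all bodies. -/
def mapCode {ι : Type*} (q : ℕ) (items : List ι) (len : ι → ℕ) (body : ι → VCode) : VCode :=
  [rep 0 0] ++ items.flatMap (fun i =>
    [wire (q + 2) ([1] ++ (List.range q).map (· + 2) ++ List.range (q + 2)), vtake (len i)] ++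
      body i ++ [wire 2 [1, 0], cat, wire 2 [1, 0], vdrop (len i), wire 2 [1, 0]]) ++
  [wire (q + 2) [0]]

theorem map_range_getD {α : Type*} (l r : List α) (d : α) {n : ℕ} (hn : l.length = n) :
    (List.range n).map (fun i => (l ++ r).getD i d) = l := by
  subst hn
  refine List.ext_getElem (by simp) fun i h1 h2 => ?_
  simp [List.getD_eq_getElem?_getD, List.getElem?_append_left h2, h2]

theorem Arith.run_mapCode (A : Arith K) {ι : Type*} {q : ℕ} (items : List ι) {len : ι → ℕ}
    {body : ι → VCode} {row out : ι → List K} {ctx : List (List K)} (hq : ctx.length = q)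
    (hlen : ∀ i ∈ items, (row i).length = len i)
    (hbody : ∀ i ∈ items, ∀ k st,
      A.run (body i ++ k) (row i :: (ctx ++ st)) = A.run k (out i :: st))
    (k : VCode) (st : List (List K)) :
    A.run (mapCode q items len body ++ k) (items.flatMap row :: (ctx ++ st)) =
      A.run k (items.flatMap out :: st) := by
  have key : ∀ (its : List ι) (acc : List K), its ⊆ items →
      A.run (its.flatMap (fun i =>
        [wire (q + 2) ([1] ++ (List.range q).map (· + 2) ++ List.range (q + 2)), vtake (len i)] ++
          body i ++ [wire 2 [1, 0], cat, wire 2 [1, 0], vdrop (len i), wire 2 [1, 0]]) ++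
          ([wire (q + 2) [0]] ++ k)) (acc :: its.flatMap row :: (ctx ++ st)) =
        A.run k ((acc ++ its.flatMap out) :: st) := by
    intro its
    induction its with
    | nil =>
      intro acc _
      simp [A.run_wire, ← hq]
    | cons i its ih =>
      intro acc hi
      have hi' : i ∈ items := hi (by simp)
      have h1 : (List.range q).map (fun i => (ctx ++ st).getD i []) = ctx :=
        map_range_getD ctx st [] hq
      have h2 : (List.range (q + 2)).map (fun j =>
          (acc :: (i :: its).flatMap row :: (ctx ++ st)).getD j []) =
          acc :: (i :: its).flatMap row :: ctx :=
        map_range_getD (acc :: (i :: its).flatMap row :: ctx) st [] (by simp [hq])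
      have h3 : (acc :: (i :: its).flatMap row :: (ctx ++ st)).drop (q + 2) = st := by
        simp [← hq]
      have h4 : ((i :: its).flatMap row).take (len i) = row i := by
        rw [List.flatMap_cons, ← hlen i hi', List.take_left]
      have h5 : ((i :: its).flatMap row).drop (len i) = its.flatMap row := by
        rw [List.flatMap_cons, ← hlen i hi', List.drop_left]
      rw [List.flatMap_cons]
      simp only [List.append_assoc, List.cons_append, List.nil_append]
      rw [A.run_wire, List.map_cons, List.map_append, h2, h3, List.map_map]
      simp only [Function.comp_def, List.getD_cons_succ, List.getD_cons_zero, h1]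
      simp only [List.append_assoc, List.cons_append, A.run_vtake, h4]
      rw [hbody i hi']
      simp only [A.run_wire, A.run_cat, A.run_vdrop, List.map_cons, List.map_nil,
        List.getD_cons_succ, List.getD_cons_zero, List.drop_succ_cons, List.drop_zero,
        List.cons_append, List.nil_append, h5]
      have := ih (acc ++ out i) (fun x hx => hi (by simp [hx]))
      simp only [List.append_assoc, List.cons_append, List.nil_append] at this
      rw [this, List.flatMap_cons]
  have := key items [] (List.Subset.refl _)
  simp only [mapCode, List.append_assoc] at this ⊢
  simp only [List.cons_append, List.nil_append, A.run_rep, List.replicate_zero] at this ⊢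
  exact this

section Primrec

variable {α β ι : Type*} [Primcodable α] [Primcodable β] [Primcodable ι]

@[fun_prop] theorem primrec_wire {f : α → ℕ} {g : α → List ℕ} (hf : Primrec f) (hg : Primrec g) :
    Primrec fun x => wire (f x) (g x) := by unfold wire; fun_prop
@[fun_prop] theorem primrec_vtake {f : α → ℕ} (hf : Primrec f) :
    Primrec fun x => vtake (f x) := by unfold vtake; fun_prop
@[fun_prop] theorem primrec_vdrop {f : α → ℕ} (hf : Primrec f) :
    Primrec fun x => vdrop (f x) := by unfold vdrop; fun_prop
@[fun_prop] theorem primrec_gather {f : α → ℕ} {g : α → List ℕ} (hf : Primrec f)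
    (hg : Primrec g) : Primrec fun x => gather (f x) (g x) := by unfold gather; fun_prop
@[fun_prop] theorem primrec_rep {f g : α → ℕ} (hf : Primrec f) (hg : Primrec g) :
    Primrec fun x => rep (f x) (g x) := by unfold rep; fun_prop
@[fun_prop] theorem primrec_vadd {f : α → ℕ} (hf : Primrec f) :
    Primrec fun x => vadd (f x) := by unfold vadd; fun_prop
@[fun_prop] theorem primrec_vsub {f : α → ℕ} (hf : Primrec f) :
    Primrec fun x => vsub (f x) := by unfold vsub; fun_prop
@[fun_prop] theorem primrec_pmul {f : α → ℕ} (hf : Primrec f) :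
    Primrec fun x => pmul (f x) := by unfold pmul; fun_prop
@[fun_prop] theorem primrec_mmul {f g : α → ℕ} (hf : Primrec f) (hg : Primrec g) :
    Primrec fun x => mmul (f x) (g x) := by unfold mmul; fun_prop

@[fun_prop] theorem primrec_position [DecidableEq β] {f : α → List β} {g : α → β}
    (hf : Primrec f) (hg : Primrec g) : Primrec fun x => position (f x) (g x) := by
  unfold position; fun_prop

@[fun_prop] theorem primrec_relabel [DecidableEq β] {f g : α → List β} (hf : Primrec f)
    (hg : Primrec g) : Primrec fun x => relabel (f x) (g x) := by unfold relabel; fun_prop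

@[fun_prop] theorem primrec_mapCode {q : α → ℕ} {items : α → List ι} {len : α → ι → ℕ}
    {body : α → ι → VCode} (hq : Primrec q) (hi : Primrec items)
    (hl : Primrec fun p : α × ι => len p.1 p.2) (hb : Primrec fun p : α × ι => body p.1 p.2) :
    Primrec fun x => mapCode (q x) (items x) (len x) (body x) := by
  unfold mapCode
  fun_prop

end Primrec

/-! ### Weights -/

/-- The number of field operations of an instruction, apart from matrix products, when the unit is
the cost per coefficient of a polynomial multiplication. -/
def wt (i : VInstr) : ℕ := if 6 ≤ i.1 ∧ i.1 ≤ 9 then i.2.getD 0 0 else 0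

/-- The degree of a matrix product. -/
def mwt (i : VInstr) : ℕ := if i.1 = 10 then i.2.getD 1 0 else 0

/-- The polynomial products in an instruction have degree at most `B`, its matrix products have
order `m` and degree at most `δ`, and it is an instruction of the machine. -/
def Admissible (B m δ : ℕ) (i : VInstr) : Prop :=
  i.1 ≤ 10 ∧ (i.1 = 9 → 1 ≤ i.2.getD 0 0 ∧ i.2.getD 0 0 ≤ B) ∧
    (i.1 = 10 → i.2.getD 0 0 = m ∧ 1 ≤ i.2.getD 1 0 ∧ i.2.getD 1 0 ≤ δ)

/-- The program `c` is admissible, and its weights are at most `w` and `w'`. -/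
structure Cost (B m δ : ℕ) (c : VCode) (w w' : ℕ) : Prop where
  adm : ∀ i ∈ c, Admissible B m δ i
  wt_le : (c.map wt).sum ≤ w
  mwt_le : (c.map mwt).sum ≤ w'

namespace Cost

variable {B m δ : ℕ}

theorem mono {c : VCode} {w w' v v' : ℕ} (h : Cost B m δ c w w') (hw : w ≤ v) (hw' : w' ≤ v') :
    Cost B m δ c v v' := ⟨h.adm, h.wt_le.trans hw, h.mwt_le.trans hw'⟩

theorem nil : Cost B m δ [] 0 0 := ⟨by simp, by simp, by simp⟩

theorem append {c d : VCode} {w w' v v' : ℕ} (hc : Cost B m δ c w w') (hd : Cost B m δ d v v') :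
    Cost B m δ (c ++ d) (w + v) (w' + v') := by
  refine ⟨?_, ?_, ?_⟩
  · intro i hi
    rcases List.mem_append.1 hi with h | h
    exacts [hc.adm i h, hd.adm i h]
  · simpa using add_le_add hc.wt_le hd.wt_le
  · simpa using add_le_add hc.mwt_le hd.mwt_le

theorem cons {i : VInstr} {d : VCode} {w w' v v' : ℕ} (hc : Cost B m δ [i] w w')
    (hd : Cost B m δ d v v') : Cost B m δ (i :: d) (w + v) (w' + v') :=
  hc.append hd

theorem free {i : VInstr} (hi : i.1 < 6) : Cost B m δ [i] 0 0 := by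
  refine ⟨?_, ?_, ?_⟩
  · simp only [List.mem_singleton, forall_eq]
    exact ⟨by omega, fun h => by omega, fun h => by omega⟩
  · simp [wt]; omega
  · simp [mwt]; omega

theorem wire (n : ℕ) (idx : List ℕ) : Cost B m δ [wire n idx] 0 0 := free (by simp [Residual.wire])
theorem cat : Cost B m δ [cat] 0 0 := free (by simp [Residual.cat])
theorem vtake (n : ℕ) : Cost B m δ [vtake n] 0 0 := free (by simp [Residual.vtake])
theorem vdrop (n : ℕ) : Cost B m δ [vdrop n] 0 0 := free (by simp [Residual.vdrop])
theorem gather (n : ℕ) (idx : List ℕ) : Cost B m δ [gather n idx] 0 0 :=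
  free (by simp [Residual.gather])
theorem rep (j n : ℕ) : Cost B m δ [rep j n] 0 0 := free (by simp [Residual.rep])
theorem relabel {α : Type*} [DecidableEq α] (s t : List α) : Cost B m δ [relabel s t] 0 0 :=
  gather _ _
theorem vadd (n : ℕ) : Cost B m δ [vadd n] n 0 := by
  refine ⟨?_, ?_, ?_⟩ <;> simp [Admissible, Residual.vadd, wt, mwt]
theorem vsub (n : ℕ) : Cost B m δ [vsub n] n 0 := by
  refine ⟨?_, ?_, ?_⟩ <;> simp [Admissible, Residual.vsub, wt, mwt]
theorem vdiv (n : ℕ) : Cost B m δ [vdiv n] n 0 := by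
  refine ⟨?_, ?_, ?_⟩ <;> simp [Admissible, Residual.vdiv, wt, mwt]
theorem pmul {d : ℕ} (h1 : 1 ≤ d) (h2 : d ≤ B) : Cost B m δ [pmul d] d 0 := by
  refine ⟨?_, ?_, ?_⟩ <;> simp [Admissible, Residual.pmul, wt, mwt, h1, h2]
theorem mmul {d : ℕ} (h1 : 1 ≤ d) (h2 : d ≤ δ) : Cost B m δ [mmul m d] 0 d := by
  refine ⟨?_, ?_, ?_⟩ <;> simp [Admissible, Residual.mmul, wt, mwt, h1, h2]

theorem flatMap {ι : Type*} (items : List ι) {body : ι → VCode} {w w' : ι → ℕ}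
    (h : ∀ i ∈ items, Cost B m δ (body i) (w i) (w' i)) :
    Cost B m δ (items.flatMap body) (items.map w).sum (items.map w').sum := by
  induction items with
  | nil => exact nil
  | cons i items ih =>
    exact (h i (by simp)).append (ih fun j hj => h j (by simp [hj]))

theorem mapCode {ι : Type*} (q : ℕ) (items : List ι) {len : ι → ℕ} {body : ι → VCode}
    {w w' : ι → ℕ} (h : ∀ i ∈ items, Cost B m δ (body i) (w i) (w' i)) :
    Cost B m δ (mapCode q items len body) (items.map w).sum (items.map w').sum := by
  have h1 : ∀ i ∈ items, Cost B m δ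
      ([Residual.wire (q + 2) ([1] ++ (List.range q).map (· + 2) ++ List.range (q + 2)),
        Residual.vtake (len i)] ++ body i ++
        [Residual.wire 2 [1, 0], Residual.cat, Residual.wire 2 [1, 0], Residual.vdrop (len i),
          Residual.wire 2 [1, 0]]) (w i) (w' i) := by
    intro i hi
    refine mono ((((wire _ _).cons (vtake _)).append (h i hi)).append ((wire _ _).cons
      (cat.cons ((wire _ _).cons ((vdrop _).cons (wire _ _)))))) (by omega) (by omega)
  exact (((rep 0 0).append (flatMap items h1)).append (wire _ _)).mono (by omega) (by omega)

end Cost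

variable {K : Type*} [Field K]

/-! ### Coefficient vectors -/

@[simp] theorem length_polyCoeffs (p : K[X]) (n : ℕ) : (polyCoeffs p n).length = n := by
  simp [polyCoeffs]

@[simp] theorem polyCoeffs_zero_right (p : K[X]) : polyCoeffs p 0 = [] := rfl

theorem polyCoeffs_congr {p q : K[X]} {n : ℕ} (h : ∀ i < n, p.coeff i = q.coeff i) :
    polyCoeffs p n = polyCoeffs q n :=
  List.map_congr_left fun i hi => h i (List.mem_range.1 hi)

theorem polyCoeffs_congr_dvd {p q : K[X]} {n : ℕ} (h : X ^ n ∣ p - q) :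
    polyCoeffs p n = polyCoeffs q n :=
  polyCoeffs_congr fun i hi => sub_eq_zero.1 (by
    rw [← coeff_sub]; exact (X_pow_dvd_iff.1 h) i hi)

theorem getD_polyCoeffs (p : K[X]) (n i : ℕ) :
    (polyCoeffs p n).getD i 0 = if i < n then p.coeff i else 0 := by
  unfold polyCoeffs
  split_ifs with h <;> simp [List.getD_eq_getElem?_getD, h]

theorem take_polyCoeffs (p : K[X]) {k n : ℕ} (h : k ≤ n) :
    (polyCoeffs p n).take k = polyCoeffs p k := by
  rw [polyCoeffs, ← List.map_take, List.take_range, min_eq_left h, polyCoeffs]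

theorem polyCoeffs_append {a b : K[X]} {k : ℕ} (n : ℕ) (ha : a.degree < k) :
    polyCoeffs a k ++ polyCoeffs b n = polyCoeffs (a + X ^ k * b) (k + n) := by
  have ha' := degree_lt_iff_coeff_zero _ _ |>.1 ha
  rw [polyCoeffs, polyCoeffs, polyCoeffs, List.range_add, List.map_append, List.map_map]
  congr 1
  · refine List.map_congr_left fun i hi => ?_
    have : ¬ k ≤ i := by simpa using hi
    simp [coeff_X_pow_mul', this]
  · refine List.map_congr_left fun i hi => ?_
    simp [coeff_X_pow_mul', ha' (k + i) (by omega)]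

theorem exists_split (p : K[X]) (k : ℕ) : ∃ a b : K[X], a.degree < k ∧ p = a + X ^ k * b := by
  refine ⟨p %ₘ X ^ k, p /ₘ X ^ k, ?_, (modByMonic_add_div p _).symm⟩
  simpa using degree_modByMonic_lt p (monic_X_pow (R := K) k)

theorem zipWith_add_polyCoeffs (p q : K[X]) (n : ℕ) :
    List.zipWith (· + ·) (polyCoeffs p n) (polyCoeffs q n) = polyCoeffs (p + q) n := by
  simp [polyCoeffs, List.zipWith_map]

theorem zipWith_sub_polyCoeffs (p q : K[X]) (n : ℕ) :
    List.zipWith (· - ·) (polyCoeffs p n) (polyCoeffs q n) = polyCoeffs (p - q) n := by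
  simp [polyCoeffs, List.zipWith_map]

theorem polyCoeffs_zero (n : ℕ) : polyCoeffs (0 : K[X]) n = List.replicate n 0 := by
  exact List.ext_getElem (by simp) fun i h1 h2 => by simp [polyCoeffs]

theorem polyCoeffs_one_one : polyCoeffs (1 : K[X]) 1 = [1] := by
  simp [polyCoeffs]

theorem natDegree_le_of_degree_lt {p : K[X]} {n : ℕ} (h : p.degree < (n + 1 : ℕ)) :
    p.natDegree ≤ n :=
  natDegree_le_iff_coeff_eq_zero.2 fun N hN => (degree_lt_iff_coeff_zero _ _).1 h N hN

/-! ### Programs for univariate polynomials -/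

/-- Multiply by `X ^ s` a polynomial with `len` coefficients, and keep `n` coefficients. -/
def place (len s n : ℕ) : VInstr :=
  gather len ((List.range n).map fun i => if i < s then len else i - s)

/-- Reverse a vector. -/
def vrev (n : ℕ) : VInstr := gather n ((List.range n).map fun i => n - 1 - i)

/-- Split a vector after `k` entries; the second part gets on top. -/
def cut (k : ℕ) : VCode := [wire 1 [0, 0], vtake k, wire 2 [1, 0], vdrop k]

/-- Append the leading coefficient of a monic polynomial. -/
def monicCode : VCode := [rep 1 1, wire 2 [1, 0], cat]

/-- Multiply polynomials with `a` and `b` coefficients, and keep `o` coefficients. -/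
def mulCode (d a b o : ℕ) : VCode :=
  if d = 0 then [wire 2 [], rep 0 o]
  else [place a 0 (d + 1), wire 2 [1, 0], place b 0 (d + 1), pmul d, vtake o]

namespace Arith

variable (A : Arith K)

theorem run_rep_zero (n : ℕ) (k : VCode) (st : List (List K)) :
    A.run (rep 0 n :: k) st = A.run k (polyCoeffs (0 : K[X]) n :: st) := by
  rw [run_rep, polyCoeffs_zero, constant]

theorem run_rep_one (k : VCode) (st : List (List K)) :
    A.run (rep 1 1 :: k) st = A.run k (polyCoeffs (1 : K[X]) 1 :: st) := by
  rw [run_rep, polyCoeffs_one_one, constant]; rfl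

theorem run_place {p : K[X]} {len s n : ℕ} (h : ∀ i, len ≤ i → s + i < n → p.coeff i = 0)
    (k : VCode) (st : List (List K)) :
    A.run (place len s n :: k) (polyCoeffs p len :: st) =
      A.run k (polyCoeffs (X ^ s * p) n :: st) := by
  rw [place, A.run_gather (by simp), List.map_map]
  congr 2
  refine List.map_congr_left fun i hi => ?_
  have hi : i < n := List.mem_range.1 hi
  rw [Function.comp, getD_polyCoeffs, coeff_X_pow_mul']
  by_cases h1 : i < s
  · simp [h1]
  · simp only [h1, if_false, not_lt.1 h1, if_true]
    split_ifs with h2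
    · rfl
    · exact (h _ (by omega) (by omega)).symm

theorem run_place_of_degree_lt {p : K[X]} {len n : ℕ} (h : p.degree < len)
    (k : VCode) (st : List (List K)) :
    A.run (place len 0 n :: k) (polyCoeffs p len :: st) = A.run k (polyCoeffs p n :: st) := by
  rw [A.run_place fun i hi _ => (degree_lt_iff_coeff_zero _ _).1 h i hi]
  simp

theorem run_vrev {p : K[X]} {n : ℕ} (k : VCode) (st : List (List K)) :
    A.run (vrev n :: k) (polyCoeffs p n :: st) =
      A.run k (polyCoeffs (p.reflect (n - 1)) n :: st) := by
  rw [vrev, A.run_gather (by simp), List.map_map]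
  congr 2
  refine List.map_congr_left fun i hi => ?_
  have hi : i < n := List.mem_range.1 hi
  rw [Function.comp, getD_polyCoeffs, coeff_reflect, revAt_le (by omega), if_pos (by omega)]

theorem run_cut {a b : List K} {n : ℕ} (ha : a.length = n) (k : VCode) (st : List (List K)) :
    A.run (cut n ++ k) ((a ++ b) :: st) = A.run k (b :: a :: st) := by
  subst ha
  simp [cut, run_wire, run_vtake, run_vdrop]

theorem run_cut_polyCoeffs {p q : K[X]} {n o : ℕ} (k : VCode) (st : List (List K)) :
    A.run (cut n ++ k) ((polyCoeffs p n ++ polyCoeffs q o) :: st) =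
      A.run k (polyCoeffs q o :: polyCoeffs p n :: st) :=
  A.run_cut (by simp) k st

theorem run_monicCode {p : K[X]} {n : ℕ} (hp : p.degree < n) (k : VCode) (st : List (List K)) :
    A.run (monicCode ++ k) (polyCoeffs p n :: st) =
      A.run k (polyCoeffs (p + X ^ n) (n + 1) :: st) := by
  simp only [monicCode, List.cons_append, List.nil_append, A.run_rep_one, A.run_wire, A.run_cat,
    List.map_cons, List.map_nil, List.getD_cons_succ, List.getD_cons_zero, List.drop_succ_cons,
    List.drop_zero]
  rw [polyCoeffs_append 1 hp, mul_one]

theorem run_mulCode {p q : K[X]} {d a b o : ℕ} (hp : p.degree < a) (hq : q.degree < b)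
    (ha : a ≤ d + 1) (hb : b ≤ d + 1) (ho : o ≤ 2 * d + 1) (hd : d = 0 → o = 0) (k : VCode)
    (st : List (List K)) :
    A.run (mulCode d a b o ++ k) (polyCoeffs p a :: polyCoeffs q b :: st) =
      A.run k (polyCoeffs (p * q) o :: st) := by
  unfold mulCode
  split_ifs with h
  · simp [A.run_wire, A.run_rep_zero, hd h]
  · have hp' : p.natDegree ≤ d :=
      natDegree_le_of_degree_lt (hp.trans_le (by exact_mod_cast ha))
    have hq' : q.natDegree ≤ d :=
      natDegree_le_of_degree_lt (hq.trans_le (by exact_mod_cast hb))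
    simp only [List.cons_append, List.nil_append, A.run_place_of_degree_lt hp, A.run_wire,
      List.map_cons, List.map_nil, List.getD_cons_succ, List.getD_cons_zero, List.drop_succ_cons,
      List.drop_zero, A.run_place_of_degree_lt hq, A.run_pmul (by omega : 1 ≤ d) hq' hp',
      A.run_vtake, take_polyCoeffs _ ho]
    rw [mul_comm]

theorem run_mulCode_trunc (p q : K[X]) (n : ℕ) (k : VCode) (st : List (List K)) :
    A.run (mulCode n n n n ++ k) (polyCoeffs p n :: polyCoeffs q n :: st) =
      A.run k (polyCoeffs (p * q) n :: st) := by
  obtain ⟨a, b, ha, rfl⟩ := exists_split p n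
  obtain ⟨c, d, hc, rfl⟩ := exists_split q n
  rw [polyCoeffs_congr_dvd (p := a + X ^ n * b) (q := a) ⟨b, by ring⟩,
    polyCoeffs_congr_dvd (p := c + X ^ n * d) (q := c) ⟨d, by ring⟩,
    A.run_mulCode ha hc (by omega) (by omega) (by omega) id]
  rw [polyCoeffs_congr_dvd (p := a * c) (q := (a + X ^ n * b) * (c + X ^ n * d))]
  exact ⟨-(a * d + b * c + X ^ n * b * d), by ring⟩

end Arith

/-! ### Inversion of power series -/

/-- Newton iteration, on a list whose length is the number of coefficients. -/
def invRec : List ℕ → VCode :=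
  splitRec (fun l => if l.length = 0 then [] else [rep 1 1, vdiv 1]) fun l c _ =>
    [wire 1 [0, 0], vtake ((l.length + 1) / 2)] ++ c ++
    [place ((l.length + 1) / 2) 0 l.length, wire 2 [0, 1, 0]] ++
    mulCode l.length l.length l.length l.length ++
    [rep 1 1, place 1 0 l.length, vsub l.length, wire 2 [0, 1, 1]] ++
    mulCode l.length l.length l.length l.length ++ [vadd l.length]

theorem invRec_of_le {l : List ℕ} (h : 2 ≤ l.length) : invRec l =
    [wire 1 [0, 0], vtake ((l.length + 1) / 2)] ++ invRec (l.take ((l.length + 1) / 2)) ++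
    [place ((l.length + 1) / 2) 0 l.length, wire 2 [0, 1, 0]] ++
    mulCode l.length l.length l.length l.length ++
    [rep 1 1, place 1 0 l.length, vsub l.length, wire 2 [0, 1, 1]] ++
    mulCode l.length l.length l.length l.length ++ [vadd l.length] :=
  splitRec_of_le h

/-- Invert a power series with `n` coefficients. -/
def invCode (n : ℕ) : VCode := invRec (List.replicate n 0)

theorem newton_step {p v v₀ : K[X]} {n h : ℕ} (hn : n ≤ 2 * h) (hv : X ^ n ∣ p * v - 1)
    (hv₀ : X ^ h ∣ p * v₀ - 1) : X ^ n ∣ v₀ * (1 - p * v₀) + v₀ - v := by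
  have h1 : (X : K[X]) ^ n ∣ (p * v₀ - 1) ^ 2 :=
    (pow_dvd_pow X hn).trans (by rw [mul_comm, pow_mul]; exact pow_dvd_pow_of_dvd hv₀ 2)
  have h2 : v₀ * (1 - p * v₀) + v₀ - v =
      -(v * (p * v₀ - 1) ^ 2) - (p * v - 1) * (v₀ * (1 - p * v₀) + v₀) := by ring
  rw [h2]
  exact dvd_sub ((h1.mul_left v).neg_right) (hv.mul_right _)

theorem coeff_zero_mul_of_dvd {p v : K[X]} {n : ℕ} (hn : n ≠ 0) (hv : X ^ n ∣ p * v - 1) :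
    p.coeff 0 * v.coeff 0 = 1 := by
  have h := X_pow_dvd_iff.1 hv 0 (by omega)
  rw [coeff_sub, mul_coeff_zero, coeff_one_zero] at h
  exact sub_eq_zero.1 h

theorem Arith.run_invCode (A : Arith K) {p v : K[X]} {n : ℕ} (hv : X ^ n ∣ p * v - 1)
    (k : VCode) (st : List (List K)) :
    A.run (invCode n ++ k) (polyCoeffs p n :: st) = A.run k (polyCoeffs v n :: st) := by
  unfold invCode
  induction n using Nat.strong_induction_on generalizing v k st with
  | _ n ih =>
    rcases lt_or_ge n 2 with h | h
    · rw [invRec, splitRec_of_lt (by simpa using h)]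
      obtain rfl | rfl : n = 0 ∨ n = 1 := by omega
      · simp
      · have h1 := coeff_zero_mul_of_dvd one_ne_zero hv
        have h2 : p.coeff 0 ≠ 0 := left_ne_zero_of_mul (h1.trans_ne one_ne_zero)
        have h3 : ∀ q : K[X], polyCoeffs q 1 = [q.coeff 0] := fun q => rfl
        simp only [List.length_replicate, if_neg one_ne_zero, List.cons_append, List.nil_append,
          A.run_rep_one, h3, A.run_vdiv_one h2]
        rw [coeff_one_zero, one_div, eq_inv_of_mul_eq_one_right h1]
    · rw [invRec_of_le (by simpa using h)]
      simp only [List.take_replicate, List.length_replicate]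
      set m := (n + 1) / 2 with hm
      have hmn : m ≤ n := by omega
      rw [min_eq_left hmn]
      obtain ⟨a, b, ha, hab⟩ := exists_split v m
      have hvm : X ^ m ∣ p * v - 1 := (pow_dvd_pow X hmn).trans hv
      have ham : X ^ m ∣ p * a - 1 := by
        have : p * a - 1 = p * v - 1 - X ^ m * (p * b) := by rw [hab]; ring
        rw [this]
        exact dvd_sub hvm (dvd_mul_right _ _)
      simp only [List.append_assoc, List.cons_append, List.nil_append, A.run_wire, A.run_vtake,
        List.map_cons, List.map_nil, List.getD_cons_zero,
        List.drop_succ_cons, List.drop_zero, take_polyCoeffs _ hmn]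
      rw [ih m (by omega) ham, A.run_place_of_degree_lt ha]
      simp
      rw [A.run_mulCode_trunc, A.run_rep_one, A.run_place_of_degree_lt (by simp),
        A.run_vsub (by simp) (by simp), zipWith_sub_polyCoeffs]
      simp
      rw [A.run_mulCode_trunc, A.run_vadd (by simp) (by simp), zipWith_add_polyCoeffs]
      congr 2
      refine polyCoeffs_congr_dvd ?_
      have := newton_step (n := n) (h := m) (by omega) hv ham
      rwa [mul_comm a p, mul_comm _ a]

/-! ### Shifts -/

/-- Divide and conquer for `p (X + x)` and `(X + x) ^ n`, on a list of length `n`. -/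
def shiftRec : List ℕ → VCode :=
  splitRec (fun l => if l.length = 0 then [wire 2 [0]] else [cat]) fun l c₁ c₂ =>
    [wire 2 [0, 1, 0, 1], vtake ((l.length + 1) / 2)] ++ c₁ ++
    [wire 3 [1, 2, 0], vdrop ((l.length + 1) / 2)] ++ c₂ ++
    cut (l.length - (l.length + 1) / 2) ++ [wire 3 [2, 0, 1]] ++ cut ((l.length + 1) / 2) ++
    monicCode ++ [wire 4 [2, 0, 1, 3]] ++ monicCode ++ [wire 4 [1, 3, 2, 1, 0]] ++
    mulCode l.length ((l.length + 1) / 2 + 1) (l.length - (l.length + 1) / 2) l.length ++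
    [wire 2 [1, 0], place ((l.length + 1) / 2) 0 l.length, vadd l.length, wire 3 [1, 2, 0]] ++
    mulCode l.length ((l.length + 1) / 2 + 1) (l.length - (l.length + 1) / 2 + 1) l.length ++
    [wire 2 [1, 0], cat]

theorem shiftRec_of_le {l : List ℕ} (h : 2 ≤ l.length) : shiftRec l =
    [wire 2 [0, 1, 0, 1], vtake ((l.length + 1) / 2)] ++ shiftRec (l.take ((l.length + 1) / 2)) ++
    [wire 3 [1, 2, 0], vdrop ((l.length + 1) / 2)] ++ shiftRec (l.drop ((l.length + 1) / 2)) ++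
    cut (l.length - (l.length + 1) / 2) ++ [wire 3 [2, 0, 1]] ++ cut ((l.length + 1) / 2) ++
    monicCode ++ [wire 4 [2, 0, 1, 3]] ++ monicCode ++ [wire 4 [1, 3, 2, 1, 0]] ++
    mulCode l.length ((l.length + 1) / 2 + 1) (l.length - (l.length + 1) / 2) l.length ++
    [wire 2 [1, 0], place ((l.length + 1) / 2) 0 l.length, vadd l.length, wire 3 [1, 2, 0]] ++
    mulCode l.length ((l.length + 1) / 2 + 1) (l.length - (l.length + 1) / 2 + 1) l.length ++
    [wire 2 [1, 0], cat] :=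
  splitRec_of_le h

/-- From `p` and `x` compute `p (X + x)` and the lower coefficients of `(X + x) ^ n`. -/
def shiftCode (n : ℕ) : VCode := shiftRec (List.replicate n 0)

theorem degree_X_add_C_pow_sub (x : K) (n : ℕ) :
    ((X + C x) ^ n - X ^ n : K[X]).degree < n := by
  have h1 : ((X + C x) ^ n : K[X]).Monic := (monic_X_add_C x).pow n
  have h2 : ((X + C x) ^ n : K[X]).degree = n := by simp
  refine (degree_sub_lt_left (by simp) h1.ne_zero (by simp [h1.leadingCoeff])).trans_eq h2

theorem degree_comp_X_add_C_lt {p : K[X]} {n : ℕ} (x : K) (hp : p.degree < n) :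
    (p.comp (X + C x)).degree < n := by
  rcases eq_or_ne p 0 with rfl | h0
  · simp
  · have h1 : p.comp (X + C x) ≠ 0 := by
      intro h
      rw [← taylor_apply, LinearMap.map_eq_zero_iff _ (taylor_injective x)] at h
      exact h0 h
    rw [degree_eq_natDegree h1, natDegree_comp, natDegree_X_add_C, mul_one,
      ← degree_eq_natDegree h0]
    exact hp

theorem Arith.run_shiftCode (A : Arith K) {p : K[X]} (x : K) {n : ℕ} (hp : p.degree < n)
    (k : VCode) (st : List (List K)) :
    A.run (shiftCode n ++ k) (polyCoeffs p n :: [x] :: st) =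
      A.run k ((polyCoeffs (p.comp (X + C x)) n ++ polyCoeffs ((X + C x) ^ n - X ^ n) n) :: st) := by
  unfold shiftCode
  induction n using Nat.strong_induction_on generalizing p k st with
  | _ n ih =>
    rcases lt_or_ge n 2 with h | h
    · rw [shiftRec, splitRec_of_lt (by simpa using h)]
      obtain rfl | rfl : n = 0 ∨ n = 1 := by omega
      · simp [A.run_wire]
      · have h3 : ∀ q : K[X], polyCoeffs q 1 = [q.coeff 0] := fun q => rfl
        have h4 : p = C (p.coeff 0) := eq_C_of_degree_le_zero (by
          rw [degree_le_iff_coeff_zero]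
          intro i hi
          exact (degree_lt_iff_coeff_zero _ _).1 hp i (by exact_mod_cast hi))
        simp only [List.length_replicate, if_neg one_ne_zero, List.cons_append, List.nil_append,
          A.run_cat, h3]
        congr 3
        · rw [h4]; simp
        · simp
    · rw [shiftRec_of_le (by simpa using h)]
      simp only [List.take_replicate, List.drop_replicate, List.length_replicate]
      have hle : (n + 1) / 2 ≤ n := by omega
      obtain ⟨l, hl⟩ : ∃ l, n = (n + 1) / 2 + l := ⟨n - (n + 1) / 2, by omega⟩
      rw [min_eq_left hle]
      have hln : n - (n + 1) / 2 = l := by omega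
      rw [hln]
      set m := (n + 1) / 2 with hm
      obtain ⟨a, b, ha, rfl⟩ := exists_split p m
      have hb : b.degree < l := by
        rw [degree_lt_iff_coeff_zero] at hp ha ⊢
        intro i hi
        have := hp (i + m) (by omega)
        rwa [coeff_add, ha _ (by omega), coeff_X_pow_mul, zero_add] at this
      have e1 : polyCoeffs (a + X ^ m * b) n = polyCoeffs a m ++ polyCoeffs b l := by
        rw [polyCoeffs_append l ha, ← hl]
      rw [e1]
      have h1 := degree_X_add_C_pow_sub x m
      have h2 := degree_X_add_C_pow_sub x l
      have h3 := degree_comp_X_add_C_lt x ha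
      have h4 := degree_comp_X_add_C_lt x hb
      simp only [List.append_assoc, List.cons_append, List.nil_append, A.run_wire, A.run_vtake,
        List.map_cons, List.map_nil, List.getD_cons_succ, List.getD_cons_zero,
        List.drop_succ_cons, List.drop_zero, List.take_left' (length_polyCoeffs a m)]
      rw [ih m (by omega) ha]
      simp only [List.cons_append, List.nil_append, A.run_wire, A.run_vdrop,
        List.map_cons, List.map_nil, List.getD_cons_succ, List.getD_cons_zero,
        List.drop_succ_cons, List.drop_zero, List.drop_left' (length_polyCoeffs a m)]
      rw [ih l (by omega) hb, A.run_cut_polyCoeffs]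
      simp
      rw [A.run_cut_polyCoeffs, A.run_monicCode h1]
      simp
      rw [A.run_monicCode h2]
      simp
      have h5 : ∀ j : ℕ, ((X + C x : K[X]) ^ j).degree < (j + 1 : ℕ) := by
        intro j
        have : ((X + C x) ^ j : K[X]).degree = j := by simp
        rw [this]
        exact_mod_cast Nat.lt_succ_self j
      rw [A.run_mulCode (h5 m) h4 (by omega) (by omega) (by omega) (by omega)]
      simp
      rw [A.run_place_of_degree_lt h3, A.run_vadd (by simp) (by simp), zipWith_add_polyCoeffs,
        A.run_wire]
      simp
      rw [A.run_mulCode (h5 m) (h5 l) (by omega) (by omega) (by omega) (by omega)]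
      simp
      congr 3
      · rw [← pow_add, ← hl]
        exact polyCoeffs_congr_dvd (by simp)

/-! ### Remainders -/

/-- From `r`, `c`, the lower coefficients of a monic polynomial `F` of degree `n`, and the inverse
of its reverse, compute the remainder of `r X ^ n + c` modulo `F`. -/
def remStep (n : ℕ) : VCode :=
  [wire 4 [0, 3, 1, 2], vrev n] ++ mulCode n n n n ++ [vrev n, wire 3 [0, 2, 1]] ++
    mulCode n n n n ++ [wire 2 [1, 0], vsub n]

/-- Horner's rule: the remainder of a polynomial with `(q + 1) n` coefficients. -/
def hornerCode (n : ℕ) : ℕ → VCode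
  | 0 => [wire 3 [0]]
  | q + 1 => [wire 3 [0, 1, 2, 0, 1, 2], vdrop n] ++ hornerCode n q ++
      [wire 4 [1, 0, 2, 3], vtake n, wire 2 [1, 0]] ++ remStep n

/-- The remainder of a polynomial with `N` coefficients modulo a monic polynomial of degree `n`. -/
def remCode (n N : ℕ) : VCode :=
  if n = 0 then [wire 3 [], rep 0 0]
  else [place N 0 (((N - 1) / n + 1) * n)] ++ hornerCode n ((N - 1) / n)

theorem reflect_quotient {F U q r s : K[X]} {n : ℕ} (hn : 1 ≤ n) (hF : F.natDegree ≤ n)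
    (hU : X ^ n ∣ F.reflect n * U - 1) (hq : q.degree < n) (hr : r.degree < n)
    (hs : s.degree < n) (h : r * X ^ n = q * F + s) :
    X ^ n ∣ r.reflect (n - 1) * U - q.reflect (n - 1) := by
  have key : ∀ t : K[X], t.degree < n → t.natDegree ≤ n - 1 := fun t ht =>
    natDegree_le_of_degree_lt (by rwa [Nat.sub_add_cancel hn])
  have h1 : (r * X ^ n).reflect (n - 1 + n) = r.reflect (n - 1) := by
    rw [reflect_mul _ _ (key r hr) (natDegree_X_pow_le n), reflect_monomial]
    simp
  have h2 : (q * F).reflect (n - 1 + n) = q.reflect (n - 1) * F.reflect n :=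
    reflect_mul _ _ (key q hq) hF
  have h3 : X ^ n ∣ s.reflect (n - 1 + n) := by
    rw [X_pow_dvd_iff]
    intro d hd
    rw [coeff_reflect, revAt_le (by omega)]
    exact (degree_lt_iff_coeff_zero _ _).1 hs _ (by omega)
  have h4 : r.reflect (n - 1) = q.reflect (n - 1) * F.reflect n + s.reflect (n - 1 + n) := by
    rw [← h1, h, reflect_add, h2]
  rw [h4]
  have : (q.reflect (n - 1) * F.reflect n + s.reflect (n - 1 + n)) * U - q.reflect (n - 1) =
      q.reflect (n - 1) * (F.reflect n * U - 1) + s.reflect (n - 1 + n) * U := by ring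
  rw [this]
  exact dvd_add (hU.mul_left _) (h3.mul_right _)

theorem reflect_reflect (p : K[X]) (n : ℕ) : (p.reflect n).reflect n = p := by
  ext i
  simp

/-- The data of a monic polynomial `F` of degree `n` for divisions: its lower coefficients, and the
inverse `U` of its reverse. -/
structure IsDivisor (F U : K[X]) (n : ℕ) : Prop where
  monic : F.Monic
  natDegree_eq : F.natDegree = n
  inv : X ^ n ∣ F.reflect n * U - 1

theorem IsDivisor.degree_mod_lt {F U : K[X]} {n : ℕ} (h : IsDivisor F U n) (p : K[X]) :
    (p %ₘ F).degree < n := by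
  have := degree_modByMonic_lt p h.monic
  rwa [degree_eq_natDegree h.monic.ne_zero, h.natDegree_eq] at this

theorem polyCoeffs_monic {F : K[X]} {n : ℕ} :
    polyCoeffs F n = polyCoeffs (F - X ^ n) n :=
  polyCoeffs_congr_dvd (by simp)

theorem Arith.run_remStep (A : Arith K) {F U r c : K[X]} {n : ℕ} (hn : 1 ≤ n)
    (h : IsDivisor F U n) (hr : r.degree < n) (hc : c.degree < n) (k : VCode)
    (st : List (List K)) :
    A.run (remStep n ++ k)
        (polyCoeffs r n :: polyCoeffs c n :: polyCoeffs F n :: polyCoeffs U n :: st) =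
      A.run k (polyCoeffs ((r * X ^ n + c) %ₘ F) n :: st) := by
  set q := (r * X ^ n) /ₘ F with hq
  set s := (r * X ^ n) %ₘ F with hs
  have e : r * X ^ n = q * F + s := by
    rw [hq, hs, mul_comm _ F, add_comm]; exact (modByMonic_add_div _ _).symm
  have hsd : s.degree < n := h.degree_mod_lt _
  have hqd : q.degree < n := by
    rcases eq_or_ne r 0 with rfl | h0
    · rw [hq, zero_mul, zero_divByMonic]; exact hr
    rcases eq_or_ne q 0 with h1 | h1
    · rw [h1]; simp
    rw [degree_eq_natDegree h1, hq, natDegree_divByMonic _ h.monic, h.natDegree_eq,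
      natDegree_mul_X_pow n h0, Nat.add_sub_cancel, ← degree_eq_natDegree h0]
    exact hr
  have h1 := reflect_quotient hn h.natDegree_eq.le h.inv hqd hr hsd e
  have h2 : (r * X ^ n + c) %ₘ F = s + c := by
    rw [add_modByMonic, ← hs, (modByMonic_eq_self_iff h.monic).2]
    rwa [degree_eq_natDegree h.monic.ne_zero, h.natDegree_eq]
  simp only [remStep, List.append_assoc, List.cons_append, List.nil_append, A.run_wire,
    List.map_cons, List.map_nil, List.getD_cons_succ, List.getD_cons_zero, A.run_vrev,
    List.drop_succ_cons, List.drop_zero]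
  rw [A.run_mulCode_trunc, polyCoeffs_congr_dvd h1, A.run_vrev, reflect_reflect]
  simp
  rw [A.run_mulCode_trunc]
  simp
  rw [A.run_vsub (by simp) (by simp), zipWith_sub_polyCoeffs]
  congr 2
  refine polyCoeffs_congr_dvd ⟨-r, ?_⟩
  rw [h2]
  linear_combination e

theorem Arith.run_hornerCode (A : Arith K) {F U : K[X]} {n : ℕ} (hn : 1 ≤ n)
    (h : IsDivisor F U n) (q : ℕ) {p : K[X]} (hp : p.degree < ((q + 1) * n : ℕ)) (k : VCode)
    (st : List (List K)) :
    A.run (hornerCode n q ++ k)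
        (polyCoeffs p ((q + 1) * n) :: polyCoeffs F n :: polyCoeffs U n :: st) =
      A.run k (polyCoeffs (p %ₘ F) n :: st) := by
  induction q generalizing p k st with
  | zero =>
    rw [(modByMonic_eq_self_iff h.monic).2]
    · simp [hornerCode]
    · rw [degree_eq_natDegree h.monic.ne_zero, h.natDegree_eq]
      simpa using hp
  | succ q ih =>
    obtain ⟨a, b, ha, rfl⟩ := exists_split p n
    have e : (q + 1 + 1) * n = n + (q + 1) * n := by ring
    have hb : b.degree < ((q + 1) * n : ℕ) := by
      rw [degree_lt_iff_coeff_zero] at hp ha ⊢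
      intro i hi
      have := hp (i + n) (by rw [e]; omega)
      rwa [coeff_add, ha _ (by omega), coeff_X_pow_mul, zero_add] at this
    rw [e, ← polyCoeffs_append _ ha]
    simp only [hornerCode, List.append_assoc, List.cons_append, List.nil_append, A.run_wire,
      A.run_vdrop, List.map_cons, List.map_nil, List.getD_cons_succ, List.getD_cons_zero,
      List.drop_succ_cons, List.drop_zero, List.drop_left' (length_polyCoeffs a n)]
    rw [ih hb]
    simp only [List.cons_append, List.nil_append, A.run_wire, A.run_vtake,
      List.map_cons, List.map_nil, List.getD_cons_succ, List.getD_cons_zero,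
      List.drop_succ_cons, List.drop_zero, List.take_left' (length_polyCoeffs a n)]
    rw [A.run_remStep hn h (h.degree_mod_lt _) ha]
    congr 3
    rw [add_comm a, mul_comm]
    refine sub_eq_zero.1 ?_
    rw [← sub_modByMonic, modByMonic_eq_zero_iff_dvd h.monic]
    refine ⟨-(b /ₘ F * X ^ n), ?_⟩
    linear_combination X ^ n * modByMonic_add_div b F

theorem Arith.run_remCode (A : Arith K) {F U p : K[X]} {n N : ℕ} (h : IsDivisor F U n)
    (hp : p.degree < N) (k : VCode) (st : List (List K)) :
    A.run (remCode n N ++ k)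
        (polyCoeffs p N :: polyCoeffs F n :: polyCoeffs U n :: st) =
      A.run k (polyCoeffs (p %ₘ F) n :: st) := by
  unfold remCode
  split_ifs with hn
  · simp [A.run_wire, A.run_rep_zero, hn]
  · have hN : N ≤ ((N - 1) / n + 1) * n := by
      have h2 : N - 1 < ((N - 1) / n + 1) * n := by
        rw [mul_comm]; exact Nat.lt_mul_div_succ _ (by omega)
      omega
    rw [List.append_assoc, List.cons_append, List.nil_append, A.run_place_of_degree_lt hp,
      A.run_hornerCode (by omega) h _ (hp.trans_le (by exact_mod_cast hN))]

namespace Cost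

variable {B m δ : ℕ}

theorem place (len s n : ℕ) : Cost B m δ [place len s n] 0 0 := gather _ _

theorem vrev (n : ℕ) : Cost B m δ [vrev n] 0 0 := gather _ _

theorem cut (k : ℕ) : Cost B m δ (cut k) 0 0 :=
  (wire _ _).cons ((vtake _).cons ((wire _ _).cons (vdrop _)))

theorem monicCode : Cost B m δ monicCode 0 0 := (rep _ _).cons ((wire _ _).cons cat)

theorem mulCode {d : ℕ} (a b o : ℕ) (h : d ≤ B) : Cost B m δ (mulCode d a b o) d 0 := by
  unfold Residual.mulCode
  split_ifs with h0
  · exact ((wire _ _).cons (rep _ _)).mono (by omega) (by omega)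
  · exact ((place _ _ _).cons ((wire _ _).cons ((place _ _ _).cons
      ((pmul (by omega) h).cons (vtake _))))).mono (by omega) (by omega)

theorem invCode {n : ℕ} (h : n ≤ B) : Cost B m δ (invCode n) (12 * n) 0 := by
  unfold Residual.invCode
  induction n using Nat.strong_induction_on with
  | _ n ih =>
    rcases lt_or_ge n 2 with h2 | h2
    · rw [invRec, splitRec_of_lt (by simpa using h2)]
      split_ifs with h3
      · exact nil.mono (by omega) (by omega)
      · rw [List.length_replicate] at h3
        exact ((rep _ _).cons (vdiv _)).mono (by omega) (by omega)
    · rw [invRec_of_le (by simpa using h2)]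
      simp only [List.take_replicate, List.length_replicate]
      rw [min_eq_left (by omega)]
      exact (((((((wire _ _).cons (vtake _)).append (ih ((n + 1) / 2) (by omega) (by omega))).append
        ((place _ _ _).cons (wire _ _))).append (mulCode _ _ _ h)).append ((rep _ _).cons
        ((place _ _ _).cons ((vsub _).cons (wire _ _))))).append (mulCode _ _ _ h)).append
        (vadd _) |>.mono (by omega) (by omega)

theorem shiftCode {n h : ℕ} (hB : n ≤ B) (hn : n ≤ 2 ^ h) :
    Cost B m δ (shiftCode n) (3 * n * h) 0 := by
  unfold Residual.shiftCode
  induction h generalizing n with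
  | zero =>
    rw [shiftRec, splitRec_of_lt (by simp; omega)]
    split_ifs
    · exact wire _ _
    · exact cat
  | succ h ih =>
    rcases lt_or_ge n 2 with h2 | h2
    · rw [shiftRec, splitRec_of_lt (by simp; omega)]
      split_ifs
      · exact (wire _ _).mono (by omega) (by omega)
      · exact cat.mono (by omega) (by omega)
    · rw [shiftRec_of_le (by simpa using h2)]
      simp only [List.take_replicate, List.drop_replicate, List.length_replicate]
      rw [min_eq_left (by omega)]
      have h3 : 2 ^ (h + 1) = 2 * 2 ^ h := by ring
      have i1 := ih (n := (n + 1) / 2) (by omega) (by omega)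
      have i2 := ih (n := n - (n + 1) / 2) (by omega) (by omega)
      refine ((((((((((((((((wire _ _).cons (vtake _)).append i1).append ((wire _ _).cons
        (vdrop _))).append i2).append (cut _)).append (wire _ _)).append (cut _)).append
        monicCode).append (wire _ _)).append monicCode).append (wire _ _)).append
        (mulCode _ _ _ hB)).append ((wire _ _).cons ((place _ _ _).cons ((vadd _).cons
        (wire _ _))))).append (mulCode _ _ _ hB)).append ((wire _ _).cons cat)).mono ?_ (by omega)
      have h4 : 3 * ((n + 1) / 2) * h + 3 * (n - (n + 1) / 2) * h = 3 * n * h := by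
        rw [← add_mul, ← mul_add, Nat.add_sub_cancel' (by omega)]
      have h5 : 3 * n * (h + 1) = 3 * n * h + 3 * n := by ring
      omega

theorem remStep {n : ℕ} (h : n ≤ B) : Cost B m δ (remStep n) (3 * n) 0 :=
  ((((((wire _ _).cons (vrev _)).append (mulCode _ _ _ h)).append ((vrev _).cons
    (wire _ _))).append (mulCode _ _ _ h)).append ((wire _ _).cons (vsub _))).mono
    (by omega) (by omega)

theorem hornerCode {n : ℕ} (h : n ≤ B) (q : ℕ) :
    Cost B m δ (hornerCode n q) (3 * (q * n)) 0 := by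
  induction q with
  | zero => exact (wire _ _).mono (by omega) (by omega)
  | succ q ih =>
    refine (((((wire _ _).cons (vdrop _)).append ih).append ((wire _ _).cons ((vtake _).cons
      (wire _ _)))).append (remStep h)).mono ?_ (by omega)
    have : (q + 1) * n = q * n + n := by ring
    omega

theorem remCode {n : ℕ} (h : n ≤ B) (N : ℕ) : Cost B m δ (remCode n N) (3 * N) 0 := by
  unfold Residual.remCode
  split_ifs
  · exact ((wire _ _).cons (rep _ _)).mono (by omega) (by omega)
  · refine ((place _ _ _).append (hornerCode h _)).mono ?_ (by omega)
    have := Nat.div_mul_le_self (N - 1) n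
    omega

end Cost

section Primrec

variable {α : Type*} [Primcodable α]

@[fun_prop] theorem primrec_place {f g h : α → ℕ} (hf : Primrec f) (hg : Primrec g)
    (hh : Primrec h) : Primrec fun x => place (f x) (g x) (h x) := by unfold place; fun_prop
@[fun_prop] theorem primrec_vrev {f : α → ℕ} (hf : Primrec f) :
    Primrec fun x => vrev (f x) := by unfold vrev; fun_prop
@[fun_prop] theorem primrec_cut {f : α → ℕ} (hf : Primrec f) :
    Primrec fun x => cut (f x) := by unfold cut; fun_prop
@[fun_prop] theorem primrec_mulCode {f g h j : α → ℕ} (hf : Primrec f) (hg : Primrec g)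
    (hh : Primrec h) (hj : Primrec j) : Primrec fun x => mulCode (f x) (g x) (h x) (j x) := by
  unfold mulCode; fun_prop

theorem invRec_primrec : Primrec invRec := splitRec_primrec (by fun_prop) (by fun_prop)

theorem shiftRec_primrec : Primrec shiftRec := splitRec_primrec (by fun_prop) (by fun_prop)

@[fun_prop] theorem primrec_replicate {f : α → ℕ} (hf : Primrec f) :
    Primrec fun x => List.replicate (f x) 0 := by
  have : Primrec fun x => (List.range (f x)).map fun _ => 0 := by fun_prop
  exact this.of_eq fun x => by simp

@[fun_prop] theorem primrec_invCode {f : α → ℕ} (hf : Primrec f) :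
    Primrec fun x => invCode (f x) := by
  unfold invCode; exact invRec_primrec.comp (by fun_prop)
@[fun_prop] theorem primrec_shiftCode {f : α → ℕ} (hf : Primrec f) :
    Primrec fun x => shiftCode (f x) := by
  unfold shiftCode; exact shiftRec_primrec.comp (by fun_prop)
@[fun_prop] theorem primrec_remStep {f : α → ℕ} (hf : Primrec f) :
    Primrec fun x => remStep (f x) := by unfold remStep; fun_prop

@[fun_prop] theorem primrec_hornerCode {f g : α → ℕ} (hf : Primrec f) (hg : Primrec g) :
    Primrec fun x => hornerCode (f x) (g x) := by
  have : Primrec fun x => Nat.rec (motive := fun _ => VCode) [wire 3 [0]] (fun _ c =>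
      [wire 3 [0, 1, 2, 0, 1, 2], vdrop (f x)] ++ c ++
      [wire 4 [1, 0, 2, 3], vtake (f x), wire 2 [1, 0]] ++ remStep (f x)) (g x) := by fun_prop
  refine this.of_eq fun x => ?_
  induction g x with
  | zero => rfl
  | succ q ih => simp only [ih, hornerCode]

@[fun_prop] theorem primrec_remCode {f g : α → ℕ} (hf : Primrec f) (hg : Primrec g) :
    Primrec fun x => remCode (f x) (g x) := by unfold remCode; fun_prop

end Primrec

section Inverses

variable {K : Type*} [Field K]

theorem exists_inverse {p : K[X]} (hp : p.coeff 0 ≠ 0) (n : ℕ) : ∃ v, X ^ n ∣ p * v - 1 := by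
  have h : IsCoprime (X ^ n) p := by
    refine IsCoprime.pow_left ((irreducible_X.coprime_iff_not_dvd).2 ?_)
    rwa [X_dvd_iff]
  obtain ⟨a, b, hab⟩ := h
  exact ⟨b, -a, by linear_combination hab⟩

theorem exists_isDivisor {F : K[X]} (hF : F.Monic) : ∃ U, IsDivisor F U F.natDegree := by
  obtain ⟨U, hU⟩ := exists_inverse (p := F.reflect F.natDegree) (n := F.natDegree) (by
    rw [coeff_reflect, revAt_le (by omega)]; simp [hF.coeff_natDegree])
  exact ⟨U, hF, rfl, hU⟩

end Inverses

variable {K : Type*} [Field K]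

/-! ### Products of monic polynomials -/

theorem monic_list_prod {l : List K[X]} (h : ∀ F ∈ l, F.Monic) : l.prod.Monic := by
  induction l with
  | nil => simp
  | cons F l ih => 
    rw [List.prod_cons]
    exact (h F (by simp)).mul (ih fun G hG => h G (by simp [hG]))

theorem natDegree_list_prod {l : List K[X]} (h : ∀ F ∈ l, F.Monic) :
    l.prod.natDegree = (l.map natDegree).sum := by
  induction l with
  | nil => simp
  | cons F l ih =>
    have h1 : ∀ G ∈ l, G.Monic := fun G hG => h G (by simp [hG])
    rw [List.prod_cons, (h F (by simp)).natDegree_mul (monic_list_prod h1), ih h1]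
    simp

/-- An inverse of the reverse of a monic polynomial, as needed for divisions. -/
noncomputable def divInv (F : K[X]) : K[X] :=
  open Classical in if h : F.Monic then (exists_isDivisor h).choose else 0

theorem isDivisor_divInv {F : K[X]} (h : F.Monic) : IsDivisor F (divInv F) F.natDegree := by
  rw [divInv, dif_pos h]
  exact (exists_isDivisor h).choose_spec

/-- The vector that describes divisions by `F`. -/
noncomputable def nodeVec (F : K[X]) : List K :=
  polyCoeffs F F.natDegree ++ polyCoeffs (divInv F) F.natDegree

/-- The subproduct tree of a list of polynomials, as a vector. -/
noncomputable def treeVec : List K[X] → List K :=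
  splitRec (fun l => nodeVec l.prod) fun l a b => nodeVec l.prod ++ (a ++ b)

theorem treeVec_of_le {l : List K[X]} (h : 2 ≤ l.length) : treeVec l =
    nodeVec l.prod ++ (treeVec (l.take ((l.length + 1) / 2)) ++
      treeVec (l.drop ((l.length + 1) / 2))) :=
  splitRec_of_le h

theorem exists_treeVec (l : List K[X]) : ∃ t, treeVec l = nodeVec l.prod ++ t := by
  rcases lt_or_ge l.length 2 with h | h
  · exact ⟨[], by rw [treeVec, splitRec_of_lt h, List.append_nil]⟩
  · exact ⟨_, treeVec_of_le h⟩

/-- The length of a subproduct tree in terms of the degrees. -/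
def treeLen : List ℕ → ℕ := splitRec (fun l => 2 * l.sum) fun l a b => 2 * l.sum + (a + b)

theorem treeLen_of_le {l : List ℕ} (h : 2 ≤ l.length) : treeLen l =
    2 * l.sum + (treeLen (l.take ((l.length + 1) / 2)) + treeLen (l.drop ((l.length + 1) / 2))) :=
  splitRec_of_le h

theorem length_nodeVec (F : K[X]) : (nodeVec F).length = 2 * F.natDegree := by
  simp [nodeVec]; omega

theorem length_treeVec {l : List K[X]} (h : ∀ F ∈ l, F.Monic) :
    (treeVec l).length = treeLen (l.map natDegree) := by
  induction l using split_induction with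
  | base l hl =>
    rw [treeVec, treeLen, splitRec_of_lt hl, splitRec_of_lt (by simpa using hl), length_nodeVec,
      natDegree_list_prod h]
  | step l hl h1 h2 =>
    rw [treeVec_of_le hl, treeLen_of_le (by simpa using hl), List.length_append,
      List.length_append, h1 fun F hF => h F (List.mem_of_mem_take hF),
      h2 fun F hF => h F (List.mem_of_mem_drop hF), length_nodeVec, natDegree_list_prod h]
    simp

/-! ### Programs for subproduct trees -/

/-- From the lower coefficients of a monic polynomial of degree `n` compute the description of
divisions by it. -/
def nodeCode (n : ℕ) : VCode :=
  [wire 1 [0, 0]] ++ monicCode ++ [gather (n + 1) ((List.range n).map fun i => n - i)] ++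
    invCode n ++ [wire 2 [1, 0], cat]

/-- Compute the subproduct tree from the lower coefficients of monic polynomials. -/
def treeCode : List ℕ → VCode :=
  splitRec (fun l => nodeCode l.sum) fun l c₁ c₂ =>
    cut (l.take ((l.length + 1) / 2)).sum ++ c₂ ++ [wire 2 [1, 0]] ++ c₁ ++
    [wire 2 [0, 1, 0, 1], vtake (l.take ((l.length + 1) / 2)).sum] ++ monicCode ++
    [wire 2 [1, 0], vtake (l.drop ((l.length + 1) / 2)).sum] ++ monicCode ++
    mulCode l.sum ((l.drop ((l.length + 1) / 2)).sum + 1)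
      ((l.take ((l.length + 1) / 2)).sum + 1) l.sum ++ nodeCode l.sum ++
    [wire 3 [1, 2, 0], cat, wire 2 [1, 0], cat]

theorem treeCode_of_le {l : List ℕ} (h : 2 ≤ l.length) : treeCode l =
    cut (l.take ((l.length + 1) / 2)).sum ++ treeCode (l.drop ((l.length + 1) / 2)) ++
    [wire 2 [1, 0]] ++ treeCode (l.take ((l.length + 1) / 2)) ++
    [wire 2 [0, 1, 0, 1], vtake (l.take ((l.length + 1) / 2)).sum] ++ monicCode ++
    [wire 2 [1, 0], vtake (l.drop ((l.length + 1) / 2)).sum] ++ monicCode ++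
    mulCode l.sum ((l.drop ((l.length + 1) / 2)).sum + 1)
      ((l.take ((l.length + 1) / 2)).sum + 1) l.sum ++ nodeCode l.sum ++
    [wire 3 [1, 2, 0], cat, wire 2 [1, 0], cat] :=
  splitRec_of_le h

theorem degree_lt_succ_natDegree (F : K[X]) : F.degree < (F.natDegree + 1 : ℕ) :=
  lt_of_le_of_lt degree_le_natDegree (by exact_mod_cast Nat.lt_succ_self _)

theorem Arith.run_monicCode_of_monic (A : Arith K) {F : K[X]} (hF : F.Monic) (k : VCode)
    (st : List (List K)) :
    A.run (monicCode ++ k) (polyCoeffs F F.natDegree :: st) =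
      A.run k (polyCoeffs F (F.natDegree + 1) :: st) := by
  have h : (F - X ^ F.natDegree).degree < (F.natDegree : WithBot ℕ) := by
    rw [← degree_eq_natDegree hF.ne_zero]
    exact degree_sub_lt_left (by rw [degree_X_pow, degree_eq_natDegree hF.ne_zero]) hF.ne_zero
      (by simp [hF.leadingCoeff])
  rw [polyCoeffs_monic, A.run_monicCode h, sub_add_cancel]

theorem Arith.run_nodeCode (A : Arith K) {F : K[X]} (hF : F.Monic) (k : VCode)
    (st : List (List K)) :
    A.run (nodeCode F.natDegree ++ k) (polyCoeffs F F.natDegree :: st) =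
      A.run k (nodeVec F :: st) := by
  simp only [nodeCode, List.append_assoc, List.cons_append, List.nil_append, A.run_wire,
    List.map_cons, List.map_nil, List.getD_cons_zero, List.drop_succ_cons, List.drop_zero]
  rw [A.run_monicCode_of_monic hF, A.run_gather (by simp), List.map_map]
  have h1 : List.map ((fun i => (polyCoeffs F (F.natDegree + 1)).getD i 0) ∘
      fun i => F.natDegree - i) (List.range F.natDegree) =
      polyCoeffs (F.reflect F.natDegree) F.natDegree := by
    refine List.map_congr_left fun i hi => ?_
    have hi : i < F.natDegree := List.mem_range.1 hi
    rw [Function.comp, getD_polyCoeffs, coeff_reflect, revAt_le hi.le, if_pos (by omega)]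
  rw [h1, A.run_invCode (isDivisor_divInv hF).inv]
  simp [nodeVec]

/-- The lower coefficients of a list of monic polynomials. -/
noncomputable def lowVec (l : List K[X]) : List K := l.flatMap fun F => polyCoeffs F F.natDegree

theorem length_lowVec (l : List K[X]) : (lowVec l).length = (l.map natDegree).sum := by
  simp [lowVec, List.length_flatMap]

theorem take_treeVec {l : List K[X]} : 
    (treeVec l).take l.prod.natDegree = polyCoeffs l.prod l.prod.natDegree := by
  obtain ⟨t, ht⟩ := exists_treeVec l
  rw [ht, nodeVec, List.append_assoc, List.take_left' (by simp)]

theorem Arith.run_treeCode (A : Arith K) {l : List K[X]} (h : ∀ F ∈ l, F.Monic) (k : VCode)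
    (st : List (List K)) :
    A.run (treeCode (l.map natDegree) ++ k) (lowVec l :: st) = A.run k (treeVec l :: st) := by
  induction l using split_induction generalizing k st with
  | base l hl =>
    rw [treeVec, treeCode, splitRec_of_lt hl, splitRec_of_lt (by simpa using hl),
      ← natDegree_list_prod h]
    have : lowVec l = polyCoeffs l.prod l.prod.natDegree := by
      match l, hl with
      | [], _ => simp [lowVec]
      | [F], _ => simp [lowVec]
    rw [this, A.run_nodeCode (monic_list_prod h)]
  | step l hl ih1 ih2 =>
    have m1 : ∀ F ∈ l.take ((l.length + 1) / 2), F.Monic := fun F hF =>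
      h F (List.mem_of_mem_take hF)
    have m2 : ∀ F ∈ l.drop ((l.length + 1) / 2), F.Monic := fun F hF =>
      h F (List.mem_of_mem_drop hF)
    rw [treeVec_of_le hl, treeCode_of_le (by simpa using hl)]
    simp only [← List.map_take, ← List.map_drop, List.length_map]
    have e : l = l.take ((l.length + 1) / 2) ++ l.drop ((l.length + 1) / 2) := by simp
    generalize l.take ((l.length + 1) / 2) = l₁ at *
    generalize l.drop ((l.length + 1) / 2) = l₂ at *
    subst e
    have e1 : lowVec (l₁ ++ l₂) = lowVec l₁ ++ lowVec l₂ := by simp [lowVec]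
    simp only [← natDegree_list_prod m1, ← natDegree_list_prod m2, ← natDegree_list_prod h]
    simp only [List.append_assoc]
    rw [e1, A.run_cut (by rw [length_lowVec, natDegree_list_prod m1]), ih2 m2]
    simp
    rw [ih1 m1]
    simp
    rw [take_treeVec, A.run_monicCode_of_monic (monic_list_prod m1)]
    simp
    rw [take_treeVec, A.run_monicCode_of_monic (monic_list_prod m2)]
    have hm := monic_list_prod h
    have hd : (l₁.prod * l₂.prod).natDegree = l₁.prod.natDegree + l₂.prod.natDegree :=
      (monic_list_prod m1).natDegree_mul (monic_list_prod m2)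
    rw [List.prod_append] at hm
    rw [A.run_mulCode (degree_lt_succ_natDegree _) (degree_lt_succ_natDegree _) (by omega)
      (by omega) (by omega) id, mul_comm l₂.prod, A.run_nodeCode hm]
    simp

/-! ### Combination of residues -/

/-- The sum of `a * ∏ G` over the pairs `(F, a)` of the list, where `G` runs through the first
components of the other pairs. -/
noncomputable def upPoly : List (K[X] × K[X]) → K[X]
  | [] => 0
  | e :: l => e.2 * (l.map Prod.fst).prod + e.1 * upPoly l

theorem upPoly_append (l₁ l₂ : List (K[X] × K[X])) :
    upPoly (l₁ ++ l₂) =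
      upPoly l₁ * (l₂.map Prod.fst).prod + (l₁.map Prod.fst).prod * upPoly l₂ := by
  induction l₁ with
  | nil => simp [upPoly]
  | cons e l₁ ih =>
    simp only [List.cons_append, upPoly, ih, List.map_append, List.prod_append, List.map_cons,
      List.prod_cons]
    ring

theorem degree_add_lt {p q : K[X]} {n : ℕ} (hp : p.degree < n) (hq : q.degree < n) :
    (p + q).degree < n := (degree_add_le p q).trans_lt (max_lt hp hq)

theorem degree_mul_lt {p q : K[X]} {a b n : ℕ} (hp : p.degree < a) (hq : q.degree < (b + 1 : ℕ))
    (hn : n = a + b) : (p * q).degree < n := by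
  rcases eq_or_ne p 0 with rfl | h1
  · simp
  rcases eq_or_ne q 0 with rfl | h2
  · simp
  rw [degree_eq_natDegree (mul_ne_zero h1 h2), natDegree_mul h1 h2]
  rw [degree_eq_natDegree h1] at hp
  rw [degree_eq_natDegree h2] at hq
  norm_cast at hp hq ⊢
  omega

/-- The hypotheses on a list of moduli and residues. -/
structure IsResidueList (l : List (K[X] × K[X])) : Prop where
  monic : ∀ e ∈ l, e.1.Monic
  degree_lt : ∀ e ∈ l, e.2.degree < e.1.natDegree

theorem IsResidueList.sublist {l l' : List (K[X] × K[X])} (h : IsResidueList l) (hl : l' ⊆ l) :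
    IsResidueList l' := ⟨fun e he => h.monic e (hl he), fun e he => h.degree_lt e (hl he)⟩

theorem IsResidueList.monic_map {l : List (K[X] × K[X])} (h : IsResidueList l) :
    ∀ F ∈ l.map Prod.fst, F.Monic := by
  intro F hF
  obtain ⟨e, he, rfl⟩ := List.mem_map.1 hF
  exact h.monic e he

theorem degree_upPoly_lt {l : List (K[X] × K[X])} (h : IsResidueList l) :
    (upPoly l).degree < ((l.map Prod.fst).prod.natDegree : ℕ) := by
  induction l with
  | nil => simp [upPoly]
  | cons e l ih =>
    have h1 : IsResidueList l := h.sublist (by simp)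
    have h2 := monic_list_prod h1.monic_map
    have h3 := (h.monic e (by simp)).natDegree_mul h2
    rw [List.map_cons, List.prod_cons, upPoly]
    refine degree_add_lt ?_ ?_
    · exact degree_mul_lt (h.degree_lt e (by simp)) (degree_lt_succ_natDegree _) h3
    · rw [mul_comm]
      exact degree_mul_lt (ih h1) (degree_lt_succ_natDegree _) (by omega)

/-- The vector of the residues. -/
noncomputable def residueVec (l : List (K[X] × K[X])) : List K :=
  l.flatMap fun e => polyCoeffs e.2 e.1.natDegree

theorem length_residueVec (l : List (K[X] × K[X])) :
    (residueVec l).length = ((l.map Prod.fst).map natDegree).sum := by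
  simp [residueVec, List.length_flatMap, Function.comp_def]

/-- Compute `upPoly` from the vector of the residues and the subproduct tree. -/
def upCode : List ℕ → VCode :=
  splitRec (fun _ => [wire 2 [0]]) fun l c₁ c₂ =>
    [wire 2 [1, 0], vdrop (2 * l.sum)] ++ cut (treeLen (l.take ((l.length + 1) / 2))) ++
    [wire 3 [2, 1, 0]] ++ cut (l.take ((l.length + 1) / 2)).sum ++ [wire 4 [0, 3, 1, 2, 2, 3]] ++
    c₂ ++ [wire 3 [1, 2, 0]] ++ c₁ ++
    [wire 4 [2, 1, 3, 0], vtake (l.take ((l.length + 1) / 2)).sum] ++ monicCode ++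
    mulCode l.sum ((l.take ((l.length + 1) / 2)).sum + 1) (l.drop ((l.length + 1) / 2)).sum l.sum ++
    [wire 3 [1, 2, 0], vtake (l.drop ((l.length + 1) / 2)).sum] ++ monicCode ++
    mulCode l.sum ((l.drop ((l.length + 1) / 2)).sum + 1) (l.take ((l.length + 1) / 2)).sum l.sum ++
    [vadd l.sum]

theorem upCode_of_le {l : List ℕ} (h : 2 ≤ l.length) : upCode l =
    [wire 2 [1, 0], vdrop (2 * l.sum)] ++ cut (treeLen (l.take ((l.length + 1) / 2))) ++
    [wire 3 [2, 1, 0]] ++ cut (l.take ((l.length + 1) / 2)).sum ++ [wire 4 [0, 3, 1, 2, 2, 3]] ++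
    upCode (l.drop ((l.length + 1) / 2)) ++ [wire 3 [1, 2, 0]] ++
    upCode (l.take ((l.length + 1) / 2)) ++
    [wire 4 [2, 1, 3, 0], vtake (l.take ((l.length + 1) / 2)).sum] ++ monicCode ++
    mulCode l.sum ((l.take ((l.length + 1) / 2)).sum + 1) (l.drop ((l.length + 1) / 2)).sum l.sum ++
    [wire 3 [1, 2, 0], vtake (l.drop ((l.length + 1) / 2)).sum] ++ monicCode ++
    mulCode l.sum ((l.drop ((l.length + 1) / 2)).sum + 1) (l.take ((l.length + 1) / 2)).sum l.sum ++
    [vadd l.sum] :=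
  splitRec_of_le h

theorem Arith.run_upCode (A : Arith K) {l : List (K[X] × K[X])} (h : IsResidueList l) (k : VCode)
    (st : List (List K)) :
    A.run (upCode ((l.map Prod.fst).map natDegree) ++ k)
        (residueVec l :: treeVec (l.map Prod.fst) :: st) =
      A.run k (polyCoeffs (upPoly l) (l.map Prod.fst).prod.natDegree :: st) := by
  induction l using split_induction generalizing k st with
  | base l hl =>
    rw [upCode, splitRec_of_lt (by simpa using hl)]
    match l, hl with
    | [], _ => simp [residueVec]
    | [e], _ => simp [residueVec, upPoly]
  | step l hl ih1 ih2 =>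
    have r1 := h.sublist (l.take_subset ((l.length + 1) / 2))
    have r2 := h.sublist (l.drop_subset ((l.length + 1) / 2))
    rw [upCode_of_le (by simpa using hl), treeVec_of_le (by simpa using hl)]
    simp only [← List.map_take, ← List.map_drop, List.length_map]
    have e : l = l.take ((l.length + 1) / 2) ++ l.drop ((l.length + 1) / 2) := by simp
    generalize l.take ((l.length + 1) / 2) = l₁ at *
    generalize l.drop ((l.length + 1) / 2) = l₂ at *
    subst e
    have e1 : residueVec (l₁ ++ l₂) = residueVec l₁ ++ residueVec l₂ := by simp [residueVec]
    have m1 := r1.monic_map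
    have m2 := r2.monic_map
    simp only [← natDegree_list_prod m1, ← natDegree_list_prod m2, ← natDegree_list_prod h.monic_map,
      ← length_treeVec m1, List.append_assoc, List.cons_append, List.nil_append, A.run_wire,
      A.run_vdrop, List.map_cons, List.map_nil, List.getD_cons_zero, List.getD_cons_succ,
      List.drop_succ_cons, List.drop_zero, List.drop_left' (length_nodeVec _)]
    rw [A.run_cut rfl, e1]
    simp
    rw [A.run_cut (by rw [length_residueVec, natDegree_list_prod m1])]
    simp
    simp only [List.map_map] at ih1 ih2
    rw [ih2 r2]
    simp
    rw [ih1 r1]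
    simp
    rw [take_treeVec, A.run_monicCode_of_monic (monic_list_prod m1)]
    have hd := (monic_list_prod m1).natDegree_mul (monic_list_prod m2)
    have d1 := degree_upPoly_lt r1
    have d2 := degree_upPoly_lt r2
    rw [A.run_mulCode (degree_lt_succ_natDegree _) d2 (by omega) (by omega) (by omega) id]
    simp
    rw [take_treeVec, A.run_monicCode_of_monic (monic_list_prod m2),
      A.run_mulCode (degree_lt_succ_natDegree _) d1 (by omega) (by omega) (by omega) id,
      A.run_vadd (by simp) (by simp), zipWith_add_polyCoeffs, upPoly_append, mul_comm (upPoly l₁)]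

/-! ### Remainders modulo many polynomials -/

/-- Extract the data of the root from a subproduct tree. -/
def divisorCode (n : ℕ) : VCode :=
  [wire 1 [0, 0], vtake n, wire 2 [1, 0], vdrop n, vtake n, wire 2 [1, 0]]

theorem Arith.run_divisorCode (A : Arith K) (l : List K[X]) (k : VCode) (st : List (List K)) :
    A.run (divisorCode l.prod.natDegree ++ k) (treeVec l :: st) =
      A.run k (polyCoeffs l.prod l.prod.natDegree ::
        polyCoeffs (divInv l.prod) l.prod.natDegree :: st) := by
  obtain ⟨t, ht⟩ := exists_treeVec l
  rw [ht]
  simp [divisorCode, nodeVec]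

/-- From a polynomial with `N` coefficients and a subproduct tree whose root has degree `n`, compute
the remainder modulo the root, and keep the tree. -/
def rootRemCode (n N : ℕ) : VCode :=
  [wire 2 [1, 0, 1]] ++ divisorCode n ++ [wire 3 [2, 0, 1]] ++ remCode n N

theorem Arith.run_rootRemCode (A : Arith K) {l : List K[X]} (h : ∀ F ∈ l, F.Monic) {p : K[X]}
    {N : ℕ} (hp : p.degree < N) (k : VCode) (st : List (List K)) :
    A.run (rootRemCode l.prod.natDegree N ++ k) (polyCoeffs p N :: treeVec l :: st) =
      A.run k (polyCoeffs (p %ₘ l.prod) l.prod.natDegree :: treeVec l :: st) := by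
  simp [rootRemCode]
  rw [A.run_divisorCode]
  simp
  rw [A.run_remCode (isDivisor_divInv (monic_list_prod h)) hp]

/-- Compute the remainders of a polynomial modulo the leaves of a subproduct tree. -/
def downCode : List ℕ → VCode :=
  splitRec (fun _ => [wire 2 [0]]) fun l c₁ c₂ =>
    [wire 2 [1, 0], vdrop (2 * l.sum)] ++ cut (treeLen (l.take ((l.length + 1) / 2))) ++
    [wire 3 [2, 0, 2, 1]] ++ rootRemCode (l.drop ((l.length + 1) / 2)).sum l.sum ++ c₂ ++
    [wire 3 [1, 2, 0]] ++ rootRemCode (l.take ((l.length + 1) / 2)).sum l.sum ++ c₁ ++ [cat]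

theorem downCode_of_le {l : List ℕ} (h : 2 ≤ l.length) : downCode l =
    [wire 2 [1, 0], vdrop (2 * l.sum)] ++ cut (treeLen (l.take ((l.length + 1) / 2))) ++
    [wire 3 [2, 0, 2, 1]] ++ rootRemCode (l.drop ((l.length + 1) / 2)).sum l.sum ++
    downCode (l.drop ((l.length + 1) / 2)) ++
    [wire 3 [1, 2, 0]] ++ rootRemCode (l.take ((l.length + 1) / 2)).sum l.sum ++
    downCode (l.take ((l.length + 1) / 2)) ++ [cat] :=
  splitRec_of_le h

theorem modByMonic_modByMonic_of_dvd {F G : K[X]} (hF : F.Monic) (h : F ∣ G) (p : K[X]) :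
    (p %ₘ G) %ₘ F = p %ₘ F :=
  modByMonic_eq_of_dvd_sub hF (h.trans (dvd_modByMonic_sub p G))

theorem degree_modByMonic_lt_natDegree {F : K[X]} (hF : F.Monic) (p : K[X]) :
    (p %ₘ F).degree < F.natDegree :=
  (degree_modByMonic_lt p hF).trans_eq (degree_eq_natDegree hF.ne_zero)

theorem Arith.run_downCode (A : Arith K) {l : List K[X]} (h : ∀ F ∈ l, F.Monic) {p : K[X]}
    (hp : p.degree < l.prod.natDegree) (k : VCode) (st : List (List K)) :
    A.run (downCode (l.map natDegree) ++ k)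
        (polyCoeffs p l.prod.natDegree :: treeVec l :: st) =
      A.run k (l.flatMap (fun F => polyCoeffs (p %ₘ F) F.natDegree) :: st) := by
  induction l using split_induction generalizing p k st with
  | base l hl =>
    rw [downCode, splitRec_of_lt (by simpa using hl)]
    match l, hl with
    | [], _ => simp
    | [F], _ =>
      have hF := h F (by simp)
      have : p %ₘ F = p := (modByMonic_eq_self_iff hF).2 (by
        rw [degree_eq_natDegree hF.ne_zero]; simpa using hp)
      simp [this]
  | step l hl ih1 ih2 =>
    have m1 : ∀ F ∈ l.take ((l.length + 1) / 2), F.Monic := fun F hF =>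
      h F (List.mem_of_mem_take hF)
    have m2 : ∀ F ∈ l.drop ((l.length + 1) / 2), F.Monic := fun F hF =>
      h F (List.mem_of_mem_drop hF)
    rw [downCode_of_le (by simpa using hl), treeVec_of_le hl]
    simp only [← List.map_take, ← List.map_drop, List.length_map]
    have e : l = l.take ((l.length + 1) / 2) ++ l.drop ((l.length + 1) / 2) := by simp
    generalize l.take ((l.length + 1) / 2) = l₁ at *
    generalize l.drop ((l.length + 1) / 2) = l₂ at *
    subst e
    simp only [← natDegree_list_prod m1, ← natDegree_list_prod m2, ← natDegree_list_prod h,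
      ← length_treeVec m1, List.append_assoc, List.cons_append, List.nil_append, A.run_wire,
      A.run_vdrop, List.map_cons, List.map_nil, List.getD_cons_zero, List.getD_cons_succ,
      List.drop_succ_cons, List.drop_zero, List.drop_left' (length_nodeVec _)]
    rw [A.run_cut rfl]
    simp only [A.run_wire, List.map_cons, List.map_nil, List.getD_cons_zero, List.getD_cons_succ,
      List.drop_succ_cons, List.drop_zero, List.cons_append, List.nil_append]
    rw [A.run_rootRemCode m2 hp,
      ih2 m2 (degree_modByMonic_lt_natDegree (monic_list_prod m2) p)]
    simp only [A.run_wire, List.map_cons, List.map_nil, List.getD_cons_zero, List.getD_cons_succ,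
      List.drop_succ_cons, List.drop_zero, List.cons_append, List.nil_append]
    rw [A.run_rootRemCode m1 hp,
      ih1 m1 (degree_modByMonic_lt_natDegree (monic_list_prod m1) p), A.run_cat]
    have h1 : ∀ l' : List K[X], (∀ F ∈ l', F.Monic) →
        (l'.flatMap fun F => polyCoeffs ((p %ₘ l'.prod) %ₘ F) F.natDegree) =
          l'.flatMap fun F => polyCoeffs (p %ₘ F) F.natDegree := by
      intro l' h'
      refine List.flatMap_congr fun F hF => ?_
      rw [modByMonic_modByMonic_of_dvd (h' F hF) (List.dvd_prod hF)]
    rw [h1 _ m1, h1 _ m2, List.flatMap_append]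

namespace Cost

variable {B m δ : ℕ}

theorem take_sum_add_drop_sum (l : List ℕ) (j : ℕ) : (l.take j).sum + (l.drop j).sum = l.sum := by
  rw [← List.sum_append, List.take_append_drop]

theorem nodeCode {n : ℕ} (h : n ≤ B) : Cost B m δ (nodeCode n) (12 * n) 0 :=
  (((((wire _ _).append monicCode).append (gather _ _)).append (invCode h)).append
    ((wire _ _).cons cat)).mono (by omega) (by omega)

theorem treeCode {l : List ℕ} {h : ℕ} (hB : l.sum ≤ B) (hl : l.length ≤ 2 ^ h) :
    Cost B m δ (treeCode l) (13 * l.sum * (h + 1)) 0 := by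
  induction h generalizing l with
  | zero =>
    rw [Residual.treeCode, splitRec_of_lt (by omega)]
    exact (nodeCode hB).mono (by omega) (by omega)
  | succ h ih =>
    rcases lt_or_ge l.length 2 with h2 | h2
    · rw [Residual.treeCode, splitRec_of_lt (by omega)]
      refine (nodeCode hB).mono ?_ (by omega)
      have := Nat.le_mul_of_pos_right (13 * l.sum) (by omega : 0 < h + 1 + 1)
      omega
    · rw [treeCode_of_le h2]
      have h3 : 2 ^ (h + 1) = 2 * 2 ^ h := by ring
      have hs := take_sum_add_drop_sum l ((l.length + 1) / 2)
      have i1 := ih (l := l.take ((l.length + 1) / 2)) (by omega) (by simp; omega)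
      have i2 := ih (l := l.drop ((l.length + 1) / 2)) (by omega) (by simp; omega)
      refine (((((((((((cut _).append i2).append (wire _ _)).append i1).append ((wire _ _).cons
        (vtake _))).append monicCode).append ((wire _ _).cons (vtake _))).append monicCode).append
        (mulCode _ _ _ hB)).append (nodeCode hB)).append ((wire _ _).cons (cat.cons ((wire _ _).cons
        cat)))).mono ?_ (by omega)
      rw [← hs]
      ring_nf
      omega

theorem upCode {l : List ℕ} {h : ℕ} (hB : l.sum ≤ B) (hl : l.length ≤ 2 ^ h) :
    Cost B m δ (upCode l) (3 * l.sum * h) 0 := by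
  induction h generalizing l with
  | zero =>
    rw [Residual.upCode, splitRec_of_lt (by omega)]
    exact wire _ _
  | succ h ih =>
    rcases lt_or_ge l.length 2 with h2 | h2
    · rw [Residual.upCode, splitRec_of_lt (by omega)]
      exact (wire _ _).mono (by omega) (by omega)
    · rw [upCode_of_le h2]
      have h3 : 2 ^ (h + 1) = 2 * 2 ^ h := by ring
      have hs := take_sum_add_drop_sum l ((l.length + 1) / 2)
      have i1 := ih (l := l.take ((l.length + 1) / 2)) (by omega) (by simp; omega)
      have i2 := ih (l := l.drop ((l.length + 1) / 2)) (by omega) (by simp; omega)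
      refine ((((((((((((((((wire _ _).cons (vdrop _)).append (cut _)).append (wire _ _)).append
        (cut _)).append (wire _ _)).append i2).append (wire _ _)).append i1).append
        ((wire _ _).cons (vtake _))).append monicCode).append (mulCode _ _ _ hB)).append
        ((wire _ _).cons (vtake _))).append monicCode).append (mulCode _ _ _ hB)).append
        (vadd _)).mono ?_ (by omega)
      rw [← hs]
      ring_nf
      omega

theorem divisorCode (n : ℕ) : Cost B m δ (divisorCode n) 0 0 :=
  (wire _ _).cons ((vtake _).cons ((wire _ _).cons ((vdrop _).cons ((vtake _).cons (wire _ _)))))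

theorem rootRemCode {n : ℕ} (h : n ≤ B) (N : ℕ) : Cost B m δ (rootRemCode n N) (3 * N) 0 :=
  ((((wire _ _).append (divisorCode _)).append (wire _ _)).append (remCode h N)).mono
    (by omega) (by omega)

theorem downCode {l : List ℕ} {h : ℕ} (hB : l.sum ≤ B) (hl : l.length ≤ 2 ^ h) :
    Cost B m δ (downCode l) (6 * l.sum * h) 0 := by
  induction h generalizing l with
  | zero =>
    rw [Residual.downCode, splitRec_of_lt (by omega)]
    exact wire _ _
  | succ h ih =>
    rcases lt_or_ge l.length 2 with h2 | h2
    · rw [Residual.downCode, splitRec_of_lt (by omega)]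
      exact (wire _ _).mono (by omega) (by omega)
    · rw [downCode_of_le h2]
      have h3 : 2 ^ (h + 1) = 2 * 2 ^ h := by ring
      have hs := take_sum_add_drop_sum l ((l.length + 1) / 2)
      have i1 := ih (l := l.take ((l.length + 1) / 2)) (by omega) (by simp; omega)
      have i2 := ih (l := l.drop ((l.length + 1) / 2)) (by omega) (by simp; omega)
      refine (((((((((wire _ _).cons (vdrop _)).append (cut _)).append (wire _ _)).append
        (rootRemCode (by omega) _)).append i2).append (wire _ _)).append
        (rootRemCode (by omega) _)).append i1).append cat |>.mono ?_ (by omega)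
      rw [← hs]
      ring_nf
      omega

end Cost

section Primrec

variable {α : Type*} [Primcodable α]

@[fun_prop] theorem primrec_nodeCode {f : α → ℕ} (hf : Primrec f) :
    Primrec fun x => nodeCode (f x) := by unfold nodeCode; fun_prop

theorem treeLen_primrec : Primrec treeLen := splitRec_primrec (by fun_prop) (by fun_prop)

@[fun_prop] theorem primrec_treeLen {f : α → List ℕ} (hf : Primrec f) :
    Primrec fun x => treeLen (f x) := treeLen_primrec.comp hf

theorem treeCode_primrec : Primrec treeCode := splitRec_primrec (by fun_prop) (by fun_prop)

@[fun_prop] theorem primrec_treeCode {f : α → List ℕ} (hf : Primrec f) :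
    Primrec fun x => treeCode (f x) := treeCode_primrec.comp hf

theorem upCode_primrec : Primrec upCode := splitRec_primrec (by fun_prop) (by fun_prop)

@[fun_prop] theorem primrec_upCode {f : α → List ℕ} (hf : Primrec f) :
    Primrec fun x => upCode (f x) := upCode_primrec.comp hf

@[fun_prop] theorem primrec_divisorCode {f : α → ℕ} (hf : Primrec f) :
    Primrec fun x => divisorCode (f x) := by unfold divisorCode; fun_prop

@[fun_prop] theorem primrec_rootRemCode {f g : α → ℕ} (hf : Primrec f) (hg : Primrec g) :
    Primrec fun x => rootRemCode (f x) (g x) := by unfold rootRemCode; fun_prop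

theorem downCode_primrec : Primrec downCode := splitRec_primrec (by fun_prop) (by fun_prop)

@[fun_prop] theorem primrec_downCode {f : α → List ℕ} (hf : Primrec f) :
    Primrec fun x => downCode (f x) := downCode_primrec.comp hf

end Primrec

/-! ### Several points with multiplicities -/

/-- Shift, for `i < t`, the `i`-th of the concatenated polynomials with `s i` coefficients by the
`i`-th entry of the vector below them. -/
def shiftAllCode (ss : List ℕ) : VCode :=
  mapCode 1 (List.range ss.length) (fun i => ss.getD i 0) fun i =>
    [wire 2 [1, 0], gather ss.length [i], wire 2 [1, 0]] ++ shiftCode (ss.getD i 0) ++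
      [vtake (ss.getD i 0)]

/-- The lower coefficients of the polynomials `(X + y i) ^ s i`. -/
def leavesCode (ss : List ℕ) : VCode :=
  [rep 0 0] ++ mapCode 1 (List.range ss.length) (fun _ => 0) fun i =>
    [wire 2 [1], gather ss.length [i], rep 0 (ss.getD i 0)] ++ shiftCode (ss.getD i 0) ++
      [vdrop (ss.getD i 0)]

/-- The subproduct tree of the polynomials `(X + y i) ^ s i`. -/
def pointTreeCode (ss : List ℕ) : VCode := leavesCode ss ++ treeCode ss

/-- From the points and the subproduct tree compute the inverses that occur in the Chinese remainder
theorem, as power series at the points. -/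
def weightsCode (ss : List ℕ) : VCode :=
  [wire 2 [1, 1, 0], rep 1 1, gather 1 (ss.flatMap List.range)] ++ upCode ss ++ downCode ss ++
    shiftAllCode ss ++ mapCode 0 (List.range ss.length) (fun i => ss.getD i 0)
      fun i => invCode (ss.getD i 0)

/-- Interpolation: from the given power series at the points, the weights, the subproduct tree and
the negated points compute a polynomial. -/
def interpCode (ss : List ℕ) : VCode :=
  [wire 4 [0, 1, 3, 2]] ++ mapCode 1 (List.range ss.length) (fun i => ss.getD i 0) (fun i =>
    [wire 2 [1, 0], vdrop (ss.take i).sum, vtake (ss.getD i 0)] ++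
      mulCode (ss.getD i 0) (ss.getD i 0) (ss.getD i 0) (ss.getD i 0)) ++
    shiftAllCode ss ++ upCode ss

/-- Expansion of a polynomial with `N` coefficients at all points, given the subproduct tree and the
points. -/
def expansionCode (ss : List ℕ) (N : ℕ) : VCode :=
  rootRemCode ss.sum N ++ downCode ss ++ shiftAllCode ss

section Correctness

variable {K : Type*} [Field K] (A : Arith K)

theorem getD_map_range {α : Type*} (f : ℕ → α) {t i : ℕ} (hi : i < t) (d : α) :
    ((List.range t).map f).getD i d = f i := by
  simp [List.getD_eq_getElem?_getD, hi]

theorem run_shiftAllCode (x : ℕ → K) (s : ℕ → ℕ) (t : ℕ) (p : ℕ → K[X])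
    (hp : ∀ i < t, (p i).degree < s i) (k : VCode) (st : List (List K)) :
    A.run (shiftAllCode ((List.range t).map s) ++ k)
        ((List.range t).flatMap (fun i => polyCoeffs (p i) (s i)) :: (List.range t).map x :: st) =
      A.run k ((List.range t).flatMap
        (fun i => polyCoeffs ((p i).comp (X + C (x i))) (s i)) :: st) := by
  unfold shiftAllCode
  rw [List.length_map, List.length_range]
  refine A.run_mapCode (List.range t) (ctx := [(List.range t).map x]) rfl ?_ ?_ k st
  · intro i hi
    rw [getD_map_range s (List.mem_range.1 hi), length_polyCoeffs]
  · intro i hi k st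
    have hi : i < t := List.mem_range.1 hi
    simp only [getD_map_range s hi, List.append_assoc, List.cons_append, List.nil_append,
      A.run_wire, List.map_cons, List.map_nil, List.getD_cons_zero, List.getD_cons_succ,
      List.drop_succ_cons, List.drop_zero]
    rw [A.run_gather (by simp)]
    simp only [List.map_cons, List.map_nil, getD_map_range x hi, List.cons_append, List.nil_append,
      A.run_wire, List.getD_cons_zero, List.getD_cons_succ, List.drop_succ_cons, List.drop_zero]
    rw [A.run_shiftCode _ (hp i hi), A.run_vtake, List.take_left' (by simp)]

/-- The polynomial `(X - x) ^ s`. -/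
noncomputable def powerAt (x : K) (s : ℕ) : K[X] := (X - C x) ^ s

theorem powerAt_monic (x : K) (s : ℕ) : (powerAt x s).Monic := (monic_X_sub_C x).pow s

@[simp] theorem natDegree_powerAt (x : K) (s : ℕ) : (powerAt x s).natDegree = s := by
  simp [powerAt]

theorem powerAt_comp (x : K) (s : ℕ) : (powerAt x s).comp (X + C x) = X ^ s := by
  simp [powerAt]

/-- The list of the polynomials `(X - x i) ^ s i`. -/
noncomputable def powers (x : ℕ → K) (s : ℕ → ℕ) (t : ℕ) : List K[X] :=
  (List.range t).map fun i => powerAt (x i) (s i)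

theorem powers_monic (x : ℕ → K) (s : ℕ → ℕ) (t : ℕ) : ∀ F ∈ powers x s t, F.Monic := by
  intro F hF
  obtain ⟨i, -, rfl⟩ := List.mem_map.1 hF
  exact powerAt_monic _ _

theorem map_natDegree_powers (x : ℕ → K) (s : ℕ → ℕ) (t : ℕ) :
    (powers x s t).map natDegree = (List.range t).map s := by
  simp [powers, Function.comp_def]

theorem natDegree_prod_powers (x : ℕ → K) (s : ℕ → ℕ) (t : ℕ) :
    (powers x s t).prod.natDegree = ((List.range t).map s).sum := by
  rw [natDegree_list_prod (powers_monic x s t), map_natDegree_powers]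

theorem run_leavesCode (x : ℕ → K) (s : ℕ → ℕ) (t : ℕ) (k : VCode) (st : List (List K)) :
    A.run (leavesCode ((List.range t).map s) ++ k) ((List.range t).map (fun i => -x i) :: st) =
      A.run k (lowVec (powers x s t) :: st) := by
  unfold leavesCode
  rw [List.length_map, List.length_range, List.append_assoc, List.cons_append, List.nil_append,
    A.run_rep]
  have h1 : lowVec (powers x s t) =
      (List.range t).flatMap fun i => polyCoeffs (powerAt (x i) (s i)) (s i) := by
    simp [lowVec, powers, List.flatMap_map]
  have h2 : List.replicate 0 (constant A.κ 0) = (List.range t).flatMap fun _ => ([] : List K) := by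
    simp
  rw [h1, h2]
  refine A.run_mapCode (List.range t) (row := fun _ => [])
    (ctx := [(List.range t).map fun i => -x i]) rfl (by simp) ?_ k st
  intro i hi k st
  have hi : i < t := List.mem_range.1 hi
  simp only [getD_map_range s hi, List.append_assoc, List.cons_append, List.nil_append,
    A.run_wire, List.map_cons, List.map_nil, List.getD_cons_zero, List.getD_cons_succ,
    List.drop_succ_cons, List.drop_zero]
  rw [A.run_gather (by simp)]
  simp only [List.map_cons, List.map_nil, getD_map_range _ hi]
  rw [A.run_rep_zero, A.run_shiftCode _ (by simp), A.run_vdrop, List.drop_left' (by simp),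
    ← polyCoeffs_monic, powerAt, C_neg, sub_eq_add_neg]

theorem run_pointTreeCode (x : ℕ → K) (s : ℕ → ℕ) (t : ℕ) (k : VCode) (st : List (List K)) :
    A.run (pointTreeCode ((List.range t).map s) ++ k)
        ((List.range t).map (fun i => -x i) :: st) =
      A.run k (treeVec (powers x s t) :: st) := by
  rw [pointTreeCode, List.append_assoc, run_leavesCode, ← map_natDegree_powers x s t,
    A.run_treeCode (powers_monic x s t)]

/-- The product of the moduli other than the `i`-th one. -/
noncomputable def cofactor (x : ℕ → K) (s : ℕ → ℕ) (t i : ℕ) : K[X] :=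
  (powers x s i).prod * (((List.range t).drop (i + 1)).map fun j => powerAt (x j) (s j)).prod

/-- The moduli together with residues. -/
noncomputable def withResidues (x : ℕ → K) (s : ℕ → ℕ) (t : ℕ) (a : ℕ → K[X]) :
    List (K[X] × K[X]) := (List.range t).map fun i => (powerAt (x i) (s i), a i)

theorem map_fst_withResidues (x : ℕ → K) (s : ℕ → ℕ) (t : ℕ) (a : ℕ → K[X]) :
    (withResidues x s t a).map Prod.fst = powers x s t := by
  simp [withResidues, powers, Function.comp_def]

theorem residueVec_withResidues (x : ℕ → K) (s : ℕ → ℕ) (t : ℕ) (a : ℕ → K[X]) :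
    residueVec (withResidues x s t a) = (List.range t).flatMap fun i => polyCoeffs (a i) (s i) := by
  simp [withResidues, residueVec, List.flatMap_map]

theorem isResidueList_withResidues (x : ℕ → K) (s : ℕ → ℕ) (t : ℕ) (a : ℕ → K[X])
    (ha : ∀ i < t, (a i).degree < s i) : IsResidueList (withResidues x s t a) := by
  constructor
  · intro e he
    obtain ⟨i, -, rfl⟩ := List.mem_map.1 he
    exact powerAt_monic _ _
  · intro e he
    obtain ⟨i, hi, rfl⟩ := List.mem_map.1 he
    simpa using ha i (List.mem_range.1 hi)

theorem range_split {t i : ℕ} (hi : i < t) :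
    List.range t = List.range i ++ i :: (List.range t).drop (i + 1) := by
  have h := (List.take_append_drop i (List.range t)).symm
  rwa [List.take_range, min_eq_left hi.le, List.drop_eq_getElem_cons (by simpa using hi),
    List.getElem_range] at h

theorem upPoly_withResidues (x : ℕ → K) (s : ℕ → ℕ) {t i : ℕ} (hi : i < t) (a : ℕ → K[X]) :
    powerAt (x i) (s i) ∣ upPoly (withResidues x s t a) - a i * cofactor x s t i := by
  have h : withResidues x s t a = withResidues x s i a ++ (powerAt (x i) (s i), a i) ::
      ((List.range t).drop (i + 1)).map fun j => (powerAt (x j) (s j), a j) := by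
    conv_lhs => rw [withResidues, range_split hi]
    simp [withResidues]
  have h2 : List.map Prod.fst (((List.range t).drop (i + 1)).map fun j =>
      (powerAt (x j) (s j), a j)) =
      ((List.range t).drop (i + 1)).map fun j => powerAt (x j) (s j) := by
    simp [Function.comp_def]
  rw [h, upPoly_append, upPoly, map_fst_withResidues, List.map_cons, List.prod_cons, cofactor]
  simp only [h2]
  exact ⟨upPoly (withResidues x s i a) *
      (((List.range t).drop (i + 1)).map fun j => powerAt (x j) (s j)).prod + (powers x s i).prod *
      upPoly (((List.range t).drop (i + 1)).map fun j => (powerAt (x j) (s j), a j)), by ring⟩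

theorem eval_cofactor_ne_zero (x : ℕ → K) (s : ℕ → ℕ) {t i : ℕ} (hi : i < t)
    (hx : ∀ j < t, x j = x i → j = i) : (cofactor x s t i).eval (x i) ≠ 0 := by
  have key : ∀ l : List ℕ, (∀ j ∈ l, j < t ∧ j ≠ i) →
      (l.map fun j => powerAt (x j) (s j)).prod.eval (x i) ≠ 0 := by
    intro l hl
    rw [eval_list_prod]
    refine List.prod_ne_zero ?_
    simp only [List.mem_map, not_exists, not_and]
    rintro _ ⟨j, hj, rfl⟩ h
    simp only [powerAt, eval_pow, eval_sub, eval_X, eval_C] at h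
    have h2 : x i - x j = 0 := by_contra fun h0 => pow_ne_zero _ h0 h
    exact (hl j hj).2 (hx j (hl j hj).1 (sub_eq_zero.1 h2).symm)
  rw [cofactor, eval_mul]
  refine mul_ne_zero (key _ ?_) (key _ ?_)
  · intro j hj
    have := List.mem_range.1 hj
    omega
  · intro j hj
    obtain ⟨n, hn, rfl⟩ := List.getElem_of_mem hj
    simp at hn ⊢
    omega

/-- The residues `1`, except modulo `1`. -/
noncomputable def unitResidue (s : ℕ → ℕ) (i : ℕ) : K[X] := if s i = 0 then 0 else 1

theorem degree_unitResidue_lt (s : ℕ → ℕ) (i : ℕ) :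
    (unitResidue s i : K[X]).degree < s i := by
  unfold unitResidue
  split_ifs with h
  · simp
  · rw [degree_one]
    exact_mod_cast Nat.pos_of_ne_zero h

/-- The expansion of the `i`-th cofactor at the `i`-th point. -/
noncomputable def cofactorAt (x : ℕ → K) (s : ℕ → ℕ) (t i : ℕ) : K[X] :=
  (upPoly (withResidues x s t (unitResidue s)) %ₘ powerAt (x i) (s i)).comp (X + C (x i))

theorem comp_dvd {p q r : K[X]} (h : p ∣ q) : p.comp r ∣ q.comp r := by
  obtain ⟨u, rfl⟩ := h
  exact ⟨u.comp r, mul_comp _ _ _⟩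

theorem cofactorAt_dvd (x : ℕ → K) (s : ℕ → ℕ) {t i : ℕ} (hi : i < t) :
    X ^ s i ∣ cofactorAt x s t i - (cofactor x s t i).comp (X + C (x i)) := by
  rcases eq_or_ne (s i) 0 with h0 | h0
  · simp [h0]
  rw [cofactorAt, ← powerAt_comp (x i), ← sub_comp]
  refine comp_dvd ?_
  have h1 := upPoly_withResidues x s hi (unitResidue s)
  rw [unitResidue, if_neg h0, one_mul] at h1
  have h2 := dvd_modByMonic_sub (upPoly (withResidues x s t (unitResidue s)))
    (powerAt (x i) (s i))
  convert dvd_add h2 h1 using 1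
  ring

/-- The inverse power series of the cofactors. -/
noncomputable def weight (x : ℕ → K) (s : ℕ → ℕ) (t i : ℕ) : K[X] :=
  haveI := Classical.propDecidable (∃ v, X ^ s i ∣ cofactorAt x s t i * v - 1)
  if h : ∃ v, X ^ s i ∣ cofactorAt x s t i * v - 1 then h.choose else 0

theorem weight_dvd (x : ℕ → K) (s : ℕ → ℕ) {t i : ℕ} (hi : i < t)
    (hx : ∀ j < t, x j = x i → j = i) : X ^ s i ∣ cofactorAt x s t i * weight x s t i - 1 := by
  have h : ∃ v, X ^ s i ∣ cofactorAt x s t i * v - 1 := by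
    rcases eq_or_ne (s i) 0 with h0 | h0
    · simp [h0]
    refine exists_inverse ?_ _
    have h1 := X_pow_dvd_iff.1 (cofactorAt_dvd x s hi) 0 (by omega)
    rw [coeff_sub, sub_eq_zero] at h1
    rw [h1, coeff_zero_eq_eval_zero, eval_comp]
    simpa using eval_cofactor_ne_zero x s hi hx
  rw [weight, dif_pos h]
  exact h.choose_spec

theorem run_weightsCode {x : ℕ → K} (s : ℕ → ℕ) {t : ℕ}
    (hx : ∀ i < t, ∀ j < t, x j = x i → j = i) (k : VCode) (st : List (List K)) :
    A.run (weightsCode ((List.range t).map s) ++ k)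
        ((List.range t).map x :: treeVec (powers x s t) :: st) =
      A.run k ((List.range t).flatMap (fun i => polyCoeffs (weight x s t i) (s i)) :: st) := by
  have h1 : List.map (fun i => (polyCoeffs (1 : K[X]) 1).getD i 0)
      (((List.range t).map s).flatMap List.range) =
      residueVec (withResidues x s t (unitResidue s)) := by
    rw [residueVec_withResidues, List.map_flatMap, List.flatMap_map]
    refine List.flatMap_congr fun i _ => ?_
    refine List.map_congr_left fun j hj => ?_
    have : s i ≠ 0 := by
      have := List.mem_range.1 hj
      omega
    rw [getD_polyCoeffs, unitResidue, if_neg this]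
    rcases eq_or_ne j 0 with rfl | hj0
    · simp
    · rw [if_neg (by omega), coeff_one, if_neg hj0]
  have h2 := isResidueList_withResidues x s t (unitResidue s)
    fun i _ => degree_unitResidue_lt s i
  have h3 := A.run_upCode h2
  have h4 := A.run_downCode (powers_monic x s t) (p := upPoly (withResidues x s t (unitResidue s)))
    (by simpa only [map_fst_withResidues] using degree_upPoly_lt h2)
  rw [map_fst_withResidues, map_natDegree_powers] at h3
  rw [map_natDegree_powers] at h4
  simp only [weightsCode, List.append_assoc, List.cons_append, List.nil_append,
    A.run_wire, List.map_cons, List.map_nil, List.getD_cons_zero, List.getD_cons_succ,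
    List.drop_succ_cons, List.drop_zero, A.run_rep_one]
  rw [A.run_gather (by simp), h1, h3, h4]
  rw [powers, List.flatMap_map]
  simp only [natDegree_powerAt]
  rw [run_shiftAllCode]
  · rw [List.length_map, List.length_range]
    refine A.run_mapCode (List.range t) (ctx := []) rfl ?_ ?_ k st
    · intro i hi
      rw [getD_map_range s (List.mem_range.1 hi)]
      simp
    · intro i hi k st
      have hi : i < t := List.mem_range.1 hi
      rw [getD_map_range s hi]
      exact A.run_invCode (weight_dvd x s hi (hx i hi)) k st
  · intro i _
    simpa using degree_modByMonic_lt_natDegree (powerAt_monic (x i) (s i)) _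

/-- The residues from which the interpolating polynomial is computed. -/
noncomputable def interpResidue (x : ℕ → K) (s : ℕ → ℕ) (t : ℕ) (e : ℕ → K[X]) (i : ℕ) : K[X] :=
  ((e i * weight x s t i) %ₘ X ^ s i).comp (X + C (-x i))

/-- The interpolating polynomial. -/
noncomputable def interpPoly (x : ℕ → K) (s : ℕ → ℕ) (t : ℕ) (e : ℕ → K[X]) : K[X] :=
  upPoly (withResidues x s t (interpResidue x s t e))

theorem degree_mod_X_pow_lt (p : K[X]) (n : ℕ) : (p %ₘ X ^ n).degree < n := by
  simpa using degree_modByMonic_lt p (monic_X_pow (R := K) n)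

theorem degree_interpResidue_lt (x : ℕ → K) (s : ℕ → ℕ) (t : ℕ) (e : ℕ → K[X]) (i : ℕ) :
    (interpResidue x s t e i).degree < s i :=
  degree_comp_X_add_C_lt _ (degree_mod_X_pow_lt _ _)

theorem degree_interpPoly_lt (x : ℕ → K) (s : ℕ → ℕ) (t : ℕ) (e : ℕ → K[X]) :
    (interpPoly x s t e).degree < (((List.range t).map s).sum : ℕ) := by
  have := degree_upPoly_lt (isResidueList_withResidues x s t (interpResidue x s t e)
    fun i _ => degree_interpResidue_lt x s t e i)
  rwa [map_fst_withResidues, natDegree_prod_powers] at this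

/-- The interpolating polynomial has the prescribed expansions. -/
theorem interpPoly_comp {x : ℕ → K} (s : ℕ → ℕ) {t i : ℕ} (hi : i < t)
    (hx : ∀ j < t, x j = x i → j = i) (e : ℕ → K[X]) :
    X ^ s i ∣ (interpPoly x s t e).comp (X + C (x i)) - e i := by
  have h1 : X ^ s i ∣ (interpPoly x s t e).comp (X + C (x i)) -
      (interpResidue x s t e i).comp (X + C (x i)) * (cofactor x s t i).comp (X + C (x i)) := by
    rw [← mul_comp, ← sub_comp, ← powerAt_comp (x i)]
    exact comp_dvd (upPoly_withResidues x s hi _)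
  have h2 : (interpResidue x s t e i).comp (X + C (x i)) = (e i * weight x s t i) %ₘ X ^ s i := by
    rw [interpResidue, comp_assoc]
    simp
  have h3 : X ^ s i ∣ (e i * weight x s t i) %ₘ X ^ s i - e i * weight x s t i :=
    dvd_modByMonic_sub _ _
  rw [h2] at h1
  have h4 := cofactorAt_dvd x s hi
  have h5 := weight_dvd x s hi hx
  set a := (interpPoly x s t e).comp (X + C (x i))
  set b := (e i * weight x s t i) %ₘ X ^ s i
  set c := (cofactor x s t i).comp (X + C (x i))
  have : a - e i = (a - b * c) + (b - e i * weight x s t i) * c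
      - (cofactorAt x s t i - c) * (e i * weight x s t i)
      + e i * (cofactorAt x s t i * weight x s t i - 1) := by ring
  rw [this]
  exact dvd_add (dvd_sub (dvd_add h1 (h3.mul_right _)) (h4.mul_right _)) (h5.mul_left _)

theorem flatMap_range_slice {α : Type*} (f : ℕ → List α) (s : ℕ → ℕ)
    (hf : ∀ i, (f i).length = s i) {t i : ℕ} (hi : i < t) :
    (((List.range t).flatMap f).drop (((List.range t).map s).take i).sum).take (s i) = f i := by
  have h1 : (List.range t).flatMap f = (List.range i).flatMap f ++
      (f i ++ ((List.range t).drop (i + 1)).flatMap f) := by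
    conv_lhs => rw [range_split hi]
    simp
  have h2 : (((List.range t).map s).take i).sum = ((List.range i).flatMap f).length := by
    rw [← List.map_take, List.take_range, min_eq_left hi.le, List.length_flatMap]
    simp [hf]
  rw [h1, h2, List.drop_left, ← hf i, List.take_left]

theorem run_interpCode {x : ℕ → K} (s : ℕ → ℕ) {t : ℕ} (e : ℕ → K[X]) (k : VCode)
    (st : List (List K)) :
    A.run (interpCode ((List.range t).map s) ++ k)
        ((List.range t).flatMap (fun i => polyCoeffs (e i) (s i)) ::
          (List.range t).flatMap (fun i => polyCoeffs (weight x s t i) (s i)) ::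
          treeVec (powers x s t) :: (List.range t).map (fun i => -x i) :: st) =
      A.run k (polyCoeffs (interpPoly x s t e) ((List.range t).map s).sum :: st) := by
  simp only [interpCode, List.append_assoc, List.cons_append, List.nil_append,
    A.run_wire, List.map_cons, List.map_nil, List.getD_cons_zero, List.getD_cons_succ,
    List.drop_succ_cons, List.drop_zero, List.length_map, List.length_range]
  have h1 := A.run_mapCode (List.range t) (q := 1) (len := fun i => ((List.range t).map s).getD i 0)
    (body := fun i => [wire 2 [1, 0], vdrop (((List.range t).map s).take i).sum,
      vtake (((List.range t).map s).getD i 0)] ++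
      mulCode (((List.range t).map s).getD i 0) (((List.range t).map s).getD i 0)
        (((List.range t).map s).getD i 0) (((List.range t).map s).getD i 0))
    (row := fun i => polyCoeffs (e i) (s i))
    (out := fun i => polyCoeffs ((e i * weight x s t i) %ₘ X ^ s i) (s i))
    (ctx := [(List.range t).flatMap (fun i => polyCoeffs (weight x s t i) (s i))]) rfl
    (by
      intro i hi
      rw [getD_map_range s (List.mem_range.1 hi)]
      simp)
    (by
      intro i hi k st
      have hi : i < t := List.mem_range.1 hi
      simp only [getD_map_range s hi, List.cons_append, List.nil_append,
        A.run_wire, List.map_cons, List.map_nil, List.getD_cons_zero, List.getD_cons_succ,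
        List.drop_succ_cons, List.drop_zero, A.run_vdrop, A.run_vtake]
      rw [flatMap_range_slice _ s (by simp) hi, A.run_mulCode_trunc, mul_comm,
        polyCoeffs_congr_dvd (dvd_modByMonic_sub (e i * weight x s t i) (X ^ s i))])
  simp only [List.cons_append, List.nil_append] at h1
  rw [h1, run_shiftAllCode A _ s t _ fun i _ => degree_mod_X_pow_lt _ _]
  have h2 := A.run_upCode (isResidueList_withResidues x s t (interpResidue x s t e)
    fun i _ => degree_interpResidue_lt x s t e i)
  rw [map_fst_withResidues, map_natDegree_powers, residueVec_withResidues,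
    natDegree_prod_powers] at h2
  exact h2 k st

theorem run_expansionCode (x : ℕ → K) (s : ℕ → ℕ) (t : ℕ) {p : K[X]} {N : ℕ} (hp : p.degree < N)
    (k : VCode) (st : List (List K)) :
    A.run (expansionCode ((List.range t).map s) N ++ k)
        (polyCoeffs p N :: treeVec (powers x s t) :: (List.range t).map x :: st) =
      A.run k ((List.range t).flatMap
        (fun i => polyCoeffs (p.comp (X + C (x i))) (s i)) :: st) := by
  have h1 := A.run_rootRemCode (powers_monic x s t) hp
  have h2 := A.run_downCode (powers_monic x s t)
    (degree_modByMonic_lt_natDegree (monic_list_prod (powers_monic x s t)) p)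
  rw [map_natDegree_powers] at h2
  rw [expansionCode, ← natDegree_prod_powers x, List.append_assoc, List.append_assoc, h1, h2]
  conv_lhs => rw [powers]
  rw [List.flatMap_map]
  simp only [natDegree_powerAt]
  rw [run_shiftAllCode]
  · congr 2
    refine List.flatMap_congr fun i hi => polyCoeffs_congr_dvd ?_
    have h3 : powerAt (x i) (s i) ∈ powers x s t := List.mem_map.2 ⟨i, hi, rfl⟩
    rw [← sub_comp, ← powerAt_comp (x i)]
    refine comp_dvd ?_
    have h4 := dvd_modByMonic_sub (p %ₘ (powers x s t).prod) (powerAt (x i) (s i))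
    have h5 := (List.dvd_prod h3).trans (dvd_modByMonic_sub p (powers x s t).prod)
    have h6 := dvd_add h4 h5
    rwa [sub_add_sub_cancel] at h6
  · intro i _
    simpa using degree_modByMonic_lt_natDegree (powerAt_monic (x i) (s i)) _

end Correctness

theorem map_getD_range (l : List ℕ) : ((List.range l.length).map fun i => l.getD i 0) = l := by
  refine List.ext_getElem (by simp) fun i h1 h2 => ?_
  simp [List.getD_eq_getElem?_getD, h2]

theorem getD_le_sum (l : List ℕ) (i : ℕ) : l.getD i 0 ≤ l.sum := by
  rcases lt_or_ge i l.length with h | h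
  · rw [List.getD_eq_getElem _ _ h]
    exact List.single_le_sum (by simp) _ (List.getElem_mem h)
  · simp [List.getD_eq_getElem?_getD, h]

namespace Cost

variable {B m δ : ℕ}

/-- Cost of a loop whose bodies have costs proportional to the entries of a list. -/
theorem mapCode_getD (q c : ℕ) (ss : List ℕ) {len : ℕ → ℕ} {body : ℕ → VCode}
    (h : ∀ i, Cost B m δ (body i) (c * ss.getD i 0) 0) :
    Cost B m δ (Residual.mapCode q (List.range ss.length) len body) (c * ss.sum) 0 := by
  refine (mapCode q _ (w' := fun _ => 0) fun i _ => h i).mono ?_ (by simp)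
  rw [List.sum_map_mul_left, map_getD_range]

variable {ss : List ℕ} {h : ℕ}

theorem shiftAllCode (hB : ss.sum ≤ B) (hh : ss.sum ≤ 2 ^ h) :
    Cost B m δ (shiftAllCode ss) (3 * h * ss.sum) 0 := by
  refine mapCode_getD 1 _ ss fun i => ?_
  have h1 := getD_le_sum ss i
  refine ((((wire _ _).cons ((gather _ _).cons (wire _ _))).append
    (shiftCode (h1.trans hB) (h1.trans hh))).append (vtake _)).mono ?_ (by omega)
  ring_nf
  omega

theorem leavesCode (hB : ss.sum ≤ B) (hh : ss.sum ≤ 2 ^ h) :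
    Cost B m δ (leavesCode ss) (3 * h * ss.sum) 0 := by
  refine ((rep _ _).append (mapCode_getD 1 (3 * h) ss fun i => ?_)).mono (by omega) (by omega)
  have h1 := getD_le_sum ss i
  refine ((((wire _ _).cons ((gather _ _).cons (rep _ _))).append
    (shiftCode (h1.trans hB) (h1.trans hh))).append (vdrop _)).mono ?_ (by omega)
  ring_nf
  omega

theorem pointTreeCode (hB : ss.sum ≤ B) (hh : ss.sum ≤ 2 ^ h) (hl : ss.length ≤ 2 ^ h) :
    Cost B m δ (pointTreeCode ss) (16 * ss.sum * (h + 1)) 0 := by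
  refine ((leavesCode hB hh).append (treeCode hB hl)).mono ?_ (by omega)
  ring_nf
  omega

theorem weightsCode (hB : ss.sum ≤ B) (hh : ss.sum ≤ 2 ^ h) (hl : ss.length ≤ 2 ^ h) :
    Cost B m δ (weightsCode ss) (12 * ss.sum * (h + 1)) 0 := by
  refine (((((wire _ _).cons ((rep _ _).cons (gather _ _))).append (upCode hB hl)).append
    (downCode hB hl)).append (shiftAllCode hB hh)).append (mapCode_getD 0 12 ss fun i =>
    invCode ((getD_le_sum ss i).trans hB)) |>.mono ?_ (by omega)
  ring_nf
  omega

theorem interpCode (hB : ss.sum ≤ B) (hh : ss.sum ≤ 2 ^ h) (hl : ss.length ≤ 2 ^ h) :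
    Cost B m δ (interpCode ss) (6 * ss.sum * (h + 1)) 0 := by
  refine (((wire _ _).append (mapCode_getD 1 1 ss fun i => ((wire _ _).cons ((vdrop _).cons
    (vtake _))).append (mulCode _ _ _ ((getD_le_sum ss i).trans hB)) |>.mono (by omega)
    (by omega))).append (shiftAllCode hB hh)).append (upCode hB hl) |>.mono ?_ (by omega)
  ring_nf
  omega

theorem expansionCode (hB : ss.sum ≤ B) (hh : ss.sum ≤ 2 ^ h) (hl : ss.length ≤ 2 ^ h) (N : ℕ) :
    Cost B m δ (expansionCode ss N) (3 * N + 9 * ss.sum * h) 0 := by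
  refine ((rootRemCode hB N).append (downCode hB hl)).append (shiftAllCode hB hh) |>.mono ?_
    (by omega)
  ring_nf
  omega

end Cost

section Primrec

variable {α : Type*} [Primcodable α]

@[fun_prop] theorem primrec_shiftAllCode {f : α → List ℕ} (hf : Primrec f) :
    Primrec fun x => shiftAllCode (f x) := by unfold shiftAllCode; fun_prop
@[fun_prop] theorem primrec_leavesCode {f : α → List ℕ} (hf : Primrec f) :
    Primrec fun x => leavesCode (f x) := by unfold leavesCode; fun_prop
@[fun_prop] theorem primrec_pointTreeCode {f : α → List ℕ} (hf : Primrec f) :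
    Primrec fun x => pointTreeCode (f x) := by unfold pointTreeCode; fun_prop
@[fun_prop] theorem primrec_weightsCode {f : α → List ℕ} (hf : Primrec f) :
    Primrec fun x => weightsCode (f x) := by unfold weightsCode; fun_prop
@[fun_prop] theorem primrec_interpCode {f : α → List ℕ} (hf : Primrec f) :
    Primrec fun x => interpCode (f x) := by unfold interpCode; fun_prop
@[fun_prop] theorem primrec_expansionCode {f : α → List ℕ} {g : α → ℕ} (hf : Primrec f)
    (hg : Primrec g) : Primrec fun x => expansionCode (f x) (g x) := by
  unfold expansionCode; fun_prop

end Primrec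

/-! ### Sums of shifted polynomials -/

/-- Add `b` polynomials with `D + E` coefficients each, the `i`-th multiplied by `X ^ (D * i)`. -/
def overlapCode (D E : ℕ) : ℕ → VCode
  | 0 => [wire 1 [], rep 0 E]
  | b + 1 => [wire 1 [0, 0], vdrop (D + E)] ++ overlapCode D E b ++
      [wire 2 [1, 0], vtake (D + E)] ++ cut D ++ [wire 3 [2, 0, 1]] ++ cut E ++
      [wire 4 [1, 2, 0, 3], vadd E, cat, wire 2 [1, 0], cat]

/-- Add the products of `a` and `b` chunks of length `D` of two polynomials. -/
def entryCode (D a b : ℕ) : VCode :=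
  mapCode 0 (List.range a) (fun _ => b * (2 * D)) (fun _ => overlapCode D D b) ++
    overlapCode D (b * D) a

section Correctness

variable {K : Type*} [Field K] (A : Arith K)

theorem run_overlapCode (D E : ℕ) {b : ℕ} (q : ℕ → K[X])
    (hq : ∀ i < b, (q i).degree < (D + E : ℕ)) (k : VCode) (st : List (List K)) :
    A.run (overlapCode D E b ++ k)
        ((List.range b).flatMap (fun i => polyCoeffs (q i) (D + E)) :: st) =
      A.run k (polyCoeffs (∑ i ∈ Finset.range b, X ^ (D * i) * q i) (b * D + E) :: st) := by
  induction b generalizing q k st with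
  | zero => simp [overlapCode, A.run_rep_zero]
  | succ b ih =>
    obtain ⟨u, v, hu, huv⟩ := exists_split (q 0) D
    obtain ⟨y, z, hy, hyz⟩ :=
      exists_split (∑ i ∈ Finset.range b, X ^ (D * i) * q (i + 1)) E
    have hv : v.degree < E := by
      refine (degree_lt_iff_coeff_zero _ _).2 fun n hn => ?_
      have h1 := (degree_lt_iff_coeff_zero _ _).1 (hq 0 (by omega)) (D + n) (by omega)
      have h2 := (degree_lt_iff_coeff_zero _ _).1 hu (D + n) (by omega)
      rw [huv, coeff_add, h2, zero_add, coeff_X_pow_mul', if_pos (by omega)] at h1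
      simpa using h1
    have h0 : (List.range (b + 1)).flatMap (fun i => polyCoeffs (q i) (D + E)) =
        polyCoeffs (q 0) (D + E) ++
          (List.range b).flatMap (fun i => polyCoeffs (q (i + 1)) (D + E)) := by
      rw [List.range_succ_eq_map, List.flatMap_cons, List.flatMap_map]
    rw [h0, overlapCode]
    simp only [List.append_assoc, List.cons_append, List.nil_append, A.run_wire, List.map_cons,
      List.map_nil, List.getD_cons_zero, List.drop_succ_cons, List.drop_zero,
      A.run_vdrop]
    rw [List.drop_left' (by simp), ih (fun i => q (i + 1)) fun i hi => hq (i + 1) (by omega)]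
    simp only [List.cons_append, List.nil_append, A.run_wire, List.map_cons,
      List.map_nil, List.getD_cons_zero, List.getD_cons_succ, List.drop_succ_cons, List.drop_zero,
      A.run_vtake]
    rw [List.take_left' (by simp), huv, ← polyCoeffs_append _ hu, A.run_cut_polyCoeffs]
    simp only [List.cons_append, List.nil_append, A.run_wire, List.map_cons,
      List.map_nil, List.getD_cons_zero, List.getD_cons_succ, List.drop_succ_cons, List.drop_zero]
    rw [hyz, Nat.add_comm (b * D) E, ← polyCoeffs_append _ hy, A.run_cut_polyCoeffs]
    simp only [List.cons_append, List.nil_append, A.run_wire, List.map_cons,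
      List.map_nil, List.getD_cons_zero, List.getD_cons_succ, List.drop_succ_cons, List.drop_zero]
    rw [A.run_vadd (length_polyCoeffs _ _) (length_polyCoeffs _ _), zipWith_add_polyCoeffs,
      A.run_cat]
    simp only [List.cons_append, List.nil_append, A.run_wire, List.map_cons,
      List.map_nil, List.getD_cons_zero, List.getD_cons_succ, List.drop_succ_cons, List.drop_zero,
      A.run_cat]
    rw [polyCoeffs_append _ (degree_add_lt hy hv), polyCoeffs_append _ hu, Finset.sum_range_succ']
    have h1 : ∑ i ∈ Finset.range b, X ^ (D * (i + 1)) * q (i + 1) =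
        X ^ D * ∑ i ∈ Finset.range b, X ^ (D * i) * q (i + 1) := by
      rw [Finset.mul_sum]
      refine Finset.sum_congr rfl fun i _ => ?_
      ring
    rw [h1, hyz, huv]
    congr 3
    · ring
    · ring

theorem run_entryCode {D a b : ℕ} (q : ℕ → ℕ → K[X])
    (hq : ∀ i < a, ∀ j < b, (q i j).degree < (2 * D : ℕ)) (k : VCode) (st : List (List K)) :
    A.run (entryCode D a b ++ k) ((List.range a).flatMap (fun i =>
        (List.range b).flatMap fun j => polyCoeffs (q i j) (2 * D)) :: st) =
      A.run k (polyCoeffs (∑ i ∈ Finset.range a, X ^ (D * i) *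
        ∑ j ∈ Finset.range b, X ^ (D * j) * q i j) ((a + b) * D) :: st) := by
  rw [entryCode, List.append_assoc]
  have h1 := A.run_mapCode (List.range a) (ctx := []) (q := 0) (len := fun _ => b * (2 * D))
    (body := fun _ => overlapCode D D b)
    (row := fun i => (List.range b).flatMap fun j => polyCoeffs (q i j) (2 * D))
    (out := fun i => polyCoeffs (∑ j ∈ Finset.range b, X ^ (D * j) * q i j) (D + b * D)) rfl
    (by simp) (fun i hi k st => by
      have := run_overlapCode A D D (q i) (b := b)
        (fun j hj => by rw [← two_mul]; exact hq i (List.mem_range.1 hi) j hj) k st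
      rw [← two_mul] at this
      simp only [List.nil_append]
      rw [this, Nat.add_comm D])
    (overlapCode D (b * D) a ++ k) st
  simp only [List.nil_append] at h1
  rw [h1, run_overlapCode]
  · congr 3
    ring
  · intro i hi
    refine (degree_lt_iff_coeff_zero _ _).2 fun n hn => ?_
    rw [finsetSum_coeff]
    refine Finset.sum_eq_zero fun j hj => ?_
    have hj : j < b := Finset.mem_range.1 hj
    rw [coeff_X_pow_mul']
    split_ifs with h
    · refine (degree_lt_iff_coeff_zero _ _).1 (hq i hi j hj) _ ?_
      have : (j + 1) * D ≤ b * D := Nat.mul_le_mul_right _ hj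
      have h3 : (j + 1) * D = D * j + D := by ring
      omega
    · rfl

end Correctness

namespace Cost

variable {B m δ : ℕ}

theorem overlapCode (D E b : ℕ) : Cost B m δ (overlapCode D E b) (b * E) 0 := by
  induction b with
  | zero => exact ((wire _ _).cons (rep _ _)).mono (by omega) (by omega)
  | succ b ih =>
    refine ((wire _ _).cons (vdrop _)).append ih |>.append ((wire _ _).cons (vtake _)) |>.append
      (cut _) |>.append (wire _ _) |>.append (cut _) |>.append ((wire _ _).cons ((vadd _).cons
      (cat.cons ((wire _ _).cons cat)))) |>.mono ?_ (by omega)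
    ring_nf
    omega

theorem entryCode (D a b : ℕ) : Cost B m δ (entryCode D a b) (2 * a * b * D) 0 := by
  refine ((mapCode 0 _ fun _ _ => overlapCode D D b).append (overlapCode _ _ _)).mono ?_
    (by simp)
  simp
  ring_nf
  omega

end Cost

section Primrec

variable {α : Type*} [Primcodable α]

@[fun_prop] theorem primrec_overlapCode {f g h : α → ℕ} (hf : Primrec f) (hg : Primrec g)
    (hh : Primrec h) : Primrec fun x => overlapCode (f x) (g x) (h x) := by
  have : ∀ D E b, overlapCode D E b = Nat.rec (motive := fun _ => VCode) [wire 1 [], rep 0 E]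
      (fun _ y => [wire 1 [0, 0], vdrop (D + E)] ++ y ++
      [wire 2 [1, 0], vtake (D + E)] ++ cut D ++ [wire 3 [2, 0, 1]] ++ cut E ++
      [wire 4 [1, 2, 0, 3], vadd E, cat, wire 2 [1, 0], cat]) b := by
    intro D E b
    induction b with
    | zero => rfl
    | succ b ih => simp only [overlapCode, ih]
  simp only [this]
  fun_prop

@[fun_prop] theorem primrec_entryCode {f g h : α → ℕ} (hf : Primrec f) (hg : Primrec g)
    (hh : Primrec h) : Primrec fun x => entryCode (f x) (g x) (h x) := by
  unfold entryCode
  fun_prop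

end Primrec

/-! ### Products of polynomial matrices with unbalanced degrees -/

/-- The labels of the coefficients of a matrix with `m` columns whose rows have indices in `I`, the
polynomials of the row `i` having `len i` coefficients. -/
def labels (I : List ℕ) (m : ℕ) (len : ℕ → ℕ) : List (ℕ × ℕ × ℕ) :=
  I.flatMap fun i => (List.range m).flatMap fun k => (List.range (len i)).map fun l => (i, k, l)

/-- The number of chunks of length `D` of a vector of length `n`. -/
def chunkCount (D n : ℕ) : ℕ := (n + D - 1) / D

/-- The chunks of length `D` of the rows of a matrix. -/
def chunkList (I : List ℕ) (D : ℕ) (len : ℕ → ℕ) : List (ℕ × ℕ) :=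
  I.flatMap fun i => (List.range (chunkCount D (len i))).map fun a => (i, a)

/-- The label of the coefficient of degree `l` in column `k` and in the `r`-th chunk. -/
def chunkLabel (rl : List (ℕ × ℕ)) (m D r k l : ℕ) : ℕ × ℕ × ℕ :=
  if l < D then if r < rl.length then ((rl.getD r (0, 0)).1, k, (rl.getD r (0, 0)).2 * D + l)
    else (0, m, 0) else (0, m, 0)

/-- The pairs of numbers below `a` and `b`. -/
def rangeProd (a b : ℕ) : List (ℕ × ℕ) :=
  (List.range a).flatMap fun x => (List.range b).map fun z => (x, z)

/-- Multiply the `x`-th and the `z`-th block of `m` chunks of two matrices. -/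
def blockCode (m D : ℕ) (S T : List (ℕ × ℕ × ℕ)) (rl cl : List (ℕ × ℕ)) (x z : ℕ) : VCode :=
  [wire 3 [2, 1],
    relabel T ((List.range m).flatMap fun k => (List.range m).flatMap fun w =>
      (List.range (D + 1)).map fun l => chunkLabel cl m D (z * m + w) k l),
    wire 2 [1, 0],
    relabel S ((List.range m).flatMap fun y => (List.range m).flatMap fun k =>
      (List.range (D + 1)).map fun l => chunkLabel rl m D (x * m + y) k l),
    mmul m D]

/-- The labels of the products of all pairs of blocks. -/
def blockLabels (m D ρ γ : ℕ) : List (ℕ × ℕ × ℕ) :=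
  (rangeProd ρ γ).flatMap fun xz => (List.range m).flatMap fun y => (List.range m).flatMap fun w =>
    (List.range (2 * D + 1)).map fun l => (xz.1 * m + y, xz.2 * m + w, l)

/-- The labels of the products of chunks, sorted by the pairs of rows. -/
def pairLabels (D : ℕ) (I J : List ℕ) (len len' : ℕ → ℕ) : List (ℕ × ℕ × ℕ) :=
  J.flatMap fun j => I.flatMap fun i => (List.range (chunkCount D (len i))).flatMap fun a =>
    (List.range (chunkCount D (len' j))).flatMap fun b => (List.range (2 * D)).map fun l =>
      (position (chunkList I D len) (i, a), position (chunkList J D len') (j, b), l)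

/-- Compute the products of all chunks of the rows of two polynomial matrices with `m` columns. -/
def matCode (m D : ℕ) (I J : List ℕ) (len len' : ℕ → ℕ) : VCode :=
  [rep 0 0] ++ mapCode 2 (rangeProd (chunkCount m (chunkList I D len).length)
      (chunkCount m (chunkList J D len').length)) (fun _ => 0)
    (fun xz => blockCode m D (labels I m len) (labels J m len') (chunkList I D len)
      (chunkList J D len') xz.1 xz.2) ++
  [relabel (blockLabels m D (chunkCount m (chunkList I D len).length)
    (chunkCount m (chunkList J D len').length)) (pairLabels D I J len len')]

theorem mem_labels {I : List ℕ} {m : ℕ} {len : ℕ → ℕ} {i k l : ℕ} :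
    (i, k, l) ∈ labels I m len ↔ i ∈ I ∧ k < m ∧ l < len i := by
  simp [labels]

theorem mem_chunkList {I : List ℕ} {D : ℕ} {len : ℕ → ℕ} {i a : ℕ} :
    (i, a) ∈ chunkList I D len ↔ i ∈ I ∧ a < chunkCount D (len i) := by
  simp [chunkList]

theorem mem_rangeProd {a b x z : ℕ} : (x, z) ∈ rangeProd a b ↔ x < a ∧ z < b := by
  simp [rangeProd]

theorem le_chunkCount_mul {D : ℕ} (hD : 1 ≤ D) (n : ℕ) : n ≤ chunkCount D n * D := by
  have := Nat.div_add_mod (n + D - 1) D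
  have h2 := Nat.mod_lt (n + D - 1) hD
  rw [chunkCount, Nat.mul_comm]
  omega

theorem mem_blockLabels {m D ρ γ r s l : ℕ} (hm : 1 ≤ m) :
    (r, s, l) ∈ blockLabels m D ρ γ ↔ r < ρ * m ∧ s < γ * m ∧ l < 2 * D + 1 := by
  simp only [blockLabels, List.mem_flatMap, List.mem_map, List.mem_range, Prod.exists,
    mem_rangeProd, Prod.mk.injEq]
  constructor
  · rintro ⟨x, z, ⟨hx, hz⟩, y, hy, w, hw, l', hl, rfl, rfl, rfl⟩
    refine ⟨?_, ?_, hl⟩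
    · calc x * m + y < (x + 1) * m := by ring_nf; omega
        _ ≤ ρ * m := Nat.mul_le_mul_right _ hx
    · calc z * m + w < (z + 1) * m := by ring_nf; omega
        _ ≤ γ * m := Nat.mul_le_mul_right _ hz
  · rintro ⟨hr, hs, hl⟩
    refine ⟨r / m, s / m, ⟨Nat.div_lt_of_lt_mul (by rwa [Nat.mul_comm]),
      Nat.div_lt_of_lt_mul (by rwa [Nat.mul_comm])⟩, r % m, Nat.mod_lt _ hm, s % m,
      Nat.mod_lt _ hm, l, hl, ?_, ?_, rfl⟩
    · rw [Nat.mul_comm, Nat.div_add_mod]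
    · rw [Nat.mul_comm, Nat.div_add_mod]

section Correctness

variable {K : Type*} [Field K] (A : Arith K)

/-- The coefficient with the given label. -/
noncomputable def coeffAt (p : ℕ → ℕ → K[X]) (x : ℕ × ℕ × ℕ) : K := (p x.1 x.2.1).coeff x.2.2

theorem map_coeffAt_labels (p : ℕ → ℕ → K[X]) (I : List ℕ) (m : ℕ) (len : ℕ → ℕ) :
    (labels I m len).map (coeffAt p) =
      I.flatMap fun i => (List.range m).flatMap fun k => polyCoeffs (p i k) (len i) := by
  simp [labels, List.map_flatMap, polyCoeffs, Function.comp_def, coeffAt]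

/-- The `a`-th chunk of length `D` of a polynomial. -/
noncomputable def chunk (p : K[X]) (D a : ℕ) : K[X] :=
  ∑ l ∈ Finset.range D, monomial l (p.coeff (a * D + l))

theorem coeff_chunk (p : K[X]) (D a l : ℕ) :
    (chunk p D a).coeff l = if l < D then p.coeff (a * D + l) else 0 := by
  simp [chunk, finsetSum_coeff, coeff_monomial]

theorem degree_chunk_lt (p : K[X]) (D a : ℕ) : (chunk p D a).degree < D := by
  refine (degree_lt_iff_coeff_zero _ _).2 fun n hn => ?_
  rw [coeff_chunk, if_neg (by omega)]

theorem sum_chunk {p : K[X]} {D n : ℕ} (hD : 1 ≤ D) (hp : p.degree < (n * D : ℕ)) :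
    ∑ a ∈ Finset.range n, X ^ (D * a) * chunk p D a = p := by
  ext i
  have h1 : ∀ a, (X ^ (D * a) * chunk p D a).coeff i = if i / D = a then p.coeff i else 0 := by
    intro a
    rw [coeff_X_pow_mul', coeff_chunk]
    rcases eq_or_ne (i / D) a with rfl | h
    · have h2 := Nat.div_add_mod i D
      have h3 := Nat.mod_lt i hD
      rw [if_pos (by omega), if_pos (by omega), if_pos rfl, Nat.mul_comm (i / D)]
      congr 1
      omega
    · rw [if_neg h]
      split_ifs with h2 h3
      · exfalso
        refine h (Nat.div_eq_of_lt_le (by rwa [Nat.mul_comm]) ?_)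
        rw [Nat.add_mul, Nat.mul_comm a]
        omega
      · rfl
      · rfl
  rw [finsetSum_coeff, Finset.sum_congr rfl fun a _ => h1 a]
  simp only [Finset.sum_ite_eq, Finset.mem_range]
  split_ifs with h
  · rfl
  · refine ((degree_lt_iff_coeff_zero _ _).1 hp i ?_).symm
    rw [not_lt, Nat.le_div_iff_mul_le hD] at h
    exact h

/-- The entry of a block, or zero for the padding. -/
noncomputable def chunkPoly (rl : List (ℕ × ℕ)) (p : ℕ → ℕ → K[X]) (D r k : ℕ) : K[X] :=
  if r < rl.length then chunk (p (rl.getD r (0, 0)).1 k) D (rl.getD r (0, 0)).2 else 0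

theorem degree_chunkPoly_lt (rl : List (ℕ × ℕ)) (p : ℕ → ℕ → K[X]) (D r k : ℕ) :
    (chunkPoly rl p D r k).degree < D := by
  unfold chunkPoly
  split_ifs
  · exact degree_chunk_lt _ _ _
  · exact (degree_lt_iff_coeff_zero _ _).2 (by simp)

theorem coeffAt_chunkLabel {I : List ℕ} {m D : ℕ} {len : ℕ → ℕ} {p : ℕ → ℕ → K[X]}
    (hp : ∀ i ∈ I, ∀ k < m, (p i k).degree < len i) (r l : ℕ) {k : ℕ} (hk : k < m) :
    lookup (labels I m len) (coeffAt p) (chunkLabel (chunkList I D len) m D r k l) =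
      (chunkPoly (chunkList I D len) p D r k).coeff l := by
  unfold chunkLabel chunkPoly
  by_cases hl : l < D
  · by_cases hr : r < (chunkList I D len).length
    · have h1 : (chunkList I D len).getD r (0, 0) ∈ chunkList I D len := by
        rw [List.getD_eq_getElem _ _ hr]
        exact List.getElem_mem hr
      rcases h2 : (chunkList I D len).getD r (0, 0) with ⟨i, a⟩
      rw [h2, mem_chunkList] at h1
      simp only [hl, hr, if_true, coeff_chunk]
      by_cases h3 : a * D + l < len i
      · rw [lookup_of_mem (mem_labels.2 ⟨h1.1, hk, h3⟩)]
        rfl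
      · rw [lookup_of_not_mem (by simp [mem_labels, h3])]
        exact ((degree_lt_iff_coeff_zero _ _).1 (hp i h1.1 k hk) _ (by omega)).symm
    · simp [hl, hr, mem_labels, lookup_of_not_mem]
  · rw [if_neg hl, lookup_of_not_mem (by simp [mem_labels])]
    exact ((degree_lt_iff_coeff_zero _ _).1 (degree_chunkPoly_lt _ _ _ _ _) _ (by omega)).symm

theorem flatMap_finRange {α : Type*} (m : ℕ) (f : ℕ → List α) :
    (List.finRange m).flatMap (fun i : Fin m => f i) = (List.range m).flatMap f := by
  have h : (List.finRange m).map Fin.val = List.range m := by simp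
  rw [← h, List.flatMap_map]

/-- The square matrix whose entries are given by a function of natural numbers. -/
def matrixOf {α : Type*} (m : ℕ) (f : ℕ → ℕ → α) : Matrix (Fin m) (Fin m) α :=
  Matrix.of fun i j => f i j

theorem matCoeffs_matrixOf (m d : ℕ) (f : ℕ → ℕ → K[X]) :
    matCoeffs (matrixOf m f) (fun _ => d) =
      (List.range m).flatMap fun i => (List.range m).flatMap fun j => polyCoeffs (f i j) (d + 1) := by
  simp only [matCoeffs, matrixOf, Matrix.of_apply]
  rw [← flatMap_finRange]
  refine List.flatMap_congr fun i _ => ?_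
  exact flatMap_finRange m fun j => polyCoeffs (f i j) (d + 1)

variable {I J : List ℕ} {m D : ℕ} {len len' : ℕ → ℕ} {p q : ℕ → ℕ → K[X]}

/-- The product of the `r`-th chunk and the `s`-th chunk of two matrices. -/
noncomputable def chunkProd (rl cl : List (ℕ × ℕ)) (p q : ℕ → ℕ → K[X]) (m D r s : ℕ) : K[X] :=
  ∑ k ∈ Finset.range m, chunkPoly rl p D r k * chunkPoly cl q D s k

theorem run_blockCode (hm : 1 ≤ m) (hD : 1 ≤ D) (hp : ∀ i ∈ I, ∀ k < m, (p i k).degree < len i)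
    (hq : ∀ i ∈ J, ∀ k < m, (q i k).degree < len' i) (x z : ℕ) (k : VCode) (u : List K)
    (st : List (List K)) :
    A.run (blockCode m D (labels I m len) (labels J m len') (chunkList I D len)
        (chunkList J D len') x z ++ k)
        (u :: (labels I m len).map (coeffAt p) :: (labels J m len').map (coeffAt q) :: st) =
      A.run k ((List.range m).flatMap (fun y => (List.range m).flatMap fun w =>
        (List.range (2 * D + 1)).map fun l =>
          coeffAt (chunkProd (chunkList I D len) (chunkList J D len') p q m D)
            (x * m + y, z * m + w, l)) :: st) := by
  have h1 : ((List.range m).flatMap fun k => (List.range m).flatMap fun w =>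
      (List.range (D + 1)).map fun l => chunkLabel (chunkList J D len') m D (z * m + w) k l).map
      (lookup (labels J m len') (coeffAt q)) =
      matCoeffs (matrixOf m (fun k w : ℕ =>
        chunkPoly (chunkList J D len') q D (z * m + w) k)) (fun _ => D) := by
    rw [matCoeffs_matrixOf, List.map_flatMap]
    refine List.flatMap_congr fun k hk => ?_
    rw [List.map_flatMap]
    refine List.flatMap_congr fun w _ => ?_
    rw [List.map_map]
    exact List.map_congr_left fun l _ => coeffAt_chunkLabel hq _ _ (List.mem_range.1 hk)
  have h2 : ((List.range m).flatMap fun y => (List.range m).flatMap fun k =>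
      (List.range (D + 1)).map fun l => chunkLabel (chunkList I D len) m D (x * m + y) k l).map
      (lookup (labels I m len) (coeffAt p)) =
      matCoeffs (matrixOf m (fun y k : ℕ =>
        chunkPoly (chunkList I D len) p D (x * m + y) k)) (fun _ => D) := by
    rw [matCoeffs_matrixOf, List.map_flatMap]
    refine List.flatMap_congr fun y _ => ?_
    rw [List.map_flatMap]
    refine List.flatMap_congr fun k hk => ?_
    rw [List.map_map]
    exact List.map_congr_left fun l _ => coeffAt_chunkLabel hp _ _ (List.mem_range.1 hk)
  have hdeg : ∀ {f : K[X]}, f.degree < (D : ℕ) → f.natDegree ≤ D := fun h =>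
    natDegree_le_of_degree_le h.le
  have hS : ∀ i j, (matrixOf m (fun y k : ℕ =>
      chunkPoly (chunkList I D len) p D (x * m + y) k) i j).natDegree ≤ D :=
    fun i j => hdeg (degree_chunkPoly_lt _ _ _ _ _)
  have hT : ∀ i j, (matrixOf m (fun k w : ℕ =>
      chunkPoly (chunkList J D len') q D (z * m + w) k) i j).natDegree ≤ D :=
    fun i j => hdeg (degree_chunkPoly_lt _ _ _ _ _)
  have h3 : (matrixOf m (fun y k : ℕ =>
        chunkPoly (chunkList I D len) p D (x * m + y) k)) *
      (matrixOf m (fun k w : ℕ =>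
        chunkPoly (chunkList J D len') q D (z * m + w) k)) =
      matrixOf m (fun y w : ℕ =>
        chunkProd (chunkList I D len) (chunkList J D len') p q m D (x * m + y) (z * m + w)) := by
    ext1 i j
    simp only [Matrix.mul_apply, matrixOf, Matrix.of_apply, chunkProd]
    rw [Finset.sum_range]
  simp only [blockCode, List.cons_append, List.nil_append, A.run_wire, List.map_cons,
    List.map_nil, List.getD_cons_zero, List.getD_cons_succ, List.drop_succ_cons, List.drop_zero]
  rw [A.run_relabel, h1]
  simp only [A.run_wire, List.map_cons, List.cons_append, List.nil_append,
    List.map_nil, List.getD_cons_zero, List.getD_cons_succ, List.drop_succ_cons, List.drop_zero]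
  rw [A.run_relabel, h2, A.run_mmul hm hD hS hT, h3, matCoeffs_matrixOf]
  rfl

theorem run_matCode (hm : 1 ≤ m) (hD : 1 ≤ D) (hp : ∀ i ∈ I, ∀ k < m, (p i k).degree < len i)
    (hq : ∀ i ∈ J, ∀ k < m, (q i k).degree < len' i) (k : VCode) (st : List (List K)) :
    A.run (matCode m D I J len len' ++ k)
        ((labels I m len).map (coeffAt p) :: (labels J m len').map (coeffAt q) :: st) =
      A.run k (J.flatMap (fun j => I.flatMap fun i =>
        (List.range (chunkCount D (len i))).flatMap fun a =>
          (List.range (chunkCount D (len' j))).flatMap fun b =>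
            polyCoeffs (∑ k ∈ Finset.range m, chunk (p i k) D a * chunk (q j k) D b) (2 * D)) ::
        st) := by
  have h0 : List.replicate 0 (constant A.κ 0) = (rangeProd
      (chunkCount m (chunkList I D len).length)
      (chunkCount m (chunkList J D len').length)).flatMap fun _ => ([] : List K) := by
    simp
  unfold matCode
  rw [List.append_assoc, List.append_assoc, List.cons_append, List.nil_append, A.run_rep, h0]
  have h1 := A.run_mapCode (rangeProd (chunkCount m (chunkList I D len).length)
    (chunkCount m (chunkList J D len').length))
    (ctx := [(labels I m len).map (coeffAt p), (labels J m len').map (coeffAt q)])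
    (len := fun _ => 0) (row := fun _ => []) (q := 2) rfl (by simp)
    (fun xz _ k st => run_blockCode A hm hD hp hq xz.1 xz.2 k [] st)
    ([relabel (blockLabels m D (chunkCount m (chunkList I D len).length)
    (chunkCount m (chunkList J D len').length)) (pairLabels D I J len len')] ++ k) st
  simp only [List.cons_append, List.nil_append] at h1
  simp only [List.cons_append, List.nil_append]
  rw [h1]
  have h2 : ∀ G : ℕ × ℕ × ℕ → K, (rangeProd (chunkCount m (chunkList I D len).length)
      (chunkCount m (chunkList J D len').length)).flatMap (fun xz =>
      (List.range m).flatMap fun y => (List.range m).flatMap fun w =>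
        (List.range (2 * D + 1)).map fun l => G (xz.1 * m + y, xz.2 * m + w, l)) =
      (blockLabels m D (chunkCount m (chunkList I D len).length)
        (chunkCount m (chunkList J D len').length)).map G := by
    intro G
    simp [blockLabels, List.map_flatMap, Function.comp_def]
  rw [h2, A.run_relabel]
  congr 2
  rw [pairLabels, List.map_flatMap]
  refine List.flatMap_congr fun j hj => ?_
  rw [List.map_flatMap]
  refine List.flatMap_congr fun i hi => ?_
  rw [List.map_flatMap]
  refine List.flatMap_congr fun a ha => ?_
  rw [List.map_flatMap]
  refine List.flatMap_congr fun b hb => ?_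
  rw [List.map_map, polyCoeffs]
  refine List.map_congr_left fun l hl => ?_
  have h3 := mem_chunkList.2 ⟨hi, List.mem_range.1 ha⟩
  have h4 := mem_chunkList.2 ⟨hj, List.mem_range.1 hb⟩
  have hl := List.mem_range.1 hl
  rw [Function.comp, lookup_of_mem ((mem_blockLabels hm).2 ⟨(position_lt h3).trans_le
    (le_chunkCount_mul hm _), (position_lt h4).trans_le (le_chunkCount_mul hm _), by omega⟩),
    coeffAt, chunkProd]
  simp only [chunkPoly, position_lt h3, position_lt h4, if_true, getD_position h3,
    getD_position h4]

end Correctness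

theorem sum_map_const {α : Type*} (l : List α) (n : ℕ) : (l.map fun _ => n).sum = l.length * n := by
  simp

theorem Cost.matCode {B m D δ : ℕ} (h1 : 1 ≤ D) (h2 : D ≤ δ) (I J : List ℕ) (len len' : ℕ → ℕ) :
    Cost B m δ (matCode m D I J len len') 0 (chunkCount m (chunkList I D len).length *
      chunkCount m (chunkList J D len').length * D) := by
  refine ((rep _ _).append (Cost.mapCode 2 _ (w := fun _ => 0) (w' := fun _ => D) ?_)).append
    (relabel _ _) |>.mono (by simp) ?_
  · intro xz _
    exact ((wire _ _).cons ((relabel _ _).cons ((wire _ _).cons ((relabel _ _).cons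
      (mmul h1 h2))))).mono (by omega) (by omega)
  · rw [sum_map_const]
    simp [rangeProd]

section Primrec

variable {α : Type*} [Primcodable α]

@[fun_prop] theorem primrec_labels {I : α → List ℕ} {m : α → ℕ} {len : α → ℕ → ℕ}
    (hI : Primrec I) (hm : Primrec m) (hl : Primrec fun p : α × ℕ => len p.1 p.2) :
    Primrec fun x => labels (I x) (m x) (len x) := by unfold labels; fun_prop

@[fun_prop] theorem primrec_chunkCount {D n : α → ℕ} (hD : Primrec D) (hn : Primrec n) :
    Primrec fun x => chunkCount (D x) (n x) := by unfold chunkCount; fun_prop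

@[fun_prop] theorem primrec_chunkList {I : α → List ℕ} {D : α → ℕ} {len : α → ℕ → ℕ}
    (hI : Primrec I) (hD : Primrec D) (hl : Primrec fun p : α × ℕ => len p.1 p.2) :
    Primrec fun x => chunkList (I x) (D x) (len x) := by unfold chunkList; fun_prop

@[fun_prop] theorem primrec_chunkLabel {rl : α → List (ℕ × ℕ)} {m D r k l : α → ℕ}
    (hrl : Primrec rl) (hm : Primrec m) (hD : Primrec D) (hr : Primrec r) (hk : Primrec k)
    (hl : Primrec l) : Primrec fun x => chunkLabel (rl x) (m x) (D x) (r x) (k x) (l x) := by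
  unfold chunkLabel; fun_prop

@[fun_prop] theorem primrec_rangeProd {a b : α → ℕ} (ha : Primrec a) (hb : Primrec b) :
    Primrec fun x => rangeProd (a x) (b x) := by unfold rangeProd; fun_prop

@[fun_prop] theorem primrec_blockCode {m D : α → ℕ} {S T : α → List (ℕ × ℕ × ℕ)}
    {rl cl : α → List (ℕ × ℕ)} {a b : α → ℕ} (hm : Primrec m) (hD : Primrec D) (hS : Primrec S)
    (hT : Primrec T) (hr : Primrec rl) (hc : Primrec cl) (ha : Primrec a) (hb : Primrec b) :
    Primrec fun x => blockCode (m x) (D x) (S x) (T x) (rl x) (cl x) (a x) (b x) := by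
  unfold blockCode; fun_prop

@[fun_prop] theorem primrec_blockLabels {m D a b : α → ℕ} (hm : Primrec m) (hD : Primrec D)
    (ha : Primrec a) (hb : Primrec b) :
    Primrec fun x => blockLabels (m x) (D x) (a x) (b x) := by unfold blockLabels; fun_prop

@[fun_prop] theorem primrec_pairLabels {D : α → ℕ} {I J : α → List ℕ} {len len' : α → ℕ → ℕ}
    (hD : Primrec D) (hI : Primrec I) (hJ : Primrec J)
    (hl : Primrec fun p : α × ℕ => len p.1 p.2) (hl' : Primrec fun p : α × ℕ => len' p.1 p.2) :
    Primrec fun x => pairLabels (D x) (I x) (J x) (len x) (len' x) := by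
  unfold pairLabels; fun_prop

@[fun_prop] theorem primrec_matCode {m D : α → ℕ} {I J : α → List ℕ} {len len' : α → ℕ → ℕ}
    (hm : Primrec m) (hD : Primrec D) (hI : Primrec I) (hJ : Primrec J)
    (hl : Primrec fun p : α × ℕ => len p.1 p.2) (hl' : Primrec fun p : α × ℕ => len' p.1 p.2) :
    Primrec fun x => matCode (m x) (D x) (I x) (J x) (len x) (len' x) := by
  unfold matCode; fun_prop

end Primrec

/-! ### The algorithm -/

/-- The size of the `j`-th block of the `a`-th eigenvalue, or zero if there is no such block. -/
def blockSize (shape : List (List ℕ)) (a j : ℕ) : ℕ := (shape.getD a []).getD j 0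

/-- The sizes of the `j`-th blocks of all eigenvalues. -/
def colSizes (shape : List (List ℕ)) (j : ℕ) : List ℕ :=
  (List.range shape.length).map fun a => blockSize shape a j

/-- The sum of the sizes of the `j`-th blocks. -/
def colSize (shape : List (List ℕ)) (j : ℕ) : ℕ := (colSizes shape j).sum

/-- The number of blocks. -/
def blockCount (shape : List (List ℕ)) : ℕ := (shape.map List.length).sum

/-- The order of the Jordan matrix. -/
def totalSize (shape : List (List ℕ)) : ℕ := (shape.map List.sum).sum

/-- The degree of the matrix products. -/
def averageSize (shape : List (List ℕ)) (m : ℕ) : ℕ := max 1 (totalSize shape / m)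

/-- The number of the group of the columns `j`. -/
def level (shape : List (List ℕ)) (δ j : ℕ) : ℕ :=
  if 1 ≤ colSize shape j then min (Nat.log 2 (colSize shape j)) (Nat.log 2 δ)
  else Nat.log 2 δ + 1

/-- The indices with the given level. -/
def group (shape : List (List ℕ)) (δ g : ℕ) : List ℕ :=
  (List.range (blockCount shape)).filter fun j => level shape δ j = g

/-- The index of the largest blocks of a group. -/
def groupHead (shape : List (List ℕ)) (δ g : ℕ) : ℕ :=
  (group shape δ g).getD 0 (blockCount shape)

/-- The labels (row, eigenvalue, block, position) of the entries of a matrix with `m` rows. -/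
def entryLabels (shape : List (List ℕ)) (m : ℕ) : List (ℕ × ℕ × ℕ × ℕ) :=
  (List.range m).flatMap fun i => (List.range shape.length).flatMap fun a =>
    (List.range (shape.getD a []).length).flatMap fun j =>
      (List.range (blockSize shape a j)).map fun l => (i, a, j, l)

/-- The labels of the entries in the blocks with numbers in `J`, sorted by these numbers. -/
def colLabels (shape : List (List ℕ)) (m : ℕ) (J : List ℕ) : List (ℕ × ℕ × ℕ × ℕ) :=
  J.flatMap fun j => (List.range m).flatMap fun i => (List.range shape.length).flatMap fun a =>
    (List.range (blockSize shape a j)).map fun l => (i, a, j, l)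

/-- The interpolation of all entries. -/
def colPolyCode (shape : List (List ℕ)) (m : ℕ) : VCode :=
  mapCode 2 (List.range (blockCount shape)) (fun j => m * colSize shape j) fun j =>
    [wire 3 [1, 0, 1, 2]] ++ pointTreeCode (colSizes shape j) ++ [wire 4 [3, 0, 1, 0, 2]] ++
      weightsCode (colSizes shape j) ++ [wire 2 [1, 0]] ++
      mapCode 3 (List.range m) (fun _ => colSize shape j) (fun _ => interpCode (colSizes shape j))

/-- Reduction of the entries of a matrix of order `m` modulo a polynomial of degree `n`. -/
def reduceCode (m n : ℕ) (len : ℕ → ℕ) : VCode :=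
  mapCode 1 (rangeProd m m) (fun ik => len ik.1) fun ik =>
    (if n < len ik.1 then rootRemCode n (len ik.1) else []) ++ [wire 2 [0]]

/-- Compute the expansions of the entries of a product, given the products of all chunks. -/
def expandCode (shape : List (List ℕ)) (m D : ℕ) (J : List ℕ) (len : ℕ → ℕ) : VCode :=
  mapCode 2 J (fun j => ((List.range m).map fun i =>
      chunkCount D (len i) * (chunkCount D (colSize shape j) * (2 * D))).sum) fun j =>
    [wire 2 [1, 0]] ++ pointTreeCode (colSizes shape j) ++ [wire 3 [1, 0, 2]] ++
      mapCode 2 (List.range m)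
        (fun i => chunkCount D (len i) * (chunkCount D (colSize shape j) * (2 * D))) fun i =>
          entryCode D (chunkCount D (len i)) (chunkCount D (colSize shape j)) ++
            expansionCode (colSizes shape j)
              ((chunkCount D (len i) + chunkCount D (colSize shape j)) * D)

/-- The computation for one group of columns. -/
def groupCode (shape : List (List ℕ)) (m δ : ℕ) (len : ℕ → ℕ) (g : ℕ) : VCode :=
  [wire 5 [2, 4, 1, 2, 3]] ++ pointTreeCode (colSizes shape (groupHead shape δ g)) ++
    [wire 2 [1, 0]] ++ reduceCode m (colSize shape (groupHead shape δ g)) len ++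
    [wire 2 [1, 0], relabel (labels (List.range (blockCount shape)) m (colSize shape))
      (labels (group shape δ g) m (colSize shape)), wire 2 [1, 0]] ++
    matCode m (2 ^ g) (List.range m) (group shape δ g)
      (fun i => min (len i) (colSize shape (groupHead shape δ g))) (colSize shape) ++
    expandCode shape m (2 ^ g) (group shape δ g)
      (fun i => min (len i) (colSize shape (groupHead shape δ g)))

/-- The computation of a residual. -/
def residualCode (shape : List (List ℕ)) (m : ℕ) (len : ℕ → ℕ) : VCode :=
  cut shape.length ++ cut (labels (List.range m) m len).length ++
    [wire 3 [2, 0, 2, 1], rep 0 shape.length, vsub shape.length, wire 2 [1, 0],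
      relabel (entryLabels shape m) (colLabels shape m (List.range (blockCount shape))),
      wire 3 [0, 1, 2, 1, 2]] ++
    colPolyCode shape m ++ [rep 0 0] ++
    mapCode 4 (List.range (Nat.log 2 (averageSize shape m) + 1)) (fun _ => 0)
      (groupCode shape m (averageSize shape m) len) ++
    [relabel ((List.range (Nat.log 2 (averageSize shape m) + 1)).flatMap fun g =>
      colLabels shape m (group shape (averageSize shape m) g)) (entryLabels shape m)]

section Correctness

variable {K : Type*} [Field K] (A : Arith K)

/-- The coefficient with the given label. -/
noncomputable def entryCoeff (e : ℕ → ℕ → ℕ → K[X]) (y : ℕ × ℕ × ℕ × ℕ) : K :=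
  (e y.1 y.2.1 y.2.2.1).coeff y.2.2.2

theorem map_colLabels (e : ℕ → ℕ → ℕ → K[X]) (shape : List (List ℕ)) (m : ℕ) (J : List ℕ) :
    (colLabels shape m J).map (entryCoeff e) = J.flatMap fun j => (List.range m).flatMap fun i =>
      (List.range shape.length).flatMap fun a => polyCoeffs (e i a j) (blockSize shape a j) := by
  simp [colLabels, List.map_flatMap, polyCoeffs, Function.comp_def, entryCoeff]

/-- The polynomial that represents the `j`-th blocks of the row `k`. -/
noncomputable def colPoly (shape : List (List ℕ)) (x : ℕ → K) (e : ℕ → ℕ → ℕ → K[X]) (j k : ℕ) :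
    K[X] := interpPoly x (fun a => blockSize shape a j) shape.length (fun a => e k a j)

variable {shape : List (List ℕ)} {x : ℕ → K} {m : ℕ}

theorem run_colPolyCode (hx : ∀ i < shape.length, ∀ j < shape.length, x j = x i → j = i)
    (e : ℕ → ℕ → ℕ → K[X]) (k : VCode) (st : List (List K)) :
    A.run (colPolyCode shape m ++ k)
        ((colLabels shape m (List.range (blockCount shape))).map (entryCoeff e) ::
          (List.range shape.length).map (fun i => -x i) ::
          (List.range shape.length).map x :: st) =
      A.run k ((labels (List.range (blockCount shape)) m (colSize shape)).map
        (coeffAt (colPoly shape x e)) :: st) := by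
  rw [map_colLabels, map_coeffAt_labels, colPolyCode]
  refine A.run_mapCode _ (ctx := [(List.range shape.length).map (fun i => -x i),
    (List.range shape.length).map x]) rfl ?_ ?_ k st
  · intro j _
    simp [List.length_flatMap, colSize, colSizes]
  · intro j _ k st
    simp only [List.append_assoc, List.cons_append, List.nil_append, A.run_wire, List.map_cons,
      List.map_nil, List.getD_cons_zero, List.getD_cons_succ, List.drop_succ_cons, List.drop_zero]
    rw [colSizes, run_pointTreeCode]
    simp only [List.cons_append, List.nil_append, A.run_wire, List.map_cons,
      List.map_nil, List.getD_cons_zero, List.getD_cons_succ, List.drop_succ_cons, List.drop_zero]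
    rw [run_weightsCode A _ hx]
    simp only [List.cons_append, List.nil_append, A.run_wire, List.map_cons,
      List.map_nil, List.getD_cons_zero, List.getD_cons_succ, List.drop_succ_cons, List.drop_zero]
    refine A.run_mapCode _ (ctx := [_, _, _]) rfl ?_ ?_ k st
    · intro i _
      simp [List.length_flatMap, colSize, colSizes]
    · intro i _ k st
      exact run_interpCode A _ _ k st

theorem flatMap_rangeProd {α : Type*} (a b : ℕ) (f : ℕ → ℕ → List α) :
    ((rangeProd a b).flatMap fun p => f p.1 p.2) =
      (List.range a).flatMap fun i => (List.range b).flatMap fun j => f i j := by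
  simp [rangeProd, List.flatMap_assoc, List.flatMap_map]

/-- Reduction modulo `F` if there are more than `n` coefficients. -/
noncomputable def reduced (F : K[X]) (n : ℕ) (len : ℕ → ℕ) (p : ℕ → ℕ → K[X]) (i k : ℕ) : K[X] :=
  if n < len i then p i k %ₘ F else p i k

theorem run_reduceCode {l : List K[X]} (hl : ∀ F ∈ l, F.Monic) {n : ℕ} (hn : l.prod.natDegree = n)
    {p : ℕ → ℕ → K[X]} {len : ℕ → ℕ} (hp : ∀ i < m, ∀ k < m, (p i k).degree < len i) (k : VCode)
    (st : List (List K)) :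
    A.run (reduceCode m n len ++ k)
        ((labels (List.range m) m len).map (coeffAt p) :: treeVec l :: st) =
      A.run k ((labels (List.range m) m fun i => min (len i) n).map
        (coeffAt (reduced l.prod n len p)) :: st) := by
  rw [map_coeffAt_labels, map_coeffAt_labels, ← flatMap_rangeProd m m, ← flatMap_rangeProd m m,
    reduceCode]
  refine A.run_mapCode _ (ctx := [treeVec l]) rfl (by simp) ?_ k st
  intro ik hik k st
  have h := mem_rangeProd.1 hik
  unfold reduced
  split_ifs with h1
  · subst hn
    rw [min_eq_right h1.le]
    rw [List.append_assoc]
    refine (A.run_rootRemCode hl (hp _ h.1 _ h.2) _ st).trans ?_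
    simp
  · rw [min_eq_left (by omega)]
    simp

theorem degree_reduced_lt {F : K[X]} (hF : F.Monic) {n : ℕ} (hn : F.natDegree = n)
    {p : ℕ → ℕ → K[X]} {len : ℕ → ℕ} {i k : ℕ} (hp : (p i k).degree < len i) :
    (reduced F n len p i k).degree < (min (len i) n : ℕ) := by
  unfold reduced
  split_ifs with h
  · rw [min_eq_right h.le, ← hn]
    exact degree_modByMonic_lt_natDegree hF _
  · rwa [min_eq_left (by omega)]

theorem dvd_reduced_sub (F : K[X]) (n : ℕ) (p : ℕ → ℕ → K[X]) (len : ℕ → ℕ) (i k : ℕ) :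
    F ∣ reduced F n len p i k - p i k := by
  unfold reduced
  split_ifs with h
  · exact dvd_modByMonic_sub _ _
  · simp

theorem run_expandCode {D : ℕ} (hD : 1 ≤ D) {J : List ℕ} {p q : ℕ → ℕ → K[X]} {len : ℕ → ℕ}
    (hp : ∀ i < m, ∀ k < m, (p i k).degree < len i)
    (hq : ∀ j ∈ J, ∀ k < m, (q j k).degree < colSize shape j)
    (k : VCode) (st : List (List K)) :
    A.run (expandCode shape m D J len ++ k)
        (J.flatMap (fun j => (List.range m).flatMap fun i =>
          (List.range (chunkCount D (len i))).flatMap fun a =>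
            (List.range (chunkCount D (colSize shape j))).flatMap fun b =>
              polyCoeffs (∑ k ∈ Finset.range m, chunk (p i k) D a * chunk (q j k) D b) (2 * D)) ::
          (List.range shape.length).map (fun i => -x i) ::
          (List.range shape.length).map x :: st) =
      A.run k ((colLabels shape m J).map (entryCoeff fun i a j =>
        (∑ k ∈ Finset.range m, p i k * q j k).comp (X + C (x a))) :: st) := by
  rw [map_colLabels, expandCode]
  refine A.run_mapCode _ (ctx := [(List.range shape.length).map (fun i => -x i),
    (List.range shape.length).map x]) rfl ?_ ?_ k st
  · intro j _
    simp [List.length_flatMap]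
  · intro j hj k st
    simp only [List.append_assoc, List.cons_append, List.nil_append, A.run_wire, List.map_cons,
      List.map_nil, List.getD_cons_zero, List.getD_cons_succ, List.drop_succ_cons, List.drop_zero]
    conv_lhs => rw [colSizes, run_pointTreeCode]
    simp only [List.cons_append, List.nil_append, A.run_wire, List.map_cons,
      List.map_nil, List.getD_cons_zero, List.getD_cons_succ, List.drop_succ_cons, List.drop_zero]
    refine A.run_mapCode _ (ctx := [_, _]) rfl ?_ ?_ k st
    · intro i _
      simp [List.length_flatMap]
    · intro i hi k st
      have hi := List.mem_range.1 hi
      have hc : ∀ a b, (∑ k ∈ Finset.range m, chunk (p i k) D a * chunk (q j k) D b).degree <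
          (2 * D : ℕ) := by
        intro a b
        refine (degree_lt_iff_coeff_zero _ _).2 fun n hn => ?_
        rw [finsetSum_coeff]
        refine Finset.sum_eq_zero fun k _ => (degree_lt_iff_coeff_zero _ _).1 ?_ n hn
        refine degree_mul_lt (a := D) (b := D) (degree_chunk_lt _ _ _) ?_ (by omega)
        exact (degree_chunk_lt _ _ _).trans (by exact_mod_cast Nat.lt_succ_self D)
      have hs : ∑ a ∈ Finset.range (chunkCount D (len i)), X ^ (D * a) *
          ∑ b ∈ Finset.range (chunkCount D (colSize shape j)), X ^ (D * b) *
            ∑ k ∈ Finset.range m, chunk (p i k) D a * chunk (q j k) D b =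
          ∑ k ∈ Finset.range m, p i k * q j k := by
        have h1 : ∀ k ∈ Finset.range m, p i k * q j k =
            ∑ a ∈ Finset.range (chunkCount D (len i)),
              ∑ b ∈ Finset.range (chunkCount D (colSize shape j)),
                X ^ (D * a) * (X ^ (D * b) * (chunk (p i k) D a * chunk (q j k) D b)) := by
          intro k hk
          have hk := Finset.mem_range.1 hk
          have h2 : (p i k).degree < (chunkCount D (len i) * D : ℕ) :=
            (hp i hi k hk).trans_le (by exact_mod_cast le_chunkCount_mul hD _)
          have h3 : (q j k).degree < (chunkCount D (colSize shape j) * D : ℕ) :=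
            (hq j hj k hk).trans_le (by exact_mod_cast le_chunkCount_mul hD _)
          conv_lhs => rw [← sum_chunk hD h2, ← sum_chunk hD h3, Finset.sum_mul_sum]
          refine Finset.sum_congr rfl fun a _ => Finset.sum_congr rfl fun b _ => ?_
          ring
        rw [Finset.sum_congr rfl h1, Finset.sum_comm]
        refine Finset.sum_congr rfl fun a _ => ?_
        rw [Finset.mul_sum, Finset.sum_comm]
        refine Finset.sum_congr rfl fun b _ => ?_
        rw [Finset.mul_sum, Finset.mul_sum]
      rw [List.append_assoc, run_entryCode A _ (fun a _ b _ => hc a b), hs]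
      refine run_expansionCode A x _ _ ?_ k st
      refine (degree_lt_iff_coeff_zero _ _).2 fun n hn => ?_
      rw [finsetSum_coeff]
      refine Finset.sum_eq_zero fun k hk => (degree_lt_iff_coeff_zero _ _).1 ?_ n hn
      have hk := Finset.mem_range.1 hk
      have h2 : (p i k).degree < (chunkCount D (len i) * D : ℕ) :=
        (hp i hi k hk).trans_le (by exact_mod_cast le_chunkCount_mul hD _)
      have h3 : (q j k).degree < (chunkCount D (colSize shape j) * D : ℕ) :=
        (hq j hj k hk).trans_le (by exact_mod_cast le_chunkCount_mul hD _)
      exact degree_mul_lt h2 (h3.trans (by exact_mod_cast Nat.lt_succ_self _)) (by ring)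

/-- The sizes of the blocks of every eigenvalue are descending. -/
def Descending (shape : List (List ℕ)) : Prop :=
  ∀ a i j, i ≤ j → blockSize shape a j ≤ blockSize shape a i

theorem groupHead_le {δ g j : ℕ} (hj : j ∈ group shape δ g) : groupHead shape δ g ≤ j := by
  have h : (group shape δ g).Pairwise (· < ·) :=
    List.Pairwise.filter _ List.pairwise_lt_range
  unfold groupHead
  rcases hG : group shape δ g with _ | ⟨b, l⟩
  · rw [hG] at hj
    simp at hj
  · rw [hG] at hj h
    simp only [List.getD_cons_zero]
    rcases List.mem_cons.1 hj with rfl | hj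
    · exact le_rfl
    · exact ((List.pairwise_cons.1 h).1 j hj).le

/-- The expansions of the products of the entries. -/
noncomputable def productAt (m : ℕ) (x : ℕ → K) (p : ℕ → ℕ → K[X]) (e : ℕ → ℕ → ℕ → K[X])
    (i a j : ℕ) : K[X] :=
  ∑ k ∈ Finset.range m, (p i k).comp (X + C (x a)) * e k a j

theorem run_groupCode (hs : Descending shape) (hm : 1 ≤ m)
    (hx : ∀ i < shape.length, ∀ j < shape.length, x j = x i → j = i)
    {p : ℕ → ℕ → K[X]} {len : ℕ → ℕ} (hp : ∀ i < m, ∀ k < m, (p i k).degree < len i)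
    (e : ℕ → ℕ → ℕ → K[X]) (δ g : ℕ) (k : VCode) (u : List K) (st : List (List K)) :
    A.run (groupCode shape m δ len g ++ k) (u ::
        (labels (List.range (blockCount shape)) m (colSize shape)).map
          (coeffAt (colPoly shape x e)) ::
        (List.range shape.length).map (fun i => -x i) :: (List.range shape.length).map x ::
        (labels (List.range m) m len).map (coeffAt p) :: st) =
      A.run k ((colLabels shape m (group shape δ g)).map (entryCoeff (productAt m x p e)) ::
        st) := by
  have hD : 1 ≤ 2 ^ g := Nat.one_le_two_pow
  set h := groupHead shape δ g with hh
  set l := powers x (fun a => blockSize shape a h) shape.length with hl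
  have hmon : l.prod.Monic := monic_list_prod (powers_monic _ _ _)
  have hn : l.prod.natDegree = colSize shape h := natDegree_prod_powers _ _ _
  have hq : ∀ j ∈ group shape δ g, ∀ k < m,
      (colPoly shape x e j k).degree < colSize shape j :=
    fun j _ k _ => degree_interpPoly_lt _ _ _ _
  have hp' : ∀ i < m, ∀ k < m,
      (reduced l.prod (colSize shape h) len p i k).degree < (min (len i) (colSize shape h) : ℕ) :=
    fun i hi k hk => degree_reduced_lt hmon hn (hp i hi k hk)
  have hlab : (labels (group shape δ g) m (colSize shape)).map
      (lookup (labels (List.range (blockCount shape)) m (colSize shape))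
        (coeffAt (colPoly shape x e))) =
      (labels (group shape δ g) m (colSize shape)).map (coeffAt (colPoly shape x e)) := by
    refine List.map_congr_left fun y hy => lookup_of_mem ?_
    obtain ⟨j, k, c⟩ := y
    have h1 := mem_labels.1 hy
    exact mem_labels.2 ⟨List.mem_of_mem_filter h1.1, h1.2⟩
  unfold groupCode
  simp only [List.append_assoc, List.cons_append, List.nil_append, A.run_wire, List.map_cons,
    List.map_nil, List.getD_cons_zero, List.getD_cons_succ, List.drop_succ_cons, List.drop_zero]
  rw [colSizes, run_pointTreeCode]
  simp only [List.cons_append, List.nil_append, A.run_wire, List.map_cons,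
    List.map_nil, List.getD_cons_zero, List.getD_cons_succ, List.drop_succ_cons, List.drop_zero]
  rw [run_reduceCode A (powers_monic _ _ _) hn hp]
  simp only [List.cons_append, List.nil_append, A.run_wire, List.map_cons,
    List.map_nil, List.getD_cons_zero, List.getD_cons_succ, List.drop_succ_cons, List.drop_zero]
  rw [A.run_relabel, hlab]
  simp only [List.cons_append, List.nil_append, A.run_wire, List.map_cons,
    List.map_nil, List.getD_cons_zero, List.getD_cons_succ, List.drop_succ_cons, List.drop_zero]
  rw [run_matCode A hm hD (fun i hi => hp' i (List.mem_range.1 hi)) hq,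
    run_expandCode A hD hp' hq, map_colLabels, map_colLabels]
  congr 2
  refine List.flatMap_congr fun j hj => List.flatMap_congr fun i hi =>
    List.flatMap_congr fun a ha => polyCoeffs_congr_dvd ?_
  have ha : a < shape.length := List.mem_range.1 ha
  rw [productAt, ← coe_compRingHom_apply, map_sum, ← Finset.sum_sub_distrib]
  refine Finset.dvd_sum fun k _ => ?_
  rw [coe_compRingHom_apply, mul_comp]
  have h1 : X ^ blockSize shape a j ∣
      (reduced l.prod (colSize shape h) len p i k - p i k).comp (X + C (x a)) := by
    refine (pow_dvd_pow X (hs a _ _ (groupHead_le hj))).trans ?_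
    rw [← powerAt_comp (x a)]
    refine comp_dvd (Dvd.dvd.trans ?_ (dvd_reduced_sub _ _ _ _ _ _))
    exact List.dvd_prod (List.mem_map.2 ⟨a, List.mem_range.2 ha, rfl⟩)
  have h2 : X ^ blockSize shape a j ∣ (colPoly shape x e j k).comp (X + C (x a)) - e k a j :=
    interpPoly_comp _ ha (hx a ha) _
  rw [sub_comp] at h1
  convert dvd_add (h1.mul_right ((colPoly shape x e j k).comp (X + C (x a))))
    (h2.mul_left ((p i k).comp (X + C (x a)))) using 1
  ring

theorem blockSize_eq_zero {a j : ℕ} (h : (shape.getD a []).length ≤ j) :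
    blockSize shape a j = 0 := by
  rw [blockSize, List.getD_eq_default _ _ h]

theorem mem_colLabels {J : List ℕ} {i a j l : ℕ} : (i, a, j, l) ∈ colLabels shape m J ↔
    j ∈ J ∧ i < m ∧ a < shape.length ∧ l < blockSize shape a j := by
  simp [colLabels]

theorem mem_entryLabels {i a j l : ℕ} : (i, a, j, l) ∈ entryLabels shape m ↔
    i < m ∧ a < shape.length ∧ l < blockSize shape a j := by
  have : l < blockSize shape a j → j < (shape.getD a []).length := by
    intro h
    by_contra h1
    rw [blockSize_eq_zero (by omega)] at h
    omega
  simp only [entryLabels, List.mem_flatMap, List.mem_map, List.mem_range, Prod.mk.injEq]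
  constructor
  · rintro ⟨i, hi, a, ha, j, hj, l, hl, rfl, rfl, rfl, rfl⟩
    exact ⟨hi, ha, hl⟩
  · rintro ⟨hi, ha, hl⟩
    exact ⟨i, hi, a, ha, j, this hl, l, hl, rfl, rfl, rfl, rfl⟩

theorem lt_blockCount {a j : ℕ} (h : 1 ≤ blockSize shape a j) : j < blockCount shape := by
  by_contra h1
  rw [blockSize_eq_zero] at h
  · omega
  · refine le_trans ?_ (not_lt.1 h1)
    rcases lt_or_ge a shape.length with ha | ha
    · rw [List.getD_eq_getElem _ _ ha]
      exact List.single_le_sum (by simp) _ (List.mem_map_of_mem (List.getElem_mem ha))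
    · rw [List.getD_eq_default _ _ ha]
      exact Nat.zero_le _

theorem blockSize_le_colSize {a : ℕ} (ha : a < shape.length) (j : ℕ) :
    blockSize shape a j ≤ colSize shape j :=
  List.single_le_sum (by simp) _ (List.mem_map.2 ⟨a, List.mem_range.2 ha, rfl⟩)

theorem run_residualCode (hs : Descending shape) (hm : 1 ≤ m)
    (hx : ∀ i < shape.length, ∀ j < shape.length, x j = x i → j = i)
    {p : ℕ → ℕ → K[X]} {len : ℕ → ℕ} (hp : ∀ i < m, ∀ k < m, (p i k).degree < len i)
    (e : ℕ → ℕ → ℕ → K[X]) :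
    A.run (residualCode shape m len) [(List.range shape.length).map x ++
        ((labels (List.range m) m len).map (coeffAt p) ++
          (entryLabels shape m).map (entryCoeff e))] =
      some [(entryLabels shape m).map (entryCoeff (productAt m x p e))] := by
  have h1 : (colLabels shape m (List.range (blockCount shape))).map
      (lookup (entryLabels shape m) (entryCoeff e)) =
      (colLabels shape m (List.range (blockCount shape))).map (entryCoeff e) := by
    refine List.map_congr_left fun y hy => lookup_of_mem ?_
    obtain ⟨i, a, j, l⟩ := y
    exact mem_entryLabels.2 (mem_colLabels.1 hy).2
  have h2 : (entryLabels shape m).map (lookup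
      ((List.range (Nat.log 2 (averageSize shape m) + 1)).flatMap fun g =>
        colLabels shape m (group shape (averageSize shape m) g))
        (entryCoeff (productAt m x p e))) =
      (entryLabels shape m).map (entryCoeff (productAt m x p e)) := by
    refine List.map_congr_left fun y hy => lookup_of_mem ?_
    obtain ⟨i, a, j, l⟩ := y
    obtain ⟨hi, ha, hl⟩ := mem_entryLabels.1 hy
    have h3 : 1 ≤ blockSize shape a j := by omega
    have h4 := h3.trans (blockSize_le_colSize ha j)
    refine List.mem_flatMap.2 ⟨level shape (averageSize shape m) j, ?_, mem_colLabels.2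
      ⟨List.mem_filter.2 ⟨List.mem_range.2 (lt_blockCount h3), by simp⟩, hi, ha, hl⟩⟩
    rw [List.mem_range, level, if_pos h4]
    omega
  have h3 : List.zipWith (· - ·) (List.replicate shape.length (constant A.κ 0))
      ((List.range shape.length).map x) = (List.range shape.length).map fun i => -x i := by
    refine List.ext_getElem (by simp) fun i h1 h2 => ?_
    simp [constant]
  have h4 : List.replicate 0 (constant A.κ 0) =
      (List.range (Nat.log 2 (averageSize shape m) + 1)).flatMap fun _ => ([] : List K) := by
    simp
  unfold residualCode
  simp only [List.append_assoc]
  rw [A.run_cut (by simp), A.run_cut (by simp)]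
  simp only [List.cons_append, List.nil_append, A.run_wire, List.map_cons,
    List.map_nil, List.getD_cons_zero, List.getD_cons_succ, List.drop_succ_cons, List.drop_zero,
    A.run_rep]
  rw [A.run_vsub (by simp) (by simp), h3]
  simp only [List.cons_append, List.nil_append, A.run_wire, List.map_cons,
    List.map_nil, List.getD_cons_zero, List.getD_cons_succ, List.drop_succ_cons, List.drop_zero]
  rw [A.run_relabel, h1]
  simp only [List.cons_append, List.nil_append, A.run_wire, List.map_cons,
    List.map_nil, List.getD_cons_zero, List.getD_cons_succ, List.drop_succ_cons, List.drop_zero]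
  rw [run_colPolyCode A hx, A.run_rep, h4]
  have h5 := A.run_mapCode (List.range (Nat.log 2 (averageSize shape m) + 1)) (q := 4)
    (ctx := [_, _, _, _]) (len := fun _ => 0) (row := fun _ => []) rfl (by simp)
    (fun g _ k st => run_groupCode A hs hm hx hp e (averageSize shape m) g k [] st)
    [relabel ((List.range (Nat.log 2 (averageSize shape m) + 1)).flatMap fun g =>
      colLabels shape m (group shape (averageSize shape m) g)) (entryLabels shape m)] []
  simp only [List.cons_append, List.nil_append] at h5
  rw [h5, ← List.map_flatMap, A.run_relabel, h2, A.run_nil]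

end Correctness

section Primrec

variable {α : Type*} [Primcodable α] {s : α → List (List ℕ)}

@[fun_prop] theorem primrec_blockSize {a b : α → ℕ} (hs : Primrec s) (ha : Primrec a)
    (hb : Primrec b) : Primrec fun y => blockSize (s y) (a y) (b y) := by
  unfold blockSize; fun_prop

@[fun_prop] theorem primrec_colSizes {a : α → ℕ} (hs : Primrec s) (ha : Primrec a) :
    Primrec fun y => colSizes (s y) (a y) := by unfold colSizes; fun_prop

@[fun_prop] theorem primrec_colSize {a : α → ℕ} (hs : Primrec s) (ha : Primrec a) :
    Primrec fun y => colSize (s y) (a y) := by unfold colSize; fun_prop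

@[fun_prop] theorem primrec_blockCount (hs : Primrec s) :
    Primrec fun y => blockCount (s y) := by unfold blockCount; fun_prop

@[fun_prop] theorem primrec_averageSize {m : α → ℕ} (hs : Primrec s) (hm : Primrec m) :
    Primrec fun y => averageSize (s y) (m y) := by unfold averageSize totalSize; fun_prop

@[fun_prop] theorem primrec_level {a b : α → ℕ} (hs : Primrec s) (ha : Primrec a)
    (hb : Primrec b) : Primrec fun y => level (s y) (a y) (b y) := by unfold level; fun_prop

@[fun_prop] theorem primrec_group {a b : α → ℕ} (hs : Primrec s) (ha : Primrec a)
    (hb : Primrec b) : Primrec fun y => group (s y) (a y) (b y) := by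
  unfold group
  have hr : Primrec fun y => List.range (blockCount (s y)) := by fun_prop
  refine primrec_filter (p := fun y j => level (s y) (a y) j = b y) hr ?_
  fun_prop

@[fun_prop] theorem primrec_groupHead {a b : α → ℕ} (hs : Primrec s) (ha : Primrec a)
    (hb : Primrec b) : Primrec fun y => groupHead (s y) (a y) (b y) := by
  unfold groupHead; fun_prop

@[fun_prop] theorem primrec_entryLabels {m : α → ℕ} (hs : Primrec s) (hm : Primrec m) :
    Primrec fun y => entryLabels (s y) (m y) := by unfold entryLabels; fun_prop

@[fun_prop] theorem primrec_colLabels {m : α → ℕ} {J : α → List ℕ} (hs : Primrec s)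
    (hm : Primrec m) (hJ : Primrec J) :
    Primrec fun y => colLabels (s y) (m y) (J y) := by unfold colLabels; fun_prop

@[fun_prop] theorem primrec_colPolyCode {m : α → ℕ} (hs : Primrec s) (hm : Primrec m) :
    Primrec fun y => colPolyCode (s y) (m y) := by unfold colPolyCode; fun_prop

@[fun_prop] theorem primrec_reduceCode {m n : α → ℕ} {len : α → ℕ → ℕ} (hm : Primrec m)
    (hn : Primrec n) (hl : Primrec fun p : α × ℕ => len p.1 p.2) :
    Primrec fun y => reduceCode (m y) (n y) (len y) := by unfold reduceCode; fun_prop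

@[fun_prop] theorem primrec_expandCode {m D : α → ℕ} {J : α → List ℕ} {len : α → ℕ → ℕ}
    (hs : Primrec s) (hm : Primrec m) (hD : Primrec D) (hJ : Primrec J)
    (hl : Primrec fun p : α × ℕ => len p.1 p.2) :
    Primrec fun y => expandCode (s y) (m y) (D y) (J y) (len y) := by unfold expandCode; fun_prop

@[fun_prop] theorem primrec_groupCode {m δ g : α → ℕ} {len : α → ℕ → ℕ}
    (hs : Primrec s) (hm : Primrec m) (hδ : Primrec δ)
    (hl : Primrec fun p : α × ℕ => len p.1 p.2) (hg : Primrec g) :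
    Primrec fun y => groupCode (s y) (m y) (δ y) (len y) (g y) := by unfold groupCode; fun_prop

@[fun_prop] theorem primrec_residualCode {m : α → ℕ} {len : α → ℕ → ℕ}
    (hs : Primrec s) (hm : Primrec m) (hl : Primrec fun p : α × ℕ => len p.1 p.2) :
    Primrec fun y => residualCode (s y) (m y) (len y) := by unfold residualCode; fun_prop

end Primrec

/-! ### The cost of the algorithm -/

theorem sum_map_range (f : ℕ → ℕ) (n : ℕ) :
    ((List.range n).map f).sum = ∑ i ∈ Finset.range n, f i := by
  induction n with
  | zero => simp
  | succ n ih => simp [List.range_succ, Finset.sum_range_succ, ih]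

theorem sum_map_le_sum_map {α : Type*} {l : List α} {f g : α → ℕ} (h : ∀ a ∈ l, f a ≤ g a) :
    (l.map f).sum ≤ (l.map g).sum := List.sum_le_sum h

theorem colSizes_eq_map (shape : List (List ℕ)) (j : ℕ) :
    colSizes shape j = shape.map fun l => l.getD j 0 := by
  refine List.ext_getElem (by simp [colSizes]) fun i h1 h2 => ?_
  have h3 : i < shape.length := by simpa using h2
  simp only [colSizes, blockSize, List.getElem_map, List.getElem_range,
    List.getD_eq_getElem shape [] h3]

theorem colSize_le_totalSize (shape : List (List ℕ)) (j : ℕ) :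
    colSize shape j ≤ totalSize shape := by
  rw [colSize, colSizes_eq_map]
  exact sum_map_le_sum_map fun l _ => getD_le_sum l j

theorem sum_getD_le (l : List ℕ) (r : ℕ) :
    ((List.range r).map fun j => l.getD j 0).sum ≤ l.sum := by
  induction l generalizing r with
  | nil => simp
  | cons a l ih =>
    cases r with
    | zero => simp
    | succ r =>
      rw [List.range_succ_eq_map, List.map_cons, List.map_map, List.sum_cons, List.sum_cons]
      exact Nat.add_le_add (by simp) (ih r)

theorem sum_colSize_le (shape : List (List ℕ)) (r : ℕ) :
    ((List.range r).map (colSize shape)).sum ≤ totalSize shape := by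
  have h : colSize shape = fun j => (shape.map fun l => l.getD j 0).sum :=
    funext fun j => by rw [colSize, colSizes_eq_map]
  rw [h, totalSize]
  clear h
  induction shape with
  | nil => simp
  | cons l shape ih =>
    simp only [List.map_cons, List.sum_cons, List.sum_map_add]
    exact Nat.add_le_add (sum_getD_le l r) ih

theorem sum_flatMap {α : Type*} (l : List α) (f : α → List ℕ) :
    (l.flatMap f).sum = (l.map fun a => (f a).sum).sum := by
  induction l with
  | nil => rfl
  | cons a l ih => simp [ih]

theorem sum_filter_le {α : Type*} (l : List α) (f n : α → ℕ) (N : ℕ) :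
    ((List.range N).map fun g => ((l.filter fun j => f j = g).map n).sum).sum ≤
      (l.map n).sum := by
  induction l with
  | nil => simp
  | cons a l ih =>
    have h : ∀ g, (((a :: l).filter fun j => f j = g).map n).sum =
        (if f a = g then n a else 0) + ((l.filter fun j => f j = g).map n).sum := by
      intro g
      by_cases h : f a = g <;> simp [h]
    simp only [h, List.sum_map_add, List.map_cons, List.sum_cons]
    refine Nat.add_le_add ?_ ih
    rw [sum_map_range]
    simp only [Finset.sum_ite_eq]
    split_ifs <;> omega

theorem chunkCount_mul_le (D n : ℕ) : chunkCount D n * D ≤ n + D - 1 :=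
  Nat.div_mul_le_self _ _

theorem length_chunkList (I : List ℕ) (D : ℕ) (len : ℕ → ℕ) :
    (chunkList I D len).length = (I.map fun i => chunkCount D (len i)).sum := by
  simp [chunkList, List.length_flatMap]

namespace Cost

variable {B m δ : ℕ} {shape : List (List ℕ)} {h : ℕ}

theorem colPolyCode (hm : 1 ≤ m) (hB : totalSize shape ≤ B) (hh : totalSize shape ≤ 2 ^ h)
    (ht : shape.length ≤ 2 ^ h) :
    Cost B m δ (colPolyCode shape m) (34 * m * (h + 1) * totalSize shape) 0 := by
  refine (mapCode 2 _ (w := fun j => 34 * m * (h + 1) * colSize shape j) (w' := fun _ => 0)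
    fun j _ => ?_).mono ?_ (by simp)
  · have h1 : (colSizes shape j).sum ≤ totalSize shape := colSize_le_totalSize shape j
    have h2 : (colSizes shape j).length ≤ 2 ^ h := by simpa [colSizes] using ht
    refine ((wire _ _).append (pointTreeCode (h1.trans hB) (h1.trans hh) h2)).append (wire _ _)
      |>.append (weightsCode (h1.trans hB) (h1.trans hh) h2) |>.append (wire _ _)
      |>.append (mapCode 3 _ fun _ _ => interpCode (h1.trans hB) (h1.trans hh) h2)
      |>.mono ?_ (by simp)
    rw [sum_map_const, List.length_range]
    change 0 + 16 * colSize shape j * (h + 1) + 0 + 12 * colSize shape j * (h + 1) + 0 +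
      m * (6 * colSize shape j * (h + 1)) ≤ _
    have h3 : 28 * (colSize shape j * (h + 1)) ≤ 28 * (m * (colSize shape j * (h + 1))) :=
      Nat.mul_le_mul_left _ (Nat.le_mul_of_pos_left _ hm)
    calc _ = 28 * (colSize shape j * (h + 1)) + 6 * (m * (colSize shape j * (h + 1))) := by ring
      _ ≤ 34 * (m * (colSize shape j * (h + 1))) := by omega
      _ = _ := by ring
  · rw [List.sum_map_mul_left]
    exact Nat.mul_le_mul_left _ (sum_colSize_le _ _)

theorem reduceCode {n : ℕ} (hn : n ≤ B) (len : ℕ → ℕ) :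
    Cost B m δ (reduceCode m n len) (3 * m * ∑ i ∈ Finset.range m, len i) 0 := by
  refine (mapCode 1 _ (w := fun ik => 3 * len ik.1) (w' := fun _ => 0)
    fun ik _ => ?_).mono ?_ (by simp)
  · split_ifs with h
    · exact ((rootRemCode hn _).append (wire _ _)).mono (by omega) (by omega)
    · exact (nil.append (wire _ _)).mono (by omega) (by omega)
  · rw [rangeProd, List.map_flatMap, sum_flatMap]
    simp only [List.map_map, Function.comp_def, sum_map_const, List.length_range]
    rw [sum_map_range, ← Finset.mul_sum, ← Finset.mul_sum]
    exact le_of_eq (by ring)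

theorem expandCode (hB : totalSize shape ≤ B) (hh : totalSize shape ≤ 2 ^ h)
    (ht : shape.length ≤ 2 ^ h) {D : ℕ} {J : List ℕ}
    (hJ : ∀ j ∈ J, D ≤ colSize shape j) (len : ℕ → ℕ) :
    Cost B m δ (expandCode shape m D J len)
      ((16 * (h + 1) + 7 * (chunkList (List.range m) D len).length + 6 * m + 9 * m * h) *
        (J.map (colSize shape)).sum) 0 := by
  refine (mapCode 2 _ (w := fun j => (16 * (h + 1) +
    7 * (chunkList (List.range m) D len).length + 6 * m + 9 * m * h) * colSize shape j)
    (w' := fun _ => 0) fun j hj => ?_).mono (List.sum_map_mul_left ..).le (by simp)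
  have h1 : (colSizes shape j).sum ≤ totalSize shape := colSize_le_totalSize shape j
  have h2 : (colSizes shape j).length ≤ 2 ^ h := by simpa [colSizes] using ht
  refine ((wire _ _).append (pointTreeCode (h1.trans hB) (h1.trans hh) h2)).append (wire _ _)
      |>.append (mapCode 2 _ fun i _ => (entryCode D (chunkCount D (len i))
        (chunkCount D (colSize shape j))).append (expansionCode (h1.trans hB) (h1.trans hh) h2 _))
      |>.mono ?_ (by simp)
  change 0 + 16 * colSize shape j * (h + 1) + 0 + ((List.range m).map fun i =>
    2 * chunkCount D (len i) * chunkCount D (colSize shape j) * D +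
      (3 * ((chunkCount D (len i) + chunkCount D (colSize shape j)) * D) +
        9 * colSize shape j * h)).sum ≤ _
  have h3 : chunkCount D (colSize shape j) * D ≤ 2 * colSize shape j := by
    have := chunkCount_mul_le D (colSize shape j)
    have := hJ j hj
    omega
  have h4 : ∀ i ∈ List.range m,
      2 * chunkCount D (len i) * chunkCount D (colSize shape j) * D +
      (3 * ((chunkCount D (len i) + chunkCount D (colSize shape j)) * D) +
        9 * colSize shape j * h) ≤
      7 * colSize shape j * chunkCount D (len i) + (6 + 9 * h) * colSize shape j := by
    intro i _
    have h5 := Nat.mul_le_mul_left (2 * chunkCount D (len i)) h3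
    have h6 := Nat.mul_le_mul_left (3 * chunkCount D (len i)) (hJ j hj)
    calc _ = 2 * chunkCount D (len i) * (chunkCount D (colSize shape j) * D) +
          3 * chunkCount D (len i) * D + 3 * (chunkCount D (colSize shape j) * D) +
          9 * colSize shape j * h := by ring
      _ ≤ 2 * chunkCount D (len i) * (2 * colSize shape j) +
          3 * chunkCount D (len i) * colSize shape j + 3 * (2 * colSize shape j) +
          9 * colSize shape j * h := by omega
      _ = _ := by ring
  refine (Nat.add_le_add_left (sum_map_le_sum_map h4) _).trans (le_of_eq ?_)
  rw [List.sum_map_add, List.sum_map_mul_left, sum_map_const, List.length_range, length_chunkList]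
  ring

end Cost

section Counting

variable {shape : List (List ℕ)} {m δ g : ℕ}

theorem pow_le_colSize {j : ℕ} (hg : g ≤ Nat.log 2 δ) (hj : j ∈ group shape δ g) :
    2 ^ g ≤ colSize shape j := by
  have h : level shape δ j = g := of_decide_eq_true (List.mem_filter.1 hj).2
  rw [level] at h
  split_ifs at h with h1
  · exact Nat.pow_le_of_le_log (by omega) (by omega)
  · omega

theorem colSize_lt_pow {j : ℕ} (hg : g < Nat.log 2 δ) (hj : j ∈ group shape δ g) :
    colSize shape j < 2 ^ (g + 1) := by
  have h : level shape δ j = g := of_decide_eq_true (List.mem_filter.1 hj).2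
  rw [level] at h
  split_ifs at h with h1
  · exact Nat.lt_pow_of_log_lt (by omega) (by omega)
  · omega

theorem groupHead_mem (h : group shape δ g ≠ []) : groupHead shape δ g ∈ group shape δ g := by
  unfold groupHead
  rcases hG : group shape δ g with _ | ⟨b, l⟩
  · exact absurd hG h
  · simp

theorem colSize_groupHead_le :
    colSize shape (groupHead shape δ g) ≤ ((group shape δ g).map (colSize shape)).sum := by
  rcases eq_or_ne (group shape δ g) [] with h | h
  · rw [groupHead, h, List.getD_nil, colSize]
    refine (List.sum_eq_zero fun n hn => ?_).le
    obtain ⟨a, -, rfl⟩ := List.mem_map.1 hn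
    by_contra h1
    exact absurd (lt_blockCount (Nat.one_le_iff_ne_zero.2 h1)) (lt_irrefl _)
  · exact List.single_le_sum (by simp) _ (List.mem_map_of_mem (groupHead_mem h))

theorem totalSize_le (hm : 1 ≤ m) (hδ : totalSize shape / m ≤ δ) :
    totalSize shape ≤ 2 * m * 2 ^ Nat.log 2 δ := by
  have h1 : δ + 1 ≤ 2 ^ (Nat.log 2 δ + 1) := Nat.lt_pow_succ_log_self (by omega) δ
  have h2 : totalSize shape < m * (δ + 1) :=
    ((Nat.div_lt_iff_lt_mul hm).1 (Nat.lt_succ_of_le hδ)).trans_eq (Nat.mul_comm _ _)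
  calc totalSize shape ≤ m * (δ + 1) := h2.le
    _ ≤ m * 2 ^ (Nat.log 2 δ + 1) := Nat.mul_le_mul_left _ h1
    _ = _ := by ring

/-- The number of chunks of the rows of the left factor. -/
theorem length_rows_le {c : ℕ} (hm : 1 ≤ m) (hσ : totalSize shape / m ≤ δ)
    {len : ℕ → ℕ} (hlen : ∑ i ∈ Finset.range m, len i ≤ c * totalSize shape)
    (hg : g ≤ Nat.log 2 δ) (hG : group shape δ g ≠ []) :
    (chunkList (List.range m) (2 ^ g)
      fun i => min (len i) (colSize shape (groupHead shape δ g))).length ≤ (2 * c + 2) * m := by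
  have hD : 1 ≤ 2 ^ g := Nat.one_le_two_pow
  rw [length_chunkList]
  rcases hg.lt_or_eq with h | h
  · have h1 := colSize_lt_pow h (groupHead_mem hG)
    have h2 : ∀ i ∈ List.range m, chunkCount (2 ^ g)
        (min (len i) (colSize shape (groupHead shape δ g))) ≤ 2 := by
      intro i _
      rw [chunkCount]
      refine Nat.le_of_lt_succ (Nat.div_lt_of_lt_mul ?_)
      rw [pow_succ] at h1
      omega
    refine (sum_map_le_sum_map h2).trans ?_
    rw [sum_map_const, List.length_range, Nat.mul_comm]
    exact Nat.mul_le_mul_right _ (by omega)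
  · refine Nat.le_of_mul_le_mul_right ?_ hD
    have h2 : ∀ i ∈ List.range m, chunkCount (2 ^ g)
        (min (len i) (colSize shape (groupHead shape δ g))) * 2 ^ g ≤ len i + 2 ^ g := by
      intro i _
      have := chunkCount_mul_le (2 ^ g) (min (len i) (colSize shape (groupHead shape δ g)))
      omega
    rw [← List.sum_map_mul_right]
    refine (sum_map_le_sum_map h2).trans ?_
    rw [List.sum_map_add, sum_map_const, List.length_range, sum_map_range]
    have h3 := totalSize_le hm hσ
    rw [← h] at h3
    have h4 := Nat.mul_le_mul_left c h3
    calc _ ≤ c * (2 * m * 2 ^ g) + m * 2 ^ g := by omega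
      _ ≤ c * (2 * m * 2 ^ g) + 2 * (m * 2 ^ g) := by omega
      _ = _ := by ring

/-- The number of products of blocks. -/
theorem blocks_le {c : ℕ} (hm : 1 ≤ m) (hδ : 1 ≤ δ) (hσ : totalSize shape / m ≤ δ)
    {len : ℕ → ℕ} (hlen : ∑ i ∈ Finset.range m, len i ≤ c * totalSize shape)
    (hg : g ≤ Nat.log 2 δ) :
    chunkCount m (chunkList (List.range m) (2 ^ g)
      fun i => min (len i) (colSize shape (groupHead shape δ g))).length *
      chunkCount m (chunkList (group shape δ g) (2 ^ g) (colSize shape)).length * 2 ^ g ≤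
      (10 * c + 15) * δ := by
  rcases eq_or_ne (group shape δ g) [] with hG | hG
  · have : chunkCount m 0 = 0 := Nat.div_eq_of_lt (by omega)
    simp [hG, chunkList, this]
  have hD : 1 ≤ 2 ^ g := Nat.one_le_two_pow
  have hDδ : 2 ^ g ≤ δ := Nat.pow_le_of_le_log (by omega) hg
  have h1 := length_rows_le hm hσ hlen hg hG
  set R := (chunkList (List.range m) (2 ^ g)
      fun i => min (len i) (colSize shape (groupHead shape δ g))).length
  have h2 : chunkCount m R ≤ 2 * c + 3 := by
    refine Nat.le_of_mul_le_mul_right ?_ hm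
    refine (chunkCount_mul_le _ R).trans ?_
    have : (2 * c + 3) * m = (2 * c + 2) * m + m := by ring
    omega
  have h3 : (chunkList (group shape δ g) (2 ^ g) (colSize shape)).length * 2 ^ g ≤
      2 * totalSize shape := by
    rw [length_chunkList, ← List.sum_map_mul_right]
    have h4 : ∀ j ∈ group shape δ g, chunkCount (2 ^ g) (colSize shape j) * 2 ^ g ≤
        2 * colSize shape j := by
      intro j hj
      have := chunkCount_mul_le (2 ^ g) (colSize shape j)
      have := pow_le_colSize hg hj
      omega
    refine (sum_map_le_sum_map h4).trans ?_
    rw [List.sum_map_mul_left]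
    refine Nat.mul_le_mul_left _ ?_
    refine le_trans ?_ (sum_colSize_le shape (blockCount shape))
    exact (List.Sublist.map _ List.filter_sublist).sum_le_sum (by simp)
  set Q := (chunkList (group shape δ g) (2 ^ g) (colSize shape)).length
  have h4 : chunkCount m Q * 2 ^ g ≤ 5 * δ := by
    refine Nat.le_of_mul_le_mul_right ?_ hm
    have h5 : chunkCount m Q * m ≤ Q + m := (chunkCount_mul_le _ Q).trans (by omega)
    have h6 : totalSize shape ≤ m * (δ + 1) :=
      ((Nat.div_lt_iff_lt_mul hm).1 (Nat.lt_succ_of_le hσ)).le.trans_eq (Nat.mul_comm _ _)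
    have h7 : m * (δ + 1) ≤ 2 * (m * δ) := by
      have : m * 1 ≤ m * δ := Nat.mul_le_mul_left _ hδ
      rw [Nat.mul_add]
      omega
    have h8 := Nat.mul_le_mul_left m hDδ
    calc chunkCount m Q * 2 ^ g * m = chunkCount m Q * m * 2 ^ g := by ring
      _ ≤ (Q + m) * 2 ^ g := Nat.mul_le_mul_right _ h5
      _ = Q * 2 ^ g + m * 2 ^ g := by ring
      _ ≤ 5 * (m * δ) := by omega
      _ = _ := by ring
  calc _ = chunkCount m R * (chunkCount m Q * 2 ^ g) := by ring
    _ ≤ (2 * c + 3) * (5 * δ) := Nat.mul_le_mul h2 h4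
    _ = _ := by ring

end Counting

namespace Cost

variable {B m δ : ℕ} {shape : List (List ℕ)} {h : ℕ}

theorem groupCode {c g : ℕ} (hm : 1 ≤ m) (hδ : 1 ≤ δ) (hσ : totalSize shape / m ≤ δ)
    (hB : totalSize shape ≤ B) (hh : totalSize shape ≤ 2 ^ h) (ht : shape.length ≤ 2 ^ h)
    {len : ℕ → ℕ} (hlen : ∑ i ∈ Finset.range m, len i ≤ c * totalSize shape)
    (hg : g ≤ Nat.log 2 δ) :
    Cost B m δ (groupCode shape m δ len g)
      ((61 + 14 * c) * m * (h + 1) * ((group shape δ g).map (colSize shape)).sum +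
        3 * m * (c * totalSize shape)) ((10 * c + 15) * δ) := by
  have hD : 1 ≤ 2 ^ g := Nat.one_le_two_pow
  have h1 := colSize_le_totalSize shape (groupHead shape δ g)
  have h1' : (colSizes shape (groupHead shape δ g)).sum ≤ totalSize shape := h1
  have h2 : (colSizes shape (groupHead shape δ g)).length ≤ 2 ^ h := by simpa [colSizes] using ht
  refine (wire _ _).append (pointTreeCode (h1'.trans hB) (h1'.trans hh) h2)
    |>.append (wire _ _) |>.append (reduceCode (h1.trans hB) len)
    |>.append ((wire _ _).cons ((relabel _ _).cons (wire _ _)))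
    |>.append (matCode hD (Nat.pow_le_of_le_log (by omega) hg) _ _ _ _)
    |>.append (expandCode hB hh ht (fun j hj => pow_le_colSize hg hj) _) |>.mono ?_ ?_
  · change 0 + 16 * colSize shape (groupHead shape δ g) * (h + 1) + 0 + _ + (0 + (0 + 0)) + 0 +
      _ ≤ _
    have h3 := colSize_groupHead_le (shape := shape) (δ := δ) (g := g)
    have h4 := Nat.mul_le_mul_left (3 * m) hlen
    have h5 : (16 * (h + 1) + 7 * (chunkList (List.range m) (2 ^ g)
      fun i => min (len i) (colSize shape (groupHead shape δ g))).length + 6 * m + 9 * m * h) *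
        ((group shape δ g).map (colSize shape)).sum ≤
        (45 + 14 * c) * m * (h + 1) * ((group shape δ g).map (colSize shape)).sum := by
      rcases eq_or_ne (group shape δ g) [] with hG | hG
      · simp [hG]
      refine Nat.mul_le_mul_right _ ?_
      have h6 := length_rows_le hm hσ hlen hg hG
      have h7 : h + 1 ≤ m * (h + 1) := Nat.le_mul_of_pos_left _ hm
      have h8 : 7 * ((2 * c + 2) * m) ≤ 7 * ((2 * c + 2) * m) * (h + 1) :=
        Nat.le_mul_of_pos_right _ (by omega)
      have h9 : 6 * m ≤ 6 * m * (h + 1) := Nat.le_mul_of_pos_right _ (by omega)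
      calc _ ≤ 16 * (m * (h + 1)) + 7 * ((2 * c + 2) * m) * (h + 1) + 6 * m * (h + 1) +
            (9 * m * h + 9 * m) := by omega
        _ = _ := by ring
    have h6 : 16 * colSize shape (groupHead shape δ g) * (h + 1) ≤
        16 * m * (h + 1) * ((group shape δ g).map (colSize shape)).sum := by
      calc _ ≤ 16 * ((group shape δ g).map (colSize shape)).sum * (h + 1) :=
            Nat.mul_le_mul_right _ (Nat.mul_le_mul_left _ h3)
        _ ≤ m * (16 * ((group shape δ g).map (colSize shape)).sum * (h + 1)) :=
            Nat.le_mul_of_pos_left _ hm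
        _ = _ := by ring
    have h7 : (61 + 14 * c) * m * (h + 1) * ((group shape δ g).map (colSize shape)).sum =
      16 * m * (h + 1) * ((group shape δ g).map (colSize shape)).sum +
      (45 + 14 * c) * m * (h + 1) * ((group shape δ g).map (colSize shape)).sum := by ring
    omega
  · have := blocks_le hm hδ hσ hlen hg
    omega

theorem residualCode {c : ℕ} (hm : 1 ≤ m) (hmσ : m ≤ totalSize shape)
    (hh : totalSize shape ≤ 2 ^ h) (ht : shape.length ≤ totalSize shape)
    {len : ℕ → ℕ} (hlen : ∑ i ∈ Finset.range m, len i ≤ c * totalSize shape) :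
    Cost (totalSize shape) m (totalSize shape / m) (residualCode shape m len)
      ((96 + 17 * c) * m * (h + 1) * totalSize shape)
      ((10 * c + 15) * (totalSize shape / m) * (Nat.log 2 (totalSize shape / m) + 1)) := by
  have hδ : averageSize shape m = totalSize shape / m :=
    max_eq_right ((Nat.one_le_div_iff hm).2 hmσ)
  have hδ1 : 1 ≤ totalSize shape / m := (Nat.one_le_div_iff hm).2 hmσ
  unfold Residual.residualCode
  rw [hδ]
  refine (cut _).append (cut _) |>.append ((wire _ _).cons ((rep _ _).cons ((vsub _).cons
    ((wire _ _).cons ((relabel _ _).cons (wire _ _)))))) |>.append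
    (colPolyCode hm le_rfl hh (ht.trans hh)) |>.append (rep _ _) |>.append (mapCode 4 _
      fun g hg => groupCode hm hδ1 le_rfl le_rfl hh (ht.trans hh) hlen
        (by have := List.mem_range.1 hg; omega)) |>.append (relabel _ _) |>.mono ?_ ?_
  · rw [List.sum_map_add, List.sum_map_mul_left, sum_map_const, List.length_range]
    have h1 : (List.map (fun g => ((group shape (totalSize shape / m) g).map
        (colSize shape)).sum) (List.range (Nat.log 2 (totalSize shape / m) + 1))).sum ≤
        totalSize shape :=
      (sum_filter_le (List.range (blockCount shape)) (level shape (totalSize shape / m))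
        (colSize shape) _).trans (sum_colSize_le _ _)
    have h2 := Nat.mul_le_mul_left ((61 + 14 * c) * m * (h + 1)) h1
    have h3 : Nat.log 2 (totalSize shape / m) ≤ h := by
      have : totalSize shape / m ≤ 2 ^ h := (Nat.div_le_self _ _).trans hh
      exact (Nat.log_mono_right this).trans (Nat.log_pow (by omega) h).le
    have h4 := Nat.mul_le_mul_right (3 * m * (c * totalSize shape)) (Nat.add_le_add_right h3 1)
    have h5 : totalSize shape ≤ m * (h + 1) * totalSize shape :=
      Nat.le_mul_of_pos_left _ (by positivity)
    have h6 : (96 + 17 * c) * m * (h + 1) * totalSize shape =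
      m * (h + 1) * totalSize shape + 34 * m * (h + 1) * totalSize shape +
      (61 + 14 * c) * m * (h + 1) * totalSize shape +
      (h + 1) * (3 * m * (c * totalSize shape)) := by ring
    omega
  · rw [sum_map_const, List.length_range]
    exact le_of_eq (by ring)

end Cost

/-! ### Jordan matrices and expansions -/

section

variable {K : Type*} [Field K] {L : JordanRep K}

/-- The polynomial whose coefficients are the entries of a vector in a block. -/
noncomputable def blockPoly (v : L.Index → K) (b : Fin L.blocks.length) : K[X] :=
  ∑ l : Fin (L.blocks.get b).2, monomial (l : ℕ) (v ⟨b, l⟩)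

theorem coeff_blockPoly (v : L.Index → K) (b : Fin L.blocks.length) (n : ℕ) :
    (blockPoly v b).coeff n = if h : n < (L.blocks.get b).2 then v ⟨b, ⟨n, h⟩⟩ else 0 := by
  rw [blockPoly, finsetSum_coeff]
  simp only [coeff_monomial]
  split_ifs with h
  · rw [Finset.sum_eq_single ⟨n, h⟩]
    · simp
    · intro l _ hl
      rw [if_neg fun h1 => hl (Fin.ext h1)]
    · simp
  · refine Finset.sum_eq_zero fun l _ => if_neg ?_
    have := l.2
    omega

theorem blockPoly_add (v w : L.Index → K) (b : Fin L.blocks.length) :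
    blockPoly (v + w) b = blockPoly v b + blockPoly w b := by
  simp [blockPoly, Finset.sum_add_distrib]

theorem blockPoly_smul (c : K) (v : L.Index → K) (b : Fin L.blocks.length) :
    blockPoly (c • v) b = C c * blockPoly v b := by
  ext n
  rw [coeff_C_mul, coeff_blockPoly, coeff_blockPoly]
  split_ifs <;> simp

theorem vecMul_toMatrix (v : L.Index → K) (b : Fin L.blocks.length)
    (l : Fin (L.blocks.get b).2) :
    Matrix.vecMul v L.toMatrix ⟨b, l⟩ =
      ∑ i, v ⟨b, i⟩ * jordanBlock (L.blocks.get b).1 (L.blocks.get b).2 i l := by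
  rw [Matrix.vecMul, dotProduct, Fintype.sum_sigma, Finset.sum_eq_single b]
  · simp [JordanRep.toMatrix, Matrix.blockDiagonal'_apply]
  · intro b' _ hb
    refine Finset.sum_eq_zero fun i _ => ?_
    rw [JordanRep.toMatrix, Matrix.blockDiagonal'_apply_ne _ _ _ hb, mul_zero]
  · simp

theorem blockPoly_vecMul (v : L.Index → K) (b : Fin L.blocks.length) :
    X ^ (L.blocks.get b).2 ∣ blockPoly (Matrix.vecMul v L.toMatrix) b -
      (X + C (L.blocks.get b).1) * blockPoly v b := by
  refine X_pow_dvd_iff.2 fun n hn => ?_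
  rw [coeff_sub, sub_eq_zero, coeff_blockPoly, dif_pos hn, vecMul_toMatrix, add_mul, coeff_add,
    coeff_C_mul, coeff_blockPoly v b n, dif_pos hn]
  have h1 : ∀ i : Fin (L.blocks.get b).2,
      v ⟨b, i⟩ * jordanBlock (L.blocks.get b).1 (L.blocks.get b).2 i ⟨n, hn⟩ =
      (if (i : ℕ) + 1 = n then v ⟨b, i⟩ else 0) +
        (if i = ⟨n, hn⟩ then (L.blocks.get b).1 * v ⟨b, i⟩ else 0) := by
    intro i
    simp only [jordanBlock, Matrix.of_apply]
    by_cases h : i = ⟨n, hn⟩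
    · simp [h, mul_comm]
    · by_cases h' : (i : ℕ) + 1 = n <;> simp [h, h']
  rw [Finset.sum_congr rfl fun i _ => h1 i, Finset.sum_add_distrib]
  congr 1
  · cases n with
    | zero => simp
    | succ n =>
      rw [coeff_X_mul, coeff_blockPoly, dif_pos (by omega),
        Finset.sum_eq_single ⟨n, by omega⟩]
      · simp
      · intro i _ hi
        exact if_neg fun h => hi (Fin.ext (by simpa using h))
      · simp
  · simp

/-- The action of a polynomial in the Jordan matrix on a block. -/
theorem blockPoly_vecMul_aeval (p : K[X]) (v : L.Index → K) (b : Fin L.blocks.length) :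
    X ^ (L.blocks.get b).2 ∣ blockPoly (Matrix.vecMul v (aeval L.toMatrix p)) b -
      p.comp (X + C (L.blocks.get b).1) * blockPoly v b := by
  induction p using Polynomial.induction_on with
  | C a =>
    rw [aeval_C, Algebra.algebraMap_eq_smul_one, Matrix.vecMul_smul, Matrix.vecMul_one,
      blockPoly_smul, C_comp, sub_self]
    exact dvd_zero _
  | add p q hp hq =>
    rw [map_add, Matrix.vecMul_add, blockPoly_add, add_comp]
    convert dvd_add hp hq using 1
    ring
  | monomial n a h =>
    rw [pow_succ, ← mul_assoc, map_mul, aeval_X, ← Matrix.vecMul_vecMul, mul_comp, X_comp]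
    convert dvd_add (blockPoly_vecMul (Matrix.vecMul v (aeval L.toMatrix (C a * X ^ n))) b)
      (h.mul_left (X + C (L.blocks.get b).1)) using 1
    ring

end

/-! ### The representation of the input -/

theorem flatMap_range_flatten {α β : Type*} (ls : List (List α)) (G : ℕ → List β) :
    (List.range ls.flatten.length).flatMap G = (List.range ls.length).flatMap fun a =>
      (List.range (ls.getD a []).length).flatMap fun j => G (((ls.take a).flatten).length + j) := by
  induction ls generalizing G with
  | nil => simp
  | cons l ls ih =>
    rw [List.flatten_cons, List.length_append, List.range_add, List.flatMap_append,
      List.flatMap_map, ih, List.length_cons, List.range_succ_eq_map, List.flatMap_cons,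
      List.flatMap_map]
    simp [Nat.add_assoc]

theorem getD_flatten {α : Type*} (ls : List (List α)) (d : α) {a j : ℕ}
    (hj : j < (ls.getD a []).length) :
    ((ls.take a).flatten).length + j < ls.flatten.length ∧
      ls.flatten.getD (((ls.take a).flatten).length + j) d = (ls.getD a []).getD j d := by
  induction ls generalizing a with
  | nil => simp at hj
  | cons l ls ih =>
    cases a with
    | zero =>
      simp only [List.getD_cons_zero] at hj
      refine ⟨by simp; omega, ?_⟩
      simp [List.getD_eq_getElem?_getD, List.getElem?_append_left hj]
    | succ a =>
      simp only [List.getD_cons_succ] at hj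
      obtain ⟨h1, h2⟩ := ih hj
      simp only [List.take_succ_cons, List.flatten_cons, List.length_append, List.getD_cons_succ]
      refine ⟨by omega, ?_⟩
      rw [← h2, List.getD_append_right _ _ _ _ (by omega)]
      congr 1
      omega

section

variable {K : Type*} [Field K] {m : ℕ}

/-- The eigenvalues as a function of natural numbers. -/
def pointAt (L : JordanRep K) (a : ℕ) : K := L.points.getD a 0

/-- The blocks, grouped by eigenvalue. -/
def blockLists (L : JordanRep K) : List (List (K × ℕ)) := L.map fun e => e.2.map fun s => (e.1, s)

theorem flatten_blockLists (L : JordanRep K) : (blockLists L).flatten = L.blocks := by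
  rw [blockLists, JordanRep.blocks, List.flatMap_def]

/-- The number of a block in the list of all blocks. -/
def blockIndex (L : JordanRep K) (a j : ℕ) : ℕ := (((blockLists L).take a).flatten).length + j

theorem length_getD_blockLists (L : JordanRep K) (a : ℕ) :
    ((blockLists L).getD a []).length = (L.shape.getD a []).length := by
  simp only [blockLists, JordanRep.shape, List.getD_eq_getElem?_getD, List.getElem?_map]
  cases L[a]? <;> simp

theorem getD_blockIndex {L : JordanRep K} {a j : ℕ} (hj : j < (L.shape.getD a []).length) :
    ∃ h : blockIndex L a j < L.blocks.length,
      L.blocks.get ⟨blockIndex L a j, h⟩ = (pointAt L a, blockSize L.shape a j) := by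
  obtain ⟨h1, h2⟩ := getD_flatten (blockLists L) (0, 0) (a := a) (j := j)
    (by rwa [length_getD_blockLists])
  rw [flatten_blockLists] at h1 h2
  refine ⟨h1, ?_⟩
  rw [List.getD_eq_getElem _ _ h1] at h2
  refine h2.trans ?_
  simp only [blockLists, pointAt, JordanRep.points, blockSize, JordanRep.shape,
    List.getD_eq_getElem?_getD, List.getElem?_map] at hj ⊢
  rcases h : L[a]? with _ | e
  · simp [h] at hj
  · simp only [h, Option.map_some, Option.getD_some] at hj
    simp [hj]

/-- The entries in a block as a polynomial, indexed by natural numbers. -/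
noncomputable def entryPoly {L : JordanRep K} (E : Matrix (Fin m) L.Index K) (i a j : ℕ) : K[X] :=
  if h : i < m ∧ blockIndex L a j < L.blocks.length then
    blockPoly (E ⟨i, h.1⟩) ⟨blockIndex L a j, h.2⟩ else 0

/-- The entries of a matrix, indexed by natural numbers. -/
def entryAt {R : Type*} [Zero R] (P : Matrix (Fin m) (Fin m) R) (i k : ℕ) : R :=
  if h : i < m ∧ k < m then P ⟨i, h.1⟩ ⟨k, h.2⟩ else 0

theorem entryAt_fin {R : Type*} [Zero R] (P : Matrix (Fin m) (Fin m) R) (i k : Fin m) :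
    entryAt P i k = P i k := by
  simp [entryAt]

theorem points_eq (L : JordanRep K) :
    L.points = (List.range L.shape.length).map (pointAt L) := by
  have := map_range_getD L.points [] 0 (n := L.shape.length)
    (by simp [JordanRep.points, JordanRep.shape])
  rw [List.append_nil] at this
  exact this.symm

theorem polyCoeffs_blockPoly {L : JordanRep K} (v : L.Index → K) (b : Fin L.blocks.length) :
    (List.finRange (L.blocks.get b).2).map (fun l => v ⟨b, l⟩) =
      polyCoeffs (blockPoly v b) (L.blocks.get b).2 := by
  refine List.ext_getElem (by simp) fun n h1 h2 => ?_
  have hn : n < (L.blocks.get b).2 := by simpa using h2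
  simp only [polyCoeffs, List.getElem_map, List.getElem_range, coeff_blockPoly, dif_pos hn,
    List.getElem_finRange]
  rfl

theorem entries_eq (L : JordanRep K) (E : Matrix (Fin m) L.Index K) :
    entries L E = (entryLabels L.shape m).map (entryCoeff (entryPoly E)) := by
  have h1 : (entryLabels L.shape m).map (entryCoeff (entryPoly E)) =
      (List.range m).flatMap fun i => (List.range L.shape.length).flatMap fun a =>
        (List.range (L.shape.getD a []).length).flatMap fun j =>
          polyCoeffs (entryPoly E i a j) (blockSize L.shape a j) := by
    simp [entryLabels, List.map_flatMap, polyCoeffs, Function.comp_def, entryCoeff]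
  rw [h1, entries, ← flatMap_finRange]
  refine List.flatMap_congr fun i _ => ?_
  have h2 := flatMap_finRange L.blocks.length fun b =>
    if h : b < L.blocks.length then
      polyCoeffs (blockPoly (E i) ⟨b, h⟩) (L.blocks.get ⟨b, h⟩).2 else []
  simp only [Fin.is_lt, dite_true, Fin.eta] at h2
  simp only [polyCoeffs_blockPoly]
  have h7 := flatMap_range_flatten (blockLists L) fun b =>
    if h : b < L.blocks.length then
      polyCoeffs (blockPoly (E i) ⟨b, h⟩) (L.blocks.get ⟨b, h⟩).2 else []
  rw [flatten_blockLists] at h7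
  rw [h2, h7]
  have h3 : (blockLists L).length = L.shape.length := by simp [blockLists, JordanRep.shape]
  rw [h3]
  refine List.flatMap_congr fun a _ => ?_
  rw [length_getD_blockLists]
  refine List.flatMap_congr fun j hj => ?_
  obtain ⟨h4, h5⟩ := getD_blockIndex (List.mem_range.1 hj)
  have h6 : (L.blocks.get ⟨blockIndex L a j, h4⟩).2 = blockSize L.shape a j := by rw [h5]
  refine (dif_pos h4).trans ?_
  rw [entryPoly, dif_pos ⟨i.2, h4⟩, ← h6]
  rfl

theorem matCoeffs_eq (P : Matrix (Fin m) (Fin m) K[X]) (d : Fin m → ℕ) :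
    matCoeffs P d = (labels (List.range m) m fun i => (List.ofFn d).getD i 0 + 1).map
      (coeffAt (entryAt P)) := by
  rw [map_coeffAt_labels, ← flatMap_finRange, matCoeffs]
  refine List.flatMap_congr fun i _ => ?_
  rw [← flatMap_finRange]
  refine List.flatMap_congr fun k _ => ?_
  rw [entryAt_fin]
  congr 2
  simp [List.getD_eq_getElem?_getD]

/-- The residual in terms of expansions at the eigenvalues. -/
theorem entries_residualMatrix (L : JordanRep K) (P : Matrix (Fin m) (Fin m) K[X])
    (E : Matrix (Fin m) L.Index K) :
    entries L (residualMatrix L.toMatrix P E) = (entryLabels L.shape m).map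
      (entryCoeff (productAt m (pointAt L) (entryAt P) (entryPoly E))) := by
  rw [entries_eq]
  refine List.map_congr_left fun y hy => ?_
  obtain ⟨i, a, j, l⟩ := y
  obtain ⟨hi, ha, hl⟩ := mem_entryLabels.1 hy
  have hj : j < (L.shape.getD a []).length := by
    by_contra h
    rw [blockSize_eq_zero (by omega)] at hl
    omega
  obtain ⟨h1, h2⟩ := getD_blockIndex hj
  have h3 : (L.blocks.get ⟨blockIndex L a j, h1⟩).2 = blockSize L.shape a j := by rw [h2]
  have h4 : (L.blocks.get ⟨blockIndex L a j, h1⟩).1 = pointAt L a := by rw [h2]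
  simp only [entryCoeff, productAt, Finset.sum_range, finsetSum_coeff]
  rw [entryPoly, dif_pos ⟨hi, h1⟩, coeff_blockPoly, dif_pos (by rwa [h3])]
  rw [residualMatrix, Matrix.of_apply, Finset.sum_apply]
  refine Finset.sum_congr rfl fun k _ => ?_
  have h5 := X_pow_dvd_iff.1 (blockPoly_vecMul_aeval (P ⟨i, hi⟩ k) (E k) ⟨blockIndex L a j, h1⟩)
    l (by rwa [h3])
  rw [coeff_sub, sub_eq_zero, coeff_blockPoly, dif_pos (by rwa [h3])] at h5
  rw [h5, h4, entryPoly, dif_pos ⟨k.2, h1⟩, entryAt, dif_pos ⟨hi, k.2⟩]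

theorem degree_entryAt_lt (P : Matrix (Fin m) (Fin m) K[X]) {i k : ℕ} (hi : i < m) (hk : k < m) :
    (entryAt P i k).degree < ((List.ofFn (rowDegree P)).getD i 0 + 1 : ℕ) := by
  rw [entryAt, dif_pos ⟨hi, hk⟩]
  have h1 : (P ⟨i, hi⟩ ⟨k, hk⟩).natDegree ≤ rowDegree P ⟨i, hi⟩ :=
    Finset.le_sup (f := fun k => (P ⟨i, hi⟩ k).natDegree) (Finset.mem_univ _)
  have h2 : (List.ofFn (rowDegree P)).getD i 0 = rowDegree P ⟨i, hi⟩ := by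
    simp [List.getD_eq_getElem?_getD, hi]
  rw [h2]
  refine (degree_le_natDegree).trans_lt ?_
  exact_mod_cast Nat.lt_succ_of_le h1

theorem pointAt_injective {L : JordanRep K} (hL : L.IsStandard) :
    ∀ i < L.shape.length, ∀ j < L.shape.length, pointAt L j = pointAt L i → j = i := by
  intro i hi j hj h
  have hlen : L.shape.length = L.points.length := by simp [JordanRep.points, JordanRep.shape]
  rw [hlen] at hi hj
  rw [pointAt, pointAt, List.getD_eq_getElem _ _ hi, List.getD_eq_getElem _ _ hj] at h
  exact (List.Nodup.getElem_inj_iff hL.nodup).1 h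

theorem descending_shape {L : JordanRep K} (hL : L.IsStandard) : Descending L.shape := by
  intro a i j hij
  rcases hij.eq_or_lt with rfl | hij
  · exact le_rfl
  rcases lt_or_ge j (L.shape.getD a []).length with hj | hj
  · have ha : a < L.shape.length := by
      by_contra h
      rw [List.getD_eq_default _ _ (not_lt.1 h)] at hj
      simp at hj
    rw [blockSize, blockSize, List.getD_eq_getElem _ _ hj,
      List.getD_eq_getElem _ _ (hij.trans hj)]
    have h1 : L.shape.getD a [] ∈ L.shape := by
      rw [List.getD_eq_getElem _ _ ha]
      exact List.getElem_mem ha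
    obtain ⟨e, he, h2⟩ := List.mem_map.1 h1
    have h3 := hL.sizes e he
    rw [h2] at h3
    exact List.pairwise_iff_getElem.1 h3 i j _ _ hij
  · rw [blockSize_eq_zero hj]
    exact Nat.zero_le _

theorem totalSize_shape (L : JordanRep K) : totalSize L.shape = L.order := by
  simp [totalSize, JordanRep.shape, JordanRep.order, JordanRep.blocks, List.map_flatMap,
    sum_flatMap, Function.comp_def]

theorem length_shape_le {L : JordanRep K} (hL : L.IsStandard) : L.shape.length ≤ L.order := by
  rw [← totalSize_shape, totalSize]
  have h : ∀ l ∈ L.shape, 1 ≤ l.sum := by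
    intro l hl
    obtain ⟨e, he, rfl⟩ := List.mem_map.1 hl
    obtain ⟨s, hs⟩ := List.exists_mem_of_ne_nil _ (hL.ne_nil e he)
    exact (hL.pos e he s hs).trans (List.single_le_sum (by simp) _ hs)
  have := sum_map_le_sum_map (f := fun _ => 1) h
  rw [sum_map_const, mul_one] at this
  exact this

end

/-! ### Counting field operations -/

theorem zipProgram_cost (o : Op) (n : ℕ) : (zipProgram o n).cost = n := by
  simp [zipProgram, Program.cost, Function.comp_def, Instr.cost]

/-- The number of field operations in terms of the weights. -/
theorem vcost_le {mul : ℕ → Program} {mmulP : ℕ → ℕ → Program} {B m δ : ℕ} {μ ν : ℝ}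
    (hμ : 1 ≤ μ) (hν : 0 ≤ ν) (hmul : ∀ d, 1 ≤ d → d ≤ B → ((mul d).cost : ℝ) ≤ μ * d)
    (hmmul : ∀ d, 1 ≤ d → d ≤ δ → ((mmulP m d).cost : ℝ) ≤ ν * d) {i : VInstr}
    (hi : Admissible B m δ i) :
    (vcost (subProgram mul mmulP) i : ℝ) ≤ μ * wt i + ν * mwt i := by
  obtain ⟨n, l⟩ := i
  obtain ⟨h1, h2, h3⟩ := hi
  simp only at h1 h2 h3
  have hz : ∀ n : ℕ, (n : ℝ) ≤ μ * n := fun n => le_mul_of_one_le_left n.cast_nonneg hμ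
  unfold vcost
  split_ifs with h4
  · push_cast
    positivity
  simp only [not_lt] at h4
  interval_cases n
  · simp [subProgram, wt, mwt, Program.cost, Instr.cost]
  · simp [subProgram, wt, mwt, Program.cost, Instr.cost]
  · simpa [subProgram, wt, mwt, zipProgram_cost] using hz (l.getD 0 0)
  · simpa [subProgram, wt, mwt, zipProgram_cost] using hz (l.getD 0 0)
  · simpa [subProgram, wt, mwt, zipProgram_cost] using hz (l.getD 0 0)
  · simpa [subProgram, wt, mwt] using hmul _ (h2 rfl).1 (h2 rfl).2
  · obtain ⟨h5, h6, h7⟩ := h3 rfl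
    simpa [subProgram, wt, mwt, ← h5] using hmmul _ h6 h7

theorem Cost.expand_cost_le {mul : ℕ → Program} {mmulP : ℕ → ℕ → Program} {B m δ w w' : ℕ}
    {μ ν : ℝ} (hμ : 1 ≤ μ) (hν : 0 ≤ ν)
    (hmul : ∀ d, 1 ≤ d → d ≤ B → ((mul d).cost : ℝ) ≤ μ * d)
    (hmmul : ∀ d, 1 ≤ d → d ≤ δ → ((mmulP m d).cost : ℝ) ≤ ν * d) {c : VCode}
    (hc : Cost B m δ c w w') (n : ℕ) :
    ((expand (subProgram mul mmulP) n c).cost : ℝ) ≤ μ * w + ν * w' := by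
  have key : ∀ c : VCode, (∀ i ∈ c, Admissible B m δ i) →
      ((c.map (vcost (subProgram mul mmulP))).sum : ℝ) ≤
        μ * (c.map wt).sum + ν * (c.map mwt).sum := by
    intro c
    induction c with
    | nil => simp
    | cons i c ih =>
      intro h
      have h1 := vcost_le hμ hν hmul hmmul (h i (by simp))
      have h2 := ih fun j hj => h j (by simp [hj])
      simp only [List.map_cons, List.sum_cons]
      push_cast at h2 ⊢
      linarith
  rw [expand_cost]
  have h3 : ((c.map wt).sum : ℝ) ≤ w := by exact_mod_cast hc.wt_le
  have h4 : ((c.map mwt).sum : ℝ) ≤ w' := by exact_mod_cast hc.mwt_le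
  refine (key c hc.adm).trans ?_
  gcongr

/-- The program for the residual, given the shape of the Jordan matrix and the row degrees. -/
def residualProgram (mul : ℕ → Program) (mmulP : ℕ → ℕ → Program) (shape : List (List ℕ))
    (degs : List ℕ) : Program :=
  expand (subProgram mul mmulP)
    (shape.length + ((labels (List.range degs.length) degs.length
      fun i => degs.getD i 0 + 1).length + (entryLabels shape degs.length).length))
    (residualCode shape degs.length fun i => degs.getD i 0 + 1)

theorem residualProgram_computable {mul : ℕ → Program} {mmulP : ℕ → ℕ → Program}
    (hmul : Computable mul) (hmmul : Computable₂ mmulP) :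
    Computable₂ (residualProgram mul mmulP) := by
  unfold residualProgram
  exact expand_computable (α := List (List ℕ) × List ℕ) (subProgram_computable hmul hmmul)
    (by fun_prop) (by fun_prop)

theorem residualProgram_eval {K : Type*} [Field K] (A : Arith K) {L : JordanRep K}
    (hL : L.IsStandard) {m : ℕ} (hm : 1 ≤ m) (P : Matrix (Fin m) (Fin m) K[X])
    (E : Matrix (Fin m) L.Index K) :
    (residualProgram A.mulP A.mmulP L.shape (List.ofFn (rowDegree P))).eval A.κ
      (residualInput L P E) = some (entries L (residualMatrix L.toMatrix P E)) := by
  have h := run_residualCode A (m := m) (p := entryAt P)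
    (len := fun i => (List.ofFn (rowDegree P)).getD i 0 + 1) (descending_shape hL) hm
    (pointAt_injective hL) (fun i hi k hk => degree_entryAt_lt P hi hk) (entryPoly E)
  rw [← entries_residualMatrix, ← entries_eq, ← points_eq, ← matCoeffs_eq, ← List.append_assoc] at h
  have h1 := expand_eval _ h
  unfold residualProgram
  simp only [List.length_ofFn]
  rw [residualInput]
  convert h1 using 2
  rw [matCoeffs_eq, entries_eq, points_eq]
  simp

theorem natLog_le_logb_of_le {n : ℕ} {x : ℝ} (h : (n : ℝ) ≤ x) (hn : 1 ≤ n) :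
    (Nat.log 2 n : ℝ) ≤ Real.logb 2 x :=
  (Real.natLog_le_logb n 2).trans
    (Real.logb_le_logb_of_le (by norm_num) (by exact_mod_cast hn) h)

theorem residualProgram_cost {mul : ℕ → Program} {mmulP : ℕ → ℕ → Program} {M : ℕ → ℝ}
    {MM : ℕ → ℕ → ℝ} (hmul : ∀ d, 1 ≤ d → ((mul d).cost : ℝ) ≤ M d)
    (hM : ∀ a b : ℕ, 1 ≤ a → a ≤ b → M a / a ≤ M b / b) (hM' : ∀ d : ℕ, 1 ≤ d → (d : ℝ) ≤ M d)
    (hmmul : ∀ m d, 1 ≤ m → 1 ≤ d → ((mmulP m d).cost : ℝ) ≤ MM m d)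
    (hMM : ∀ m a b : ℕ, 1 ≤ m → 1 ≤ a → a ≤ b → MM m a / a ≤ MM m b / b)
    {shape : List (List ℕ)} {degs : List ℕ} {σ m : ℕ} (hσ : totalSize shape = σ)
    (hdegs : degs.length = m) (hm : 1 ≤ m) (hmσ : m ≤ σ) (hs : shape.length ≤ σ) {c : ℕ}
    (hc : ∑ i ∈ Finset.range m, (degs.getD i 0 + 1) ≤ c * σ) :
    ((residualProgram mul mmulP shape degs).cost : ℝ) ≤
      (192 + 34 * c) * (MM m (σ / m) * (1 + Real.logb 2 ((σ : ℝ) / m)) +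
        m * M σ * (1 + Real.logb 2 σ)) := by
  subst hdegs hσ
  set σ := totalSize shape
  set m := degs.length
  have hδ : 1 ≤ σ / m := (Nat.one_le_div_iff hm).2 hmσ
  have hσ0 : (1 : ℝ) ≤ σ := by exact_mod_cast hm.trans hmσ
  have hδ0 : (1 : ℝ) ≤ (σ / m : ℕ) := by exact_mod_cast hδ
  have hMσ := hM' σ (hm.trans hmσ)
  have hMM0 : 0 ≤ MM m (σ / m) := le_trans (Nat.cast_nonneg _) (hmmul m (σ / m) hm hδ)
  have h1 : 1 ≤ M σ / σ := (one_le_div (by linarith)).2 hMσ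
  have h2 : 0 ≤ MM m (σ / m) / (σ / m : ℕ) := by positivity
  have h3 := Cost.expand_cost_le h1 h2
    (fun d hd hdB => (hmul d hd).trans ((div_le_iff₀ (by exact_mod_cast hd)).1 (hM d σ hd hdB)))
    (fun d hd hdδ => (hmmul m d hm hd).trans
      ((div_le_iff₀ (by exact_mod_cast hd)).1 (hMM m d (σ / m) hm hd hdδ)))
    (Cost.residualCode (h := Nat.log 2 σ + 1) hm hmσ (Nat.lt_pow_succ_log_self (by omega) σ).le
      hs hc) (shape.length + ((labels (List.range m) m
      fun i => degs.getD i 0 + 1).length + (entryLabels shape m).length))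
  refine h3.trans ?_
  have h4 : (Nat.log 2 (σ / m) : ℝ) ≤ Real.logb 2 ((σ : ℝ) / m) :=
    natLog_le_logb_of_le Nat.cast_div_le hδ
  have h5 : (Nat.log 2 σ : ℝ) ≤ Real.logb 2 σ := natLog_le_logb_of_le le_rfl (hm.trans hmσ)
  have h6 : (0 : ℝ) ≤ Nat.log 2 σ := Nat.cast_nonneg _
  have h7 : (0 : ℝ) ≤ Nat.log 2 (σ / m) := Nat.cast_nonneg _
  have h8 : M σ / σ * ((96 + 17 * c) * m * (Nat.log 2 σ + 1 + 1) * σ) =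
      (96 + 17 * c) * (m * M σ * (Nat.log 2 σ + 2)) := by
    field_simp
    ring
  have h9 : MM m (σ / m) / (σ / m : ℕ) * ((10 * c + 15) * (σ / m : ℕ) * (Nat.log 2 (σ / m) + 1)) =
      (10 * c + 15) * (MM m (σ / m) * (Nat.log 2 (σ / m) + 1)) := by
    field_simp
  have hc0 : (0 : ℝ) ≤ c := Nat.cast_nonneg c
  have h10 : (96 + 17 * c : ℝ) * (m * M σ * (Nat.log 2 σ + 2)) ≤
      (192 + 34 * c) * (m * M σ * (1 + Real.logb 2 σ)) := by
    have : (0 : ℝ) ≤ m * M σ := mul_nonneg (Nat.cast_nonneg _) (by linarith)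
    have h11 : (m * M σ * (Nat.log 2 σ + 2) : ℝ) ≤ m * M σ * (2 * (1 + Real.logb 2 σ)) :=
      mul_le_mul_of_nonneg_left (by linarith) this
    calc _ ≤ (96 + 17 * c : ℝ) * (m * M σ * (2 * (1 + Real.logb 2 σ))) :=
          mul_le_mul_of_nonneg_left h11 (by positivity)
      _ = _ := by ring
  have h12 : (10 * c + 15 : ℝ) * (MM m (σ / m) * (Nat.log 2 (σ / m) + 1)) ≤
      (192 + 34 * c) * (MM m (σ / m) * (1 + Real.logb 2 ((σ : ℝ) / m))) := by
    refine mul_le_mul (by linarith) (mul_le_mul_of_nonneg_left (by linarith) hMM0)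
      (by positivity) (by positivity)
  push_cast at h8 h9 ⊢
  rw [h8, h9, mul_add]
  linarith

end Residual

end

theorem mainTheorem6 :
    ∃ C : ℝ → ℝ,
      ∀ (K : Type*) [Field K] (κ : ℕ → K) (M : ℕ → ℝ) (MM : ℕ → ℕ → ℝ),
        IsPolyMulTime κ M → IsMatMulTime κ MM →
        ∃ computeResiduals : List (List ℕ) → List ℕ → Program,
          Computable₂ computeResiduals ∧
          ∀ (L : JordanRep K), L.IsStandard →
          ∀ (m : ℕ), 1 ≤ m →
          ∀ (P : Matrix (Fin m) (Fin m) (Polynomial K)) (E : Matrix (Fin m) L.Index K),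
            (computeResiduals L.shape (List.ofFn (rowDegree P))).eval κ (residualInput L P E) =
              some (entries L (residualMatrix L.toMatrix P E)) ∧
            ∀ c : ℝ, m ≤ L.order → ((∑ i, rowDegree P i : ℕ) : ℝ) ≤ c * L.order →
              ((computeResiduals L.shape (List.ofFn (rowDegree P))).cost : ℝ) ≤
                C c * (MM m (L.order / m) * (1 + Real.logb 2 ((L.order : ℝ) / m))
                  + m * M L.order * (1 + Real.logb 2 L.order)) := by
  refine ⟨fun c => 192 + 34 * ((⌈c⌉₊ + 1 : ℕ) : ℝ), ?_⟩
  intro K _ κ M MM hM hMM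
  obtain ⟨mul, hmul, hmul'⟩ := hM.exists_algorithm
  obtain ⟨mmul, hmmul, hmmul'⟩ := hMM.exists_algorithm
  refine ⟨Residual.residualProgram mul mmul, Residual.residualProgram_computable hmul hmmul, ?_⟩
  intro L hL m hm P E
  refine ⟨Residual.residualProgram_eval
    ⟨κ, mul, mmul, fun d hd => (hmul' d hd).2, fun m d hm hd => (hmmul' m d hm hd).2⟩ hL hm P E, ?_⟩
  intro c hσ hc
  refine Residual.residualProgram_cost (fun d hd => (hmul' d hd).1) hM.superlinear hM.le_self
    (fun m d hm hd => (hmmul' m d hm hd).1) hMM.superlinear (Residual.totalSize_shape L)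
    (by simp) hm hσ (Residual.length_shape_le hL) ?_
  have h1 : ∑ i ∈ Finset.range m, ((List.ofFn (rowDegree P)).getD i 0 + 1) =
      ∑ i, rowDegree P i + m := by
    rw [Finset.sum_range, Finset.sum_add_distrib]
    simp [List.getD_eq_getElem?_getD]
  have h2 : ∑ i, rowDegree P i ≤ ⌈c⌉₊ * L.order := by
    have : ((∑ i, rowDegree P i : ℕ) : ℝ) ≤ (⌈c⌉₊ : ℝ) * L.order :=
      hc.trans (mul_le_mul_of_nonneg_right (Nat.le_ceil c) (Nat.cast_nonneg _))
    exact_mod_cast this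
  rw [h1, Nat.add_mul, Nat.one_mul]
  omega
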